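/- Let $d\ge 2$, let $V\in L_\infty(\mathbb{R}^d)$ be real-valued, and let $H=-\Delta+M_V$ be the Schrödinger operator on $L_2(\mathbb{R}^d)$ with domain $\{u\in L_2:\Delta u\in L_2\}=H^2(\mathbb{R}^d)$, where $M_f$ denotes multiplication by $f$. Write $\langle x\rangle=(1+|x|^2)^{1/2}$ and $B(0,R)$ for the Euclidean ball. Assume that the density of states of $H$ exists, i.e. that there is a Borel measure $\nu_H$ on $\mathbb{R}$ such that for every bounded interval $I\subset\mathbb{R}$ $$\nu_H(I)=\lim_{R\to\infty}\frac{1}{|B(0,R)|}\,\mathrm{Tr}\big(M_{\chi_{B(0,R)}}\chi_I(H)M_{\chi_{B(0,R)}}\big)<\infty .$$ Let $s>0$. Then $e^{-s\lambda}$ is $\nu_H$-integrable and the following hold. (i) $e^{-sH}$ is an integral operator on $L_2(\mathbb{R}^d)$. For every measurable integral kernel $K_{s,V}$ of it, the Lebesgue averaged diagonal $$K_{s,V}(x,x):=\lim_{\varepsilon\downarrow0}\frac{1}{|B(x,\varepsilon)|^2}\int_{B(x,\varepsilon)\times B(x,\varepsilon)}K_{s,V}(y,z)\,dy\,dz$$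 exists for almost every $x$, the function $\langle x\rangle^{-dr}K_{s,V}(x,x)$ is integrable for all $r>1$, and $$\int_{\mathbb{R}}e^{-s\lambda}\,d\nu_H(\lambda)=\frac{1}{|B(0,1)|}\lim_{r\downarrow1}(r-1)\int_{\mathbb{R}^d}\langle x\rangle^{-dr}K_{s,V}(x,x)\,dx .$$ (ii) For all $r>1$ the operator $e^{-sH}M_{\langle x\rangle}^{-dr}$ is of trace class, and $$\int_{\mathbb{R}}e^{-s\lambda}\,d\nu_H(\lambda)=\frac{1}{|B(0,1)|}\lim_{r\downarrow1}(r-1)\,\mathrm{Tr}\big(e^{-sH}M_{\langle x\rangle}^{-dr}\big).$$ -/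

import Mathlib

open MeasureTheory Filter Topology
open scoped ENNReal InnerProductSpace SchwartzMap Laplacian CompactlySupported ComplexOrder

noncomputable section

namespace DensityOfStates

/-! ### Operators on a complex Hilbert space -/

section Hilbert

variable {E : Type*} [NormedAddCommGroup E] [InnerProductSpace ℂ E] [CompleteSpace E]

/-- The `k`-th singular value (approximation number) of a bounded operator,
`μ(k, T) = inf { ‖T - R‖ : rank R ≤ k }`. -/
def singularValue (k : ℕ) (T : E →L[ℂ] E) : ℝ :=
  sInf {c : ℝ | ∃ R : E →L[ℂ] E, R.toLinearMap.rank ≤ (k : Cardinal) ∧ c = ‖T - R‖}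

/-- The trace class `𝓛₁`: compact operators with summable singular values. -/
def IsTraceClass (T : E →L[ℂ] E) : Prop :=
  IsCompactOperator T ∧ Summable fun k : ℕ => singularValue k T

/-- The trace `∑ ⟨e, T e⟩` over an orthonormal basis (independent of the basis if `T` is of
trace class). -/
def trace (T : E →L[ℂ] E) : ℂ :=
  ∑' e : (exists_hilbertBasis ℂ E).choose, ⟪(e : E), T e⟫_ℂ

/-- `R` is a bounded two-sided inverse of `A - z : dom A → E`, that is, `R = (A - z)⁻¹`. -/
def IsResolventAt (A : E →ₗ.[ℂ] E) (z : ℂ) (R : E →L[ℂ] E) : Prop :=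
  (∀ x : E, ∃ h : R x ∈ A.domain, A ⟨R x, h⟩ - z • R x = x) ∧
    ∀ u : A.domain, R (A u - z • (u : E)) = u

open Classical in
/-- The resolvent `(A - z)⁻¹`; the value is `0` if `z` is in the spectrum of `A`. -/
def resolventAt (A : E →ₗ.[ℂ] E) (z : ℂ) : E →L[ℂ] E :=
  if h : ∃ R : E →L[ℂ] E, IsResolventAt A z R then h.choose else 0

/-- The Cayley transform `U = (A - i)(A + i)⁻¹ = 1 - 2i (A + i)⁻¹`. -/
def cayley (A : E →ₗ.[ℂ] E) : E →L[ℂ] E :=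
  1 - (2 * Complex.I) • resolventAt A (-Complex.I)

/-- The inverse `w ↦ i (1 + w) / (1 - w)` of the scalar Cayley transform
`t ↦ (t - i) / (t + i)`; it is real on the unit circle without `1`. -/
def invCayley (w : ℂ) : ℝ := (Complex.I * (1 + w) / (1 - w)).re

/-- The positive linear functional `f ↦ ⟨ψ, f(U) ψ⟩` on `C_c(ℂ)`, where `f(U)` is given by the
continuous functional calculus of the normal operator `U`. -/
def spectralFunctional (U : E →L[ℂ] E) (ψ : E) : C_c(ℂ, ℝ) →ₚ[ℝ] ℝ :=
  PositiveLinearMap.mk₀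
    { toFun := fun f => (⟪ψ, cfc (fun w : ℂ => ((f w : ℝ) : ℂ)) U ψ⟫_ℂ).re
      map_add' := by
        intro f g
        by_cases hU : IsStarNormal U
        · have h : cfc (fun w : ℂ => (((f + g) w : ℝ) : ℂ)) U
              = cfc (fun w : ℂ => ((f w : ℝ) : ℂ)) U + cfc (fun w : ℂ => ((g w : ℝ) : ℂ)) U := by
            rw [← cfc_add U (fun w : ℂ => ((f w : ℝ) : ℂ)) (fun w : ℂ => ((g w : ℝ) : ℂ))
              (Complex.continuous_ofReal.comp f.continuous).continuousOn
              (Complex.continuous_ofReal.comp g.continuous).continuousOn]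
            simp
          rw [h]
          simp
        · simp [cfc_apply_of_not_predicate U hU]
      map_smul' := by
        intro c f
        by_cases hU : IsStarNormal U
        · have h : cfc (fun w : ℂ => (((c • f) w : ℝ) : ℂ)) U
              = (c : ℂ) • cfc (fun w : ℂ => ((f w : ℝ) : ℂ)) U := by
            rw [← cfc_smul (c : ℂ) (fun w : ℂ => ((f w : ℝ) : ℂ)) U
              (Complex.continuous_ofReal.comp f.continuous).continuousOn]
            simp
          rw [h]
          simp
        · simp [cfc_apply_of_not_predicate U hU] }
    (by
      intro f hf
      have h : 0 ≤ cfc (fun w : ℂ => ((f w : ℝ) : ℂ)) U :=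
        cfc_nonneg fun w _ => by simpa using hf w
      rw [ContinuousLinearMap.nonneg_iff_isPositive] at h
      simpa using h.re_inner_nonneg_right ψ)

/-- The spectral measure `μ_ψ = ⟨ψ, E(·) ψ⟩` on `ℝ` of a self-adjoint operator `A`: the Riesz
measure of the Cayley transform at `ψ`, transported from the unit circle to the real line. -/
def spectralMeasure (A : E →ₗ.[ℂ] E) (ψ : E) : Measure ℝ :=
  (RealRMK.rieszMeasure (spectralFunctional (cayley A) ψ)).map invCayley

/-- `T = f(A) = ∫ f dE` in the sense of the Borel functional calculus:
`⟨ψ, T ψ⟩ = ∫ f dμ_ψ` for all `ψ`. -/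
def IsBorelCalculus (A : E →ₗ.[ℂ] E) (f : ℝ → ℂ) (T : E →L[ℂ] E) : Prop :=
  ∀ ψ : E, Integrable f (spectralMeasure A ψ) ∧ ⟪ψ, T ψ⟫_ℂ = ∫ t, f t ∂(spectralMeasure A ψ)

open Classical in
/-- The bounded operator `f(A)` of the Borel functional calculus of a self-adjoint operator `A`,
for `f` Borel and bounded on the spectrum of `A` (it is unique by polarization). -/
def borelCalculus (A : E →ₗ.[ℂ] E) (f : ℝ → ℂ) : E →L[ℂ] E :=
  if h : ∃ T : E →L[ℂ] E, IsBorelCalculus A f T then h.choose else 0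

end Hilbert

/-! ### Schrödinger operators on `ℝ^d` -/

/-- `ℝ^d` with the Euclidean norm. -/
abbrev Space (d : ℕ) : Type := EuclideanSpace ℝ (Fin d)

/-- The complex Hilbert space `L₂(ℝ^d)`. -/
abbrev L2 (d : ℕ) : Type := Lp ℂ 2 (volume : Measure (Space d))

open Classical in
/-- The operator `M_f` of multiplication by `f ∈ L_∞(ℝ^d)` on `L₂(ℝ^d)`. -/
def mulOp {d : ℕ} (f : Space d → ℂ) : L2 d →L[ℂ] L2 d :=
  if h : MemLp f ∞ (volume : Measure (Space d)) then
    (ContinuousLinearMap.mul ℂ ℂ).holderL volume ∞ 2 2 (h.toLp f)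
  else 0

/-- The graph of `-Δ` in `L₂(ℝ^d)`, with `Δ` in the sense of distributions. -/
def negLaplacianGraph (d : ℕ) : Submodule ℂ (L2 d × L2 d) where
  carrier := {p | -Δ (Lp.toTemperedDistributionCLM ℂ volume 2 p.1 : 𝓢'(Space d, ℂ))
    = Lp.toTemperedDistributionCLM ℂ volume 2 p.2}
  add_mem' := by
    intro a b ha hb
    simp only [Set.mem_ofPred_eq, ← TemperedDistribution.laplacianCLM_apply, Prod.fst_add,
      Prod.snd_add, map_add, neg_add] at *
    rw [ha, hb]
  zero_mem' := by
    simp only [Set.mem_ofPred_eq, ← TemperedDistribution.laplacianCLM_apply, Prod.fst_zero,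
      Prod.snd_zero, map_zero, neg_zero]
  smul_mem' := by
    intro c a ha
    simp only [Set.mem_ofPred_eq, ← TemperedDistribution.laplacianCLM_apply, Prod.smul_fst,
      Prod.smul_snd, map_smul, ← smul_neg] at *
    rw [ha]

/-- The operator `-Δ` on `L₂(ℝ^d)`, with domain `{u ∈ L₂ : Δ u ∈ L₂} = H²(ℝ^d)`. -/
def negLaplacian (d : ℕ) : L2 d →ₗ.[ℂ] L2 d := (negLaplacianGraph d).toLinearPMap

/-- The Schrödinger operator `H = -Δ + M_V` on the domain of `-Δ`. -/
def schrodinger {d : ℕ} (V : Space d → ℝ) : L2 d →ₗ.[ℂ] L2 d :=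
  (mulOp fun x => (V x : ℂ)).toLinearMap +ᵥ negLaplacian d

/-- The operator `χ_I(H)`. -/
def spectralProjection {d : ℕ} (V : Space d → ℝ) (I : Set ℝ) : L2 d →L[ℂ] L2 d :=
  borelCalculus (schrodinger V) (I.indicator 1)

/-- The operator `e^{-sH}`. -/
def heatOp {d : ℕ} (V : Space d → ℝ) (s : ℝ) : L2 d →L[ℂ] L2 d :=
  borelCalculus (schrodinger V) fun t => (Real.exp (-s * t) : ℂ)

/-- The Lebesgue measure of the ball `B(0, R)` in `ℝ^d`. -/
def ballVol (d : ℕ) (R : ℝ) : ℝ := (volume (Metric.ball (0 : Space d) R)).toReal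

/-- The operator `M_χ` for `χ` the indicator function of `B(0, R)`. -/
def ballCutoff (d : ℕ) (R : ℝ) : L2 d →L[ℂ] L2 d :=
  mulOp ((Metric.ball (0 : Space d) R).indicator 1)

/-- The density of states of `H = -Δ + M_V` exists and is the Borel measure `ν`: for every bounded
interval `I`, `ν(I) = lim_{R → ∞} |B(0,R)|⁻¹ Tr (M_χ χ_I(H) M_χ)`, `χ = χ_{B(0,R)}`. -/
def IsDensityOfStates {d : ℕ} (V : Space d → ℝ) (ν : Measure ℝ) : Prop :=
  ∀ I : Set ℝ, I.OrdConnected → Bornology.IsBounded I →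
    ν I ≠ ∞ ∧
    Tendsto (fun R : ℝ => (ballVol d R : ℂ)⁻¹ *
        trace (ballCutoff d R ∘L spectralProjection V I ∘L ballCutoff d R))
      atTop (𝓝 ((ν I).toReal : ℂ))

/-- `⟨x⟩ = (1 + |x|²)^{1/2}`. -/
def bracket {d : ℕ} (x : Space d) : ℝ := Real.sqrt (1 + ‖x‖ ^ 2)

/-- `T` is the integral operator on `L₂(ℝ^d)` with the measurable kernel `K`. -/
def IsIntegralKernel {d : ℕ} (T : L2 d →L[ℂ] L2 d) (K : Space d → Space d → ℂ) : Prop :=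
  AEStronglyMeasurable (Function.uncurry K)
      ((volume : Measure (Space d)).prod (volume : Measure (Space d))) ∧
    ∀ f : L2 d, ∀ᵐ x : Space d, Integrable (fun y => K x y * f y) ∧ T f x = ∫ y, K x y * f y

/-- The average of `K` over `B(x, ε) × B(x, ε)`. -/
def kernelAverage {d : ℕ} (K : Space d → Space d → ℂ) (x : Space d) (ε : ℝ) : ℂ :=
  ⨍ p in Metric.closedBall x ε ×ˢ Metric.closedBall x ε, K p.1 p.2
    ∂((volume : Measure (Space d)).prod (volume : Measure (Space d)))

/-- The diagonal value `K(x, x)` in the Lebesgue averaged sense. -/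
def kernelDiag {d : ℕ} (K : Space d → Space d → ℂ) (x : Space d) : ℂ :=
  limUnder (𝓝[>] (0 : ℝ)) (kernelAverage K x)

end DensityOfStates

end

open DensityOfStates

set_option linter.unusedSectionVars false

noncomputable section

namespace DensityOfStates

section Spectral

variable {E : Type*} [NormedAddCommGroup E] [InnerProductSpace ℂ E] [CompleteSpace E]

/-! ### Resolvents and the Cayley transform -/

/-! Put `S = e^{-sH/2}` and let `M` bound `|V|`. Pointwise domination `|S f| ≤ e^{sM/2} e^{sΔ/2}|f|`
and the fact that all sections of the Gaussian kernel have the same `L₂` norm give `|S f (x)| ≤ C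
‖f‖` for almost every `x`. Hence `S f (x) = ⟪κ x, f⟫` with a bounded measurable map `κ : ℝ^d → L₂`
(`exists_isKernelVec`). Every quantity in the theorem is expressed through `‖κ x‖²`.

Diagonal: `e^{-sH} = S²` has the kernel `⟪κ x, κ z⟫`, and any other kernel agrees with it almost
everywhere. Its average over `B(x,ε) × B(x,ε)` is the squared norm of the average of `κ` over
`B(x,ε)`, so Lebesgue differentiation for `L₂`-valued maps identifies the averaged diagonal with `‖κ
x‖²` (`IsKernelVec.ae_kernelDiag`).

Trace: for `g = ⟨x⟩^{-dr}` and `w = √g`, factor `S² M_g = (S M_w)(M_w⁻¹ S M_g)`. Both factors are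
Hilbert-Schmidt, because Peetre's inequality lets a polynomial weight pass through a Gaussian at the
price of doubling the time; so the product is of trace class, and its trace is `∫ g ‖κ‖²`
(`isTraceClass_comp_mulOp`, `trace_comp_mulOp`). Thus (i) and (ii) are the same limit.

Density of states: let `σ_R` be `|B(0,R)|⁻¹ ∑ ⟨χ eᵢ, E(·) χ eᵢ⟩`. These measures have no mass below
`-(M+1)`, their masses of intervals `[u, v)` converge to those of `ν`, and their Laplace transforms,
which are the averages of `‖κ‖²` over `B(0,R)` for the respective time, are bounded uniformly in
`R`. So the Laplace transforms converge, and the ball averages of `‖κ‖²` tend to `∫ e^{-sλ} dν`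
(`tendsto_average_norm_sq`). An Abelian theorem in the variable `d log ⟨x⟩` turns this limit of ball
averages into the limit of `(r - 1) ∫ ⟨x⟩^{-dr} ‖κ‖²` (`tendsto_weighted_integral`).

Spectral theory enters only through `R = (H + l)⁻¹` with `l > M`, a Neumann series that is a
nonnegative injective operator. The spectral measures, defined through the Cayley transform, are
images of those of `R` under `r ↦ 1/r - l`, and `e^{-tH}` is a continuous function of `R`.
Domination passes from the free heat operator to the free resolvent by the Laplace transform, to the
resolvent of `H` by the Neumann series, and back to `e^{-tH}` by the exponential formula. -/

theorem IsResolventAt.eq {A : E →ₗ.[ℂ] E} {z : ℂ} {R R' : E →L[ℂ] E}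
    (h : IsResolventAt A z R) (h' : IsResolventAt A z R') : R = R' := by
  ext x
  obtain ⟨hx, hx'⟩ := h'.1 x
  have := h.2 ⟨R' x, hx⟩
  rwa [hx'] at this

theorem IsResolventAt.resolventAt_eq {A : E →ₗ.[ℂ] E} {z : ℂ} {R : E →L[ℂ] E}
    (h : IsResolventAt A z R) : resolventAt A z = R := by
  have hex : ∃ R : E →L[ℂ] E, IsResolventAt A z R := ⟨R, h⟩
  rw [resolventAt, dif_pos hex]
  exact hex.choose_spec.eq h

theorem IsResolventAt.injective {A : E →ₗ.[ℂ] E} {z : ℂ} {R : E →L[ℂ] E}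
    (h : IsResolventAt A z R) : Function.Injective R := by
  rw [injective_iff_map_eq_zero]
  intro x hx
  obtain ⟨h1, h2⟩ := h.1 x
  have h3 : (⟨R x, h1⟩ : A.domain) = 0 := Subtype.ext hx
  rw [h3, hx] at h2
  simpa using h2.symm

/-- On the range of `R` one has `(A - z') R = 1 + (z - z') R`, so inverting this bounded operator
moves the resolvent from `z` to `z'`. -/
theorem IsResolventAt.shift {A : E →ₗ.[ℂ] E} {z z' : ℂ} {R B : E →L[ℂ] E}
    (h : IsResolventAt A z R) (h1 : (1 + (z - z') • R) * B = 1) (h2 : B * (1 + (z - z') • R) = 1) :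
    IsResolventAt A z' (R * B) := by
  constructor
  · intro x
    obtain ⟨hx, hx'⟩ := h.1 (B x)
    refine ⟨hx, ?_⟩
    have := congrArg (fun T : E →L[ℂ] E => T x) h1
    simp only [mul_apply_eq_comp, add_apply,
      one_apply_eq_self, smul_apply] at this
    rw [sub_eq_iff_eq_add] at hx'
    change A ⟨R (B x), hx⟩ - z' • R (B x) = x
    rw [hx']
    refine Eq.trans ?_ this
    module
  · intro u
    have h3 := h.2 u
    set g := A u - z • (u : E) with hg
    have h4 : A u - z' • (u : E) = (1 + (z - z') • R) g := by
      simp only [add_apply, one_apply_eq_self,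
        smul_apply, h3]
      rw [hg]
      module
    have := congrArg (fun T : E →L[ℂ] E => T g) h2
    simp only [mul_apply_eq_comp] at this
    rw [h4, mul_apply_eq_comp, this]
    exact h3

/-- The Cayley transform as a function of the resolvent variable. -/
def cayleyFun (l : ℝ) (r : ℂ) : ℂ := 1 - 2 * Complex.I * (r * (1 + (Complex.I - l) * r)⁻¹)

/-- The resolvent variable as a function of the Cayley transform. -/
def resolventFun (l : ℝ) (w : ℂ) : ℂ := (1 - w) / (Complex.I * (1 + w) + l * (1 - w))

theorem one_add_I_sub_mul_ne_zero (l r : ℝ) : (1 + (Complex.I - l) * r : ℂ) ≠ 0 := by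
  intro h
  have h1 := congrArg Complex.im h
  have h2 := congrArg Complex.re h
  simp at h1 h2
  rw [h1] at h2
  simp at h2

theorem resolventFun_den (l r : ℝ) :
    Complex.I * (1 + cayleyFun l r) + l * (1 - cayleyFun l r)
      = 2 * Complex.I * (1 + (Complex.I - l) * r)⁻¹ := by
  have hq := inv_mul_cancel₀ (one_add_I_sub_mul_ne_zero l r)
  rw [cayleyFun]
  generalize (1 + (Complex.I - l) * r : ℂ)⁻¹ = q at *
  linear_combination (-2 * Complex.I) * hq

theorem resolventFun_den_ne_zero (l r : ℝ) :
    Complex.I * (1 + cayleyFun l r) + l * (1 - cayleyFun l r) ≠ 0 := by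
  rw [resolventFun_den]
  have := one_add_I_sub_mul_ne_zero l r
  simp [this]

theorem resolventFun_cayleyFun (l r : ℝ) : resolventFun l (cayleyFun l r) = r := by
  rw [resolventFun, resolventFun_den]
  have hq := inv_ne_zero (one_add_I_sub_mul_ne_zero l r)
  rw [cayleyFun]
  generalize (1 + (Complex.I - l) * r : ℂ)⁻¹ = q at *
  field_simp
  ring

theorem invCayley_cayleyFun (l r : ℝ) (hr : r ≠ 0) : invCayley (cayleyFun l r) = r⁻¹ - l := by
  have h1 := inv_mul_cancel₀ (one_add_I_sub_mul_ne_zero l r)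
  have hq := inv_ne_zero (one_add_I_sub_mul_ne_zero l r)
  have h2 : (r : ℂ) ≠ 0 := by exact_mod_cast hr
  have h3 := mul_inv_cancel₀ h2
  have : Complex.I * (1 + cayleyFun l r) / (1 - cayleyFun l r) = ((r⁻¹ - l : ℝ) : ℂ) := by
    rw [cayleyFun]
    generalize (1 + (Complex.I - l) * r : ℂ)⁻¹ = q at *
    push_cast
    rw [div_eq_iff (by simp [hq, h2])]
    linear_combination (-2 * Complex.I) * h1 - 2 * Complex.I * q * h3
  rw [invCayley, this, Complex.ofReal_re]

theorem spectrum_eq_ofReal_re {R : E →L[ℂ] E} (hR : IsSelfAdjoint R) {x : ℂ}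
    (hx : x ∈ spectrum ℂ R) : x = (x.re : ℂ) :=
  hR.mem_spectrum_eq_re hx

theorem continuousOn_cayleyFun {R : E →L[ℂ] E} (hR : IsSelfAdjoint R) (l : ℝ) :
    ContinuousOn (cayleyFun l) (spectrum ℂ R) := by
  unfold cayleyFun
  refine continuousOn_const.sub (continuousOn_const.mul (continuousOn_id.mul
    (ContinuousOn.inv₀ (by fun_prop) ?_)))
  intro x hx
  rw [spectrum_eq_ofReal_re hR hx]
  exact one_add_I_sub_mul_ne_zero _ _

/-- The Cayley transform needs the resolvent at `-i`. It is reached from `-l` by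
`IsResolventAt.shift`: the operator to invert is `1 + (i - l) R`, and `1 + (i - l) x` has no zero
for real `x`. -/
theorem cayley_eq_cfc {A : E →ₗ.[ℂ] E} {l : ℝ} {R : E →L[ℂ] E} (hR : IsSelfAdjoint R)
    (h : IsResolventAt A (-l) R) : cayley A = cfc (cayleyFun l) R := by
  have hn : IsStarNormal R := hR.isStarNormal
  have hne : ∀ x ∈ spectrum ℂ R, (1 + (Complex.I - l) * x : ℂ) ≠ 0 := by
    intro x hx
    rw [spectrum_eq_ofReal_re hR hx]
    exact one_add_I_sub_mul_ne_zero _ _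
  have hc1 : ContinuousOn (fun x : ℂ => 1 + (Complex.I - l) * x) (spectrum ℂ R) := by fun_prop
  have hc2 : ContinuousOn (fun x : ℂ => (1 + (Complex.I - l) * x)⁻¹) (spectrum ℂ R) :=
    hc1.inv₀ hne
  have e1 : (1 + (-(l : ℂ) - -Complex.I) • R) = cfc (fun x : ℂ => 1 + (Complex.I - l) * x) R := by
    rw [cfc_const_add (1 : ℂ) (fun x => (Complex.I - l) * x) R (by fun_prop) hn,
      cfc_const_mul_id (Complex.I - l : ℂ) R hn]
    simp only [map_one]
    congr 2
    ring
  have e2 : cfc (fun x : ℂ => 1 + (Complex.I - l) * x) R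
      * cfc (fun x : ℂ => (1 + (Complex.I - l) * x)⁻¹) R = 1 := by
    rw [← cfc_mul _ _ R hc1 hc2, ← cfc_one ℂ R hn]
    exact cfc_congr fun x hx => mul_inv_cancel₀ (hne x hx)
  have e3 : cfc (fun x : ℂ => (1 + (Complex.I - l) * x)⁻¹) R
      * cfc (fun x : ℂ => 1 + (Complex.I - l) * x) R = 1 := by
    rw [← cfc_mul _ _ R hc2 hc1, ← cfc_one ℂ R hn]
    exact cfc_congr fun x hx => inv_mul_cancel₀ (hne x hx)
  have e4 := h.shift (z' := -Complex.I) (by rw [e1]; exact e2) (by rw [e1]; exact e3)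
  have hc3 : ContinuousOn (fun r : ℂ => r * (1 + (Complex.I - l) * r)⁻¹) (spectrum ℂ R) :=
    continuousOn_id.mul hc2
  have e5 : cfc (fun r : ℂ => r * (1 + (Complex.I - l) * r)⁻¹) R
      = R * cfc (fun x : ℂ => (1 + (Complex.I - l) * x)⁻¹) R := by
    rw [cfc_mul (fun r : ℂ => r) _ R continuousOn_id hc2, cfc_id' ℂ R hn]
  have e6 := cfc_const_mul (2 * Complex.I : ℂ) _ R hc3
  have e7 := cfc_sub (fun _ : ℂ => (1 : ℂ))
    (fun r : ℂ => 2 * Complex.I * (r * (1 + (Complex.I - l) * r)⁻¹)) R continuousOn_const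
    (continuousOn_const.mul hc3)
  rw [cfc_const_one ℂ R hn] at e7
  rw [cayley, e4.resolventAt_eq, ← e5, ← e6]
  exact e7.symm

theorem isStarNormal_cayley {A : E →ₗ.[ℂ] E} {l : ℝ} {R : E →L[ℂ] E} (hR : IsSelfAdjoint R)
    (h : IsResolventAt A (-l) R) : IsStarNormal (cayley A) := by
  rw [cayley_eq_cfc hR h]
  exact cfc_predicate _ _

theorem spectrum_cayley {A : E →ₗ.[ℂ] E} {l : ℝ} {R : E →L[ℂ] E} (hR : IsSelfAdjoint R)
    (h : IsResolventAt A (-l) R) : spectrum ℂ (cayley A) = cayleyFun l '' spectrum ℂ R := by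
  have hn : IsStarNormal R := hR.isStarNormal
  rw [cayley_eq_cfc hR h]
  exact cfc_map_spectrum _ _ hn (continuousOn_cayleyFun hR l)

theorem continuousOn_resolventFun {A : E →ₗ.[ℂ] E} {l : ℝ} {R : E →L[ℂ] E} (hR : IsSelfAdjoint R)
    (h : IsResolventAt A (-l) R) : ContinuousOn (resolventFun l) (spectrum ℂ (cayley A)) := by
  rw [spectrum_cayley hR h]
  unfold resolventFun
  refine ContinuousOn.div (by fun_prop) (by fun_prop) ?_
  rintro _ ⟨x, hx, rfl⟩
  rw [spectrum_eq_ofReal_re hR hx]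
  exact resolventFun_den_ne_zero _ _

theorem cfc_comp_resolventFun {A : E →ₗ.[ℂ] E} {l : ℝ} {R : E →L[ℂ] E} (hR : IsSelfAdjoint R)
    (h : IsResolventAt A (-l) R) {f : ℝ → ℝ} (hf : Continuous f) :
    cfc (fun w : ℂ => ((f (resolventFun l w).re : ℝ) : ℂ)) (cayley A) = cfc f R := by
  have hn : IsStarNormal R := hR.isStarNormal
  have hc := continuousOn_resolventFun hR h
  rw [spectrum_cayley hR h] at hc
  rw [cayley_eq_cfc hR h, ← cfc_comp _ _ R hn ?_ (continuousOn_cayleyFun hR l),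
    cfc_real_eq_complex f hR]
  · refine cfc_congr fun x hx => ?_
    rw [spectrum_eq_ofReal_re hR hx]
    simp [resolventFun_cayleyFun]
  · exact Complex.continuous_ofReal.comp_continuousOn (hf.comp_continuousOn
      (Complex.continuous_re.comp_continuousOn hc))

/-! ### The Riesz measure of a normal operator -/

section Riesz

variable {U : E →L[ℂ] E} [hU : IsStarNormal U]

theorem spectralFunctional_apply (U : E →L[ℂ] E) (ψ : E) (f : C_c(ℂ, ℝ)) :
    spectralFunctional U ψ f = (⟪ψ, cfc (fun w : ℂ => ((f w : ℝ) : ℂ)) U ψ⟫_ℂ).re := rfl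

theorem rieszMeasure_isCompact_le (ψ : E) {K : Set ℂ} (hK : IsCompact K) :
    RealRMK.rieszMeasure (spectralFunctional U ψ) K ≤ ENNReal.ofReal (‖ψ‖ ^ 2) := by
  -- Enlarging `K` by the spectrum makes the cut-off equal to `1` there, so its functional calculus
  -- is the identity and the bound does not depend on `K`.
  have hK' : IsCompact (K ∪ spectrum ℂ U) := hK.union (spectrum.isCompact U)
  obtain ⟨f, hf1, hf2, -, hf3⟩ := exists_continuousMap_one_of_isCompact_subset_isOpen hK'
    isOpen_univ (Set.subset_univ _)
  have := RealRMK.rieszMeasure_le_of_eq_one (spectralFunctional U ψ)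
    (f := ⟨f, hf2⟩) (fun x => (hf3 x).1) hK (fun x hx => hf1 (Or.inl hx))
  refine this.trans (le_of_eq ?_)
  rw [spectralFunctional_apply]
  have : cfc (fun w : ℂ => ((f w : ℝ) : ℂ)) U = 1 := by
    rw [← cfc_one ℂ U]
    refine cfc_congr fun x hx => ?_
    have := hf1 (Or.inr hx : x ∈ K ∪ spectrum ℂ U)
    simp [this]
  change ENNReal.ofReal (⟪ψ, cfc (fun w : ℂ => ((f w : ℝ) : ℂ)) U ψ⟫_ℂ).re = _
  rw [this]
  congr 1
  rw [one_apply_eq_self, inner_self_eq_norm_sq_to_K]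
  norm_cast

instance isFiniteMeasure_rieszMeasure (ψ : E) :
    IsFiniteMeasure (RealRMK.rieszMeasure (spectralFunctional U ψ)) := by
  constructor
  have h1 := isOpen_univ.measure_eq_iSup_isCompact
    (RealRMK.rieszMeasure (spectralFunctional U ψ))
  rw [h1]
  refine lt_of_le_of_lt (b := ENNReal.ofReal (‖ψ‖ ^ 2)) ?_ ENNReal.ofReal_lt_top
  simp only [iSup_le_iff]
  intro K _ hK
  exact rieszMeasure_isCompact_le ψ hK

theorem rieszMeasure_compl_spectrum (ψ : E) :
    RealRMK.rieszMeasure (spectralFunctional U ψ) (spectrum ℂ U)ᶜ = 0 := by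
  have ho : IsOpen (spectrum ℂ U)ᶜ := (spectrum.isCompact (𝕜 := ℂ) U).isClosed.isOpen_compl
  rw [ho.measure_eq_iSup_isCompact]
  simp only [ENNReal.iSup_eq_zero]
  intro K hKs hK
  obtain ⟨f, hf1, hf2, hf4, hf3⟩ := exists_continuousMap_one_of_isCompact_subset_isOpen hK ho hKs
  have := RealRMK.rieszMeasure_le_of_eq_one (spectralFunctional U ψ)
    (f := ⟨f, hf2⟩) (fun x => (hf3 x).1) hK (fun x hx => hf1 hx)
  refine le_antisymm (this.trans (le_of_eq ?_)) zero_le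
  rw [spectralFunctional_apply]
  change ENNReal.ofReal (⟪ψ, cfc (fun w : ℂ => ((f w : ℝ) : ℂ)) U ψ⟫_ℂ).re = _
  have : cfc (fun w : ℂ => ((f w : ℝ) : ℂ)) U = 0 := by
    rw [← cfc_zero ℂ U]
    refine cfc_congr fun x hx => ?_
    have : f x = 0 := by
      by_contra hne
      exact hf4 (subset_tsupport _ hne) hx
    simp [this]
  simp [this]

/-- The Riesz measure is known only against `C_c(ℂ)`. It does not charge the complement of the
spectrum, so `f` may be replaced by a Tietze extension from the spectrum times a compactly supported
cut-off. -/
theorem integral_rieszMeasure_continuousOn (ψ : E) {f : ℂ → ℝ}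
    (hf : ContinuousOn f (spectrum ℂ U)) :
    ∫ w, f w ∂(RealRMK.rieszMeasure (spectralFunctional U ψ))
      = (⟪ψ, cfc (fun w : ℂ => ((f w : ℝ) : ℂ)) U ψ⟫_ℂ).re := by
  obtain ⟨F, hF⟩ := ContinuousMap.exists_restrict_eq (spectrum.isCompact (𝕜 := ℂ) U).isClosed
    ⟨(spectrum ℂ U).domRestrict f, hf.domRestrict⟩
  obtain ⟨χ, hχ1, hχ2, -, hχ3⟩ := exists_continuousMap_one_of_isCompact_subset_isOpen
    (spectrum.isCompact (𝕜 := ℂ) U) isOpen_univ (Set.subset_univ _)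
  have hFf : ∀ x ∈ spectrum ℂ U, f x = (F * χ) x := by
    intro x hx
    have h1 := congrArg (fun g : C(spectrum ℂ U, ℝ) => g ⟨x, hx⟩) hF
    have h2 := hχ1 hx
    change F x = f x at h1
    simp [h2, h1]
  have hcs : HasCompactSupport (F * χ) := HasCompactSupport.mul_left hχ2
  have h1 := RealRMK.integral_rieszMeasure (spectralFunctional U ψ) ⟨F * χ, hcs⟩
  have h2 : ∫ w, f w ∂(RealRMK.rieszMeasure (spectralFunctional U ψ))
      = ∫ w, (F * χ) w ∂(RealRMK.rieszMeasure (spectralFunctional U ψ)) := by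
    refine integral_congr_ae ?_
    have := rieszMeasure_compl_spectrum (U := U) ψ
    filter_upwards [mem_ae_iff.2 this] with x hx
    exact hFf x hx
  rw [h2]
  refine h1.trans ?_
  rw [spectralFunctional_apply]
  congr 3
  refine cfc_congr fun x hx => ?_
  simp only [hFf x hx]
  rfl

end Riesz

end Spectral

section BorelCalculus

variable {E : Type*} [NormedAddCommGroup E] [InnerProductSpace ℂ E] [CompleteSpace E]

/-! ### Spectral measures of the resolvent -/

/-- The spectral measure of the resolvent `(A + l)⁻¹` at `ψ`. -/
def resolventMeasure (A : E →ₗ.[ℂ] E) (l : ℝ) (ψ : E) : Measure ℝ :=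
  (RealRMK.rieszMeasure (spectralFunctional (cayley A) ψ)).map fun w => (resolventFun l w).re

theorem measurable_resolventFun_re (l : ℝ) : Measurable fun w => (resolventFun l w).re := by
  unfold resolventFun
  fun_prop

theorem inner_cfc_eq_re {R : E →L[ℂ] E} (f : ℝ → ℝ) (ψ : E) :
    ⟪ψ, cfc f R ψ⟫_ℂ = ((⟪ψ, cfc f R ψ⟫_ℂ).re : ℂ) := by
  have h : IsSelfAdjoint (cfc f R) := cfc_predicate _ _
  have h2 := (ContinuousLinearMap.isSelfAdjoint_iff_isSymmetric.1 h)
  have h3 := h2.coe_re_inner_self_apply ψ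
  exact h3.symm

variable {A : E →ₗ.[ℂ] E} {l : ℝ} {R : E →L[ℂ] E}

theorem ae_rieszMeasure_cayley (hR : IsSelfAdjoint R) (h : IsResolventAt A (-l) R) (ψ : E) :
    ∀ᵐ w ∂(RealRMK.rieszMeasure (spectralFunctional (cayley A) ψ)),
      ∃ r : ℝ, r ∈ spectrum ℝ R ∧ cayleyFun l r = w := by
  have hn := isStarNormal_cayley hR h
  have := rieszMeasure_compl_spectrum (U := cayley A) ψ
  rw [spectrum_cayley hR h] at this
  filter_upwards [mem_ae_iff.2 this] with w hw
  obtain ⟨x, hx, rfl⟩ := hw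
  refine ⟨x.re, ?_, by rw [← spectrum_eq_ofReal_re hR hx]⟩
  rw [spectrum_eq_ofReal_re hR hx] at hx
  exact hx

theorem isFiniteMeasure_resolventMeasure (hR : IsSelfAdjoint R) (h : IsResolventAt A (-l) R)
    (ψ : E) : IsFiniteMeasure (resolventMeasure A l ψ) := by
  have hn := isStarNormal_cayley hR h
  unfold resolventMeasure
  infer_instance

theorem ae_resolventMeasure_mem_spectrum (hR : IsSelfAdjoint R) (h : IsResolventAt A (-l) R)
    (ψ : E) : ∀ᵐ r ∂(resolventMeasure A l ψ), r ∈ spectrum ℝ R := by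
  have hc : MeasurableSet (spectrum ℝ R) := (spectrum.isCompact (𝕜 := ℝ) R).isClosed.measurableSet
  refine (ae_map_iff (p := fun r => r ∈ spectrum ℝ R)
    (measurable_resolventFun_re l).aemeasurable hc).2 ?_
  filter_upwards [ae_rieszMeasure_cayley hR h ψ] with w hw
  obtain ⟨r, hr, rfl⟩ := hw
  rwa [resolventFun_cayleyFun]

theorem integral_resolventMeasure (hR : IsSelfAdjoint R) (h : IsResolventAt A (-l) R) (ψ : E)
    {f : ℝ → ℝ} (hf : Continuous f) :
    ⟪ψ, cfc f R ψ⟫_ℂ = ((∫ r, f r ∂(resolventMeasure A l ψ) : ℝ) : ℂ) := by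
  have hn := isStarNormal_cayley hR h
  rw [resolventMeasure, integral_map (measurable_resolventFun_re l).aemeasurable
    hf.aestronglyMeasurable, integral_rieszMeasure_continuousOn (f := fun w =>
      f (resolventFun l w).re) ψ
    (hf.comp_continuousOn (Complex.continuous_re.comp_continuousOn
      (continuousOn_resolventFun hR h))), cfc_comp_resolventFun hR h hf]
  exact inner_cfc_eq_re f ψ

theorem resolventMeasure_real_univ (hR : IsSelfAdjoint R) (h : IsResolventAt A (-l) R) (ψ : E) :
    (resolventMeasure A l ψ).real Set.univ = ‖ψ‖ ^ 2 := by
  have h1 := integral_resolventMeasure hR h ψ (f := fun _ => 1) continuous_const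
  rw [cfc_const_one ℝ R, one_apply_eq_self, inner_self_eq_norm_sq_to_K,
    integral_const] at h1
  simp only [smul_eq_mul, mul_one] at h1
  apply Complex.ofReal_injective
  rw [← h1]
  push_cast
  rfl

theorem integrable_resolventMeasure (hR : IsSelfAdjoint R) (h : IsResolventAt A (-l) R) (ψ : E)
    {f : ℝ → ℝ} (hf : Continuous f) : Integrable f (resolventMeasure A l ψ) := by
  have := isFiniteMeasure_resolventMeasure hR h ψ
  obtain ⟨C, hC⟩ := (spectrum.isCompact (𝕜 := ℝ) R).exists_bound_of_continuousOn hf.continuousOn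
  refine Integrable.of_bound hf.aestronglyMeasurable C ?_
  filter_upwards [ae_resolventMeasure_mem_spectrum hR h ψ] with r hr using hC r hr

theorem denseRange_of_injective (hR : IsSelfAdjoint R) (hi : Function.Injective R) :
    DenseRange R := by
  have h1 : R.range.topologicalClosure = ⊤ := by
    rw [Submodule.topologicalClosure_eq_top_iff, ContinuousLinearMap.orthogonal_range,
      hR.adjoint_eq]
    exact LinearMap.ker_eq_bot.2 hi
  have h2 := (Submodule.dense_iff_topologicalClosure_eq_top).2 h1
  have e : ((R.range : Submodule ℂ E) : Set E) = Set.range R := by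
    ext
    simp
  rwa [e] at h2

/-- An atom at `0` would mean an eigenvalue `0` of `R`, but resolvents are injective.
Quantitatively, `k n` decreases to the indicator of `{0}` on the spectrum, `‖k n (R) R‖ ≤ 1/n`, and
the range of `R` is dense, so `k n (R) → 0` strongly. The `max r 0` only serves to make `k n`
continuous on all of `ℝ`. -/
theorem resolventMeasure_singleton_zero (hR : 0 ≤ R) (h : IsResolventAt A (-l) R) (ψ : E) :
    resolventMeasure A l ψ {0} = 0 := by
  have hsa : IsSelfAdjoint R := IsSelfAdjoint.of_nonneg hR
  have := isFiniteMeasure_resolventMeasure hsa h ψ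
  have hspec : ∀ r ∈ spectrum ℝ R, 0 ≤ r := fun r hr => spectrum_nonneg_of_nonneg hR hr
  set k : ℕ → ℝ → ℝ := fun n r => (1 + n * max r 0)⁻¹ with hk
  have hpos : ∀ (n : ℕ) (r : ℝ), 0 < 1 + (n : ℝ) * max r 0 := fun n r =>
    add_pos_of_pos_of_nonneg one_pos (mul_nonneg (Nat.cast_nonneg n) (le_max_right r 0))
  have hkc : ∀ n, Continuous (k n) := fun n =>
    Continuous.inv₀ (by fun_prop) fun r => (hpos n r).ne'
  have hk0 : ∀ n r, 0 ≤ k n r := fun n r => inv_nonneg.2 (hpos n r).le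
  have hk1 : ∀ n r, k n r ≤ 1 := fun n r => inv_le_one_of_one_le₀ (by
    have : 0 ≤ (n : ℝ) * max r 0 := mul_nonneg (Nat.cast_nonneg n) (le_max_right r 0)
    linarith)
  have hb1 : ∀ n, ‖cfc (k n) R‖ ≤ 1 := fun n => norm_cfc_le zero_le_one fun r _ => by
    rw [Real.norm_of_nonneg (hk0 n r)]; exact hk1 n r
  have hb2 : ∀ n : ℕ, 0 < n → ‖cfc (k n) R * R‖ ≤ 1 / n := by
    intro n hn
    have e : cfc (k n) R * R = cfc (fun r => k n r * r) R := by
      rw [cfc_mul (k n) (fun r => r) R (hkc n).continuousOn continuousOn_id, cfc_id' ℝ R hsa]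
    rw [e]
    refine norm_cfc_le (by positivity) fun r hr => ?_
    have h0 := hspec r hr
    rw [Real.norm_of_nonneg (mul_nonneg (hk0 n r) h0)]
    have hn' : (0 : ℝ) < n := by exact_mod_cast hn
    simp only [hk, max_eq_left h0]
    rw [inv_mul_eq_div, div_le_div_iff₀ (by positivity) hn']
    nlinarith
  have key : ∀ n, ((resolventMeasure A l ψ) {0}).toReal ≤ ‖ψ‖ * ‖cfc (k n) R ψ‖ := by
    intro n
    have h1 : ((resolventMeasure A l ψ) {0}).toReal ≤ ∫ r, k n r ∂(resolventMeasure A l ψ) := by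
      have e1 : ((resolventMeasure A l ψ) {0}).toReal
          = ∫ r, ({0} : Set ℝ).indicator 1 r ∂(resolventMeasure A l ψ) := by
        rw [integral_indicator_one (measurableSet_singleton _)]
        rfl
      rw [e1]
      refine integral_mono ((integrable_const (1 : ℝ)).indicator (measurableSet_singleton _))
        (integrable_resolventMeasure hsa h ψ (hkc n)) ?_
      intro r
      by_cases hr : r = 0
      · simp [hr, hk]
      · simp [hr, hk0]
    refine h1.trans ?_
    have h2 := integral_resolventMeasure hsa h ψ (hkc n)
    have h3 : ‖⟪ψ, cfc (k n) R ψ⟫_ℂ‖ ≤ ‖ψ‖ * ‖cfc (k n) R ψ‖ := norm_inner_le_norm _ _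
    rw [h2, Complex.norm_real] at h3
    exact (le_abs_self _).trans h3
  have lim : Tendsto (fun n => cfc (k n) R ψ) atTop (𝓝 0) := by
    rw [Metric.tendsto_atTop]
    intro ε hε
    obtain ⟨φ, hφ⟩ := (denseRange_of_injective hsa h.injective).exists_dist_lt ψ (half_pos hε)
    obtain ⟨N, hN⟩ := exists_nat_gt (‖φ‖ / (ε / 2))
    refine ⟨N + 1, fun n hn => ?_⟩
    have hn0 : 0 < n := by omega
    have hn' : (0 : ℝ) < n := by exact_mod_cast hn0
    rw [dist_zero_right]
    have e : cfc (k n) R ψ = cfc (k n) R (ψ - R φ) + (cfc (k n) R * R) φ := by simp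
    rw [e]
    refine (norm_add_le _ _).trans_lt ?_
    have h1 : ‖cfc (k n) R (ψ - R φ)‖ < ε / 2 := by
      refine (ContinuousLinearMap.le_of_opNorm_le _ (hb1 n) _).trans_lt ?_
      rw [one_mul, ← dist_eq_norm]; exact hφ
    have h2 : ‖(cfc (k n) R * R) φ‖ ≤ ε / 2 := by
      refine (ContinuousLinearMap.le_of_opNorm_le _ (hb2 n hn0) _).trans ?_
      rw [div_lt_iff₀ (half_pos hε)] at hN
      rw [one_div, inv_mul_le_iff₀ hn']
      have : (N : ℝ) ≤ n := by exact_mod_cast (by omega : N ≤ n)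
      nlinarith
    linarith
  have h5 : ((resolventMeasure A l ψ) {0}).toReal ≤ 0 := by
    refine ge_of_tendsto' (f := fun n => ‖ψ‖ * ‖cfc (k n) R ψ‖) (x := atTop) ?_ key
    simpa using (lim.norm.const_mul ‖ψ‖)
  have h6 := le_antisymm h5 ENNReal.toReal_nonneg
  rw [ENNReal.toReal_eq_zero_iff] at h6
  exact h6.resolve_right (measure_ne_top _ _)

theorem ae_resolventMeasure_pos (hR : 0 ≤ R) (h : IsResolventAt A (-l) R) (ψ : E) :
    ∀ᵐ r ∂(resolventMeasure A l ψ), 0 < r ∧ r ≤ ‖R‖ := by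
  have hsa : IsSelfAdjoint R := IsSelfAdjoint.of_nonneg hR
  have h0 : ∀ᵐ r ∂(resolventMeasure A l ψ), r ≠ 0 := by
    rw [ae_iff]
    simpa using resolventMeasure_singleton_zero hR h ψ
  filter_upwards [ae_resolventMeasure_mem_spectrum hsa h ψ, h0] with r hr hr0
  refine ⟨lt_of_le_of_ne (spectrum_nonneg_of_nonneg hR hr) (Ne.symm hr0), ?_⟩
  have h1 := spectrum.norm_le_norm_mul_of_mem hr
  have h2 : ‖(1 : E →L[ℂ] E)‖ ≤ 1 := ContinuousLinearMap.norm_id_le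
  calc r ≤ ‖r‖ := le_abs_self r
    _ ≤ ‖R‖ * ‖(1 : E →L[ℂ] E)‖ := h1
    _ ≤ ‖R‖ * 1 := by gcongr
    _ = ‖R‖ := mul_one _

theorem measurable_inv_sub (l : ℝ) : Measurable fun r : ℝ => r⁻¹ - l := by fun_prop

/-- The relation `invCayley (cayleyFun l r) = r⁻¹ - l` fails only at `r = 0`, the point that
corresponds to infinity in the spectrum of `A`, and this point carries no mass. -/
theorem spectralMeasure_eq_map (hR : 0 ≤ R) (h : IsResolventAt A (-l) R) (ψ : E) :
    spectralMeasure A ψ = (resolventMeasure A l ψ).map fun r => r⁻¹ - l := by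
  have hsa : IsSelfAdjoint R := IsSelfAdjoint.of_nonneg hR
  rw [spectralMeasure, resolventMeasure, Measure.map_map (measurable_inv_sub l)
    (measurable_resolventFun_re l)]
  refine Measure.map_congr ?_
  have h0 : ∀ᵐ r ∂(resolventMeasure A l ψ), r ≠ 0 := by
    rw [ae_iff]
    simpa using resolventMeasure_singleton_zero hR h ψ
  have h1 := ae_of_ae_map (measurable_resolventFun_re l).aemeasurable h0
  filter_upwards [ae_rieszMeasure_cayley hsa h ψ, h1] with w hw hw1
  obtain ⟨r, hr, rfl⟩ := hw
  rw [resolventFun_cayleyFun, Complex.ofReal_re] at hw1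
  simp only [Function.comp]
  rw [invCayley_cayleyFun l r hw1, resolventFun_cayleyFun, Complex.ofReal_re]

/-! ### Bounded Borel functional calculus -/

/-- Polarization, with the four quadratic terms paired by the parallelogram law. -/
theorem norm_inner_le_of_quadratic_bound {T : E →L[ℂ] E} {C : ℝ}
    (hT : ∀ x, ‖⟪x, T x⟫_ℂ‖ ≤ C * ‖x‖ ^ 2) (x y : E) :
    ‖⟪x, T y⟫_ℂ‖ ≤ C * (‖x‖ ^ 2 + ‖y‖ ^ 2) := by
  have hT' : ∀ x, ‖⟪T x, x⟫_ℂ‖ ≤ C * ‖x‖ ^ 2 := fun x => by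
    rw [← inner_conj_symm, RCLike.norm_conj]; exact hT x
  have h1 := inner_map_polarization (T : E →ₗ[ℂ] E) x y
  rw [← inner_conj_symm, RCLike.norm_conj]
  simp only [ContinuousLinearMap.coe_coe] at h1
  rw [h1, norm_div]
  have p1 := parallelogram_law_with_norm ℂ x y
  have p2 := parallelogram_law_with_norm ℂ x (Complex.I • y)
  rw [norm_smul, Complex.norm_I, one_mul] at p2
  have a1 := hT' (x + y)
  have a2 := hT' (x - y)
  have a3 := hT' (x + Complex.I • y)
  have a4 := hT' (x - Complex.I • y)
  have e4 : ‖(4 : ℂ)‖ = 4 := by simp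
  rw [e4, div_le_iff₀ (by norm_num)]
  refine (norm_sub_le _ _).trans ?_
  refine (add_le_add_left (norm_add_le _ _) _).trans ?_
  refine (add_le_add_left (add_le_add_left (norm_sub_le _ _) _) _).trans ?_
  rw [norm_mul, norm_mul, Complex.norm_I, one_mul, one_mul]
  have q1 : C * ‖x + y‖ ^ 2 + C * ‖x - y‖ ^ 2 = C * (2 * (‖x‖ ^ 2 + ‖y‖ ^ 2)) := by
    rw [← mul_add, p1]
  have q2 : C * ‖x + Complex.I • y‖ ^ 2 + C * ‖x - Complex.I • y‖ ^ 2
      = C * (2 * (‖x‖ ^ 2 + ‖y‖ ^ 2)) := by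
    rw [← mul_add, p2]
  linarith

theorem norm_inner_le_mul_of_quadratic_bound {T : E →L[ℂ] E} {C : ℝ}
    (hT : ∀ x, ‖⟪x, T x⟫_ℂ‖ ≤ C * ‖x‖ ^ 2) (x y : E) : ‖⟪x, T y⟫_ℂ‖ ≤ 2 * C * ‖x‖ * ‖y‖ := by
  rcases eq_or_ne x 0 with rfl | hx
  · simp
  rcases eq_or_ne y 0 with rfl | hy
  · simp
  have hx' := norm_pos_iff.2 hx
  have hy' := norm_pos_iff.2 hy
  have := norm_inner_le_of_quadratic_bound hT ((‖x‖⁻¹ : ℂ) • x) ((‖y‖⁻¹ : ℂ) • y)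
  rw [norm_smul, norm_smul, map_smul, inner_smul_left, inner_smul_right] at this
  simp only [norm_mul, norm_inv, Complex.norm_real, norm_norm, RCLike.norm_conj] at this
  rw [inv_mul_cancel₀ hx'.ne', inv_mul_cancel₀ hy'.ne'] at this
  have e : ‖⟪x, T y⟫_ℂ‖ = (‖x‖⁻¹ * (‖y‖⁻¹ * ‖⟪x, T y⟫_ℂ‖)) * (‖x‖ * ‖y‖) := by field_simp
  rw [e]
  calc _ ≤ (C * (1 ^ 2 + 1 ^ 2)) * (‖x‖ * ‖y‖) := by gcongr
    _ = _ := by ring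

theorem ext_of_inner_self {S T : E →L[ℂ] E} (h : ∀ x, ⟪x, S x⟫_ℂ = ⟪x, T x⟫_ℂ) : S = T := by
  have : (S : E →ₗ[ℂ] E) = T := by
    rw [← ext_inner_map]
    intro x
    simp only [ContinuousLinearMap.coe_coe]
    rw [← inner_conj_symm, h x, inner_conj_symm]
  exact_mod_cast this

/-- By polarization, convergence of the quadratic forms gives convergence of the sesquilinear forms.
The limit form is bounded by `2 * C` and is represented by a bounded operator. -/
theorem exists_of_tendsto_quadratic {T : ℕ → E →L[ℂ] E} {C : ℝ}
    (hT : ∀ n x, ‖⟪x, T n x⟫_ℂ‖ ≤ C * ‖x‖ ^ 2) {q : E → ℂ}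
    (hq : ∀ x, Tendsto (fun n => ⟪x, T n x⟫_ℂ) atTop (𝓝 (q x))) :
    ∃ S : E →L[ℂ] E, ∀ x, ⟪x, S x⟫_ℂ = q x := by
  have hq' : ∀ x, Tendsto (fun n => ⟪T n x, x⟫_ℂ) atTop (𝓝 (starRingEnd ℂ (q x))) := by
    intro x
    have := (Complex.continuous_conj.tendsto _).comp (hq x)
    refine this.congr fun n => ?_
    simp
  have hlim : ∀ x y, ∃ b, Tendsto (fun n => ⟪T n y, x⟫_ℂ) atTop (𝓝 b) := by
    intro x y
    refine ⟨(starRingEnd ℂ (q (x + y)) - starRingEnd ℂ (q (x - y))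
      + Complex.I * starRingEnd ℂ (q (x + Complex.I • y))
      - Complex.I * starRingEnd ℂ (q (x - Complex.I • y))) / 4, ?_⟩
    have := ((((hq' (x + y)).sub (hq' (x - y))).add ((hq' (x + Complex.I • y)).const_mul
      Complex.I)).sub ((hq' (x - Complex.I • y)).const_mul Complex.I)).div_const 4
    refine this.congr fun n => ?_
    exact (inner_map_polarization (T n : E →ₗ[ℂ] E) x y).symm
  choose b hb using hlim
  have hbound : ∀ x y, ‖b x y‖ ≤ 2 * C * ‖y‖ * ‖x‖ := by
    intro x y
    refine le_of_tendsto' (hb x y).norm fun n => ?_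
    have := norm_inner_le_mul_of_quadratic_bound (hT n) x y
    rw [← inner_conj_symm, RCLike.norm_conj]
    linarith
  let B : E →ₗ⋆[ℂ] E →ₗ[ℂ] ℂ := LinearMap.mk₂'ₛₗ (starRingEnd ℂ) (RingHom.id ℂ)
    (fun y x => b x y)
    (fun y y' x => tendsto_nhds_unique (hb x (y + y')) (((hb x y).add (hb x y')).congr fun n => by
      rw [map_add, inner_add_left]))
    (fun c y x => tendsto_nhds_unique (hb x (c • y)) (((hb x y).const_mul _).congr fun n => by
      rw [map_smul, inner_smul_left]))
    (fun y x x' => tendsto_nhds_unique (hb (x + x') y) (((hb x y).add (hb x' y)).congr fun n => by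
      rw [inner_add_right]))
    (fun c y x => tendsto_nhds_unique (hb (c • x) y) (((hb x y).const_mul _).congr fun n => by
      rw [inner_smul_right]; rfl))
  let B' : E →L⋆[ℂ] E →L[ℂ] ℂ := LinearMap.mkContinuous₂ B (2 * C) fun y x => hbound x y
  refine ⟨InnerProductSpace.continuousLinearMapOfBilin B', fun x => ?_⟩
  rw [← inner_conj_symm, InnerProductSpace.continuousLinearMapOfBilin_apply]
  have h1 : B' x x = b x x := rfl
  rw [h1, tendsto_nhds_unique (hb x x) (hq' x)]
  simp

theorem exists_resolventCalculus_of_tendsto (hR : IsSelfAdjoint R) (h : IsResolventAt A (-l) R)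
    {f : ℕ → ℝ → ℝ} {g : ℝ → ℝ} (hf : ∀ n, Measurable (f n)) (hb : ∀ n r, ‖f n r‖ ≤ 1)
    (hfg : ∀ r, Tendsto (fun n => f n r) atTop (𝓝 (g r)))
    (hT : ∀ n, ∃ T : E →L[ℂ] E, ∀ ψ,
      ⟪ψ, T ψ⟫_ℂ = ((∫ r, f n r ∂(resolventMeasure A l ψ) : ℝ) : ℂ)) :
    ∃ T : E →L[ℂ] E, ∀ ψ, ⟪ψ, T ψ⟫_ℂ = ((∫ r, g r ∂(resolventMeasure A l ψ) : ℝ) : ℂ) := by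
  choose T hT using hT
  refine exists_of_tendsto_quadratic (T := T) (C := 1) ?_ ?_
  · intro n ψ
    have := isFiniteMeasure_resolventMeasure hR h ψ
    rw [hT, Complex.norm_real]
    have h1 := norm_integral_le_of_norm_le_const (μ := resolventMeasure A l ψ)
      (Eventually.of_forall (hb n))
    rwa [resolventMeasure_real_univ hR h] at h1
  · intro ψ
    have := isFiniteMeasure_resolventMeasure hR h ψ
    simp_rw [hT]
    refine (Complex.continuous_ofReal.tendsto _).comp ?_
    exact tendsto_integral_of_dominated_convergence (fun _ => 1)
      (fun n => (hf n).aestronglyMeasurable) (integrable_const _)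
      (fun n => Eventually.of_forall (hb n)) (Eventually.of_forall hfg)

/-- Induction on Borel sets: indicators of closed sets are limits of continuous thickened
indicators, complements correspond to `1 - T`, and disjoint unions are limits of finite sums. -/
theorem exists_resolventCalculus_indicator (hR : IsSelfAdjoint R) (h : IsResolventAt A (-l) R)
    {J : Set ℝ} (hJ : MeasurableSet J) :
    ∃ T : E →L[ℂ] E, ∀ ψ, ⟪ψ, T ψ⟫_ℂ
      = ((∫ r, J.indicator (fun _ => (1 : ℝ)) r ∂(resolventMeasure A l ψ) : ℝ) : ℂ) := by
  have hfin := fun ψ => isFiniteMeasure_resolventMeasure hR h ψ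
  induction J, hJ using MeasurableSpace.induction_on_inter
    (borel_eq_generateFrom_isClosed (α := ℝ) ▸ BorelSpace.measurable_eq) isPiSystem_isClosed with
  | empty => exact ⟨0, fun ψ => by simp⟩
  | basic J hJ =>
    have hδ : ∀ n : ℕ, (0 : ℝ) < 1 / (n + 1) := fun n => by positivity
    have lim := thickenedIndicator_tendsto_indicator_closure hδ
      tendsto_one_div_add_atTop_nhds_zero_nat J
    rw [IsClosed.closure_eq hJ, tendsto_pi_nhds] at lim
    have hcont : ∀ n, Continuous fun r => ((thickenedIndicator (hδ n) J r : NNReal) : ℝ) :=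
      fun n => NNReal.continuous_coe.comp (thickenedIndicator (hδ n) J).continuous
    refine exists_resolventCalculus_of_tendsto hR h
      (f := fun n r => ((thickenedIndicator (hδ n) J r : NNReal) : ℝ))
      (fun n => (hcont n).measurable) ?_ ?_ ?_
    · intro n r
      rw [Real.norm_of_nonneg (NNReal.coe_nonneg _)]
      exact_mod_cast thickenedIndicator_le_one (hδ n) J r
    · intro r
      have := (NNReal.continuous_coe.tendsto _).comp (lim r)
      refine this.trans (le_of_eq ?_)
      congr 1
      by_cases hr : r ∈ J <;> simp [hr]
    · exact fun n => ⟨cfc _ R, fun ψ => integral_resolventMeasure hR h ψ (hcont n)⟩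
  | compl J hJ ih =>
    obtain ⟨T, hT⟩ := ih
    refine ⟨1 - T, fun ψ => ?_⟩
    have := hfin ψ
    rw [sub_apply, inner_sub_right, hT, one_apply_eq_self,
      inner_self_eq_norm_sq_to_K, Set.indicator_compl]
    have e : ∫ r, ((fun _ => (1 : ℝ)) - J.indicator (fun _ => (1 : ℝ)) : ℝ → ℝ) r
        ∂(resolventMeasure A l ψ)
        = ‖ψ‖ ^ 2 - ∫ r, J.indicator (fun _ => (1 : ℝ)) r ∂(resolventMeasure A l ψ) := by
      simp only [Pi.sub_apply]
      rw [integral_sub (integrable_const _) ((integrable_const _).indicator hJ), integral_const,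
        resolventMeasure_real_univ hR h]
      simp
    rw [e]
    push_cast
    rfl
  | iUnion f hd hm ih =>
    choose T hT using ih
    have hpart : ∀ n r, ∑ i ∈ Finset.range n, (f i).indicator (fun _ => (1 : ℝ)) r
        = (⋃ i ∈ Finset.range n, f i).indicator (fun _ => (1 : ℝ)) r := by
      intro n r
      rw [Finset.indicator_biUnion]
      intro i _ j _ hij
      exact hd hij
    refine exists_resolventCalculus_of_tendsto hR h
      (f := fun n r => ∑ i ∈ Finset.range n, (f i).indicator (fun _ => (1 : ℝ)) r) ?_ ?_ ?_ ?_
    · intro n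
      exact Finset.measurable_sum _ fun i _ => measurable_const.indicator (hm i)
    · intro n r
      simp only [hpart]
      refine (norm_indicator_le_norm_self _ _).trans ?_
      simp
    · intro r
      simp only [hpart]
      by_cases hr : r ∈ ⋃ i, f i
      · rw [Set.indicator_of_mem hr]
        obtain ⟨i, hi⟩ := Set.mem_iUnion.1 hr
        refine tendsto_const_nhds.congr' ?_
        filter_upwards [eventually_gt_atTop i] with n hn
        rw [Set.indicator_of_mem]
        exact Set.mem_biUnion (Finset.mem_coe.2 (Finset.mem_range.2 hn)) hi
      · rw [Set.indicator_of_notMem hr]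
        refine tendsto_const_nhds.congr fun n => ?_
        rw [Set.indicator_of_notMem]
        intro h2
        simp only [Set.mem_iUnion] at h2 hr
        obtain ⟨i, _, hi⟩ := h2
        exact hr ⟨i, hi⟩
    · intro n
      refine ⟨∑ i ∈ Finset.range n, T i, fun ψ => ?_⟩
      have := hfin ψ
      rw [sum_apply, inner_sum]
      simp_rw [hT]
      rw [integral_finsetSum _ fun i _ => (integrable_const _).indicator (hm i)]
      push_cast
      rfl

theorem IsBorelCalculus.borelCalculus_eq {f : ℝ → ℂ} {T : E →L[ℂ] E}
    (h : IsBorelCalculus A f T) : borelCalculus A f = T := by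
  have hex : ∃ T : E →L[ℂ] E, IsBorelCalculus A f T := ⟨T, h⟩
  rw [borelCalculus, dif_pos hex]
  exact ext_of_inner_self fun x => (hex.choose_spec x).2.trans (h x).2.symm

/-- Only `r > 0` has to be compared, because the spectral measures of `R` live on `(0, ‖R‖]`. The
function `f` must nevertheless be continuous across `0`, which may belong to the spectrum of `R`. -/
theorem isBorelCalculus_cfc (hR : 0 ≤ R) (h : IsResolventAt A (-l) R) {f : ℝ → ℝ}
    (hf : Continuous f) {F : ℝ → ℂ} (hF : Measurable F) (hfF : ∀ r, 0 < r → F (r⁻¹ - l) = f r) :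
    IsBorelCalculus A F (cfc f R) := by
  have hsa : IsSelfAdjoint R := IsSelfAdjoint.of_nonneg hR
  intro ψ
  have hae : (fun r => F (r⁻¹ - l)) =ᵐ[resolventMeasure A l ψ] fun r => (f r : ℂ) := by
    filter_upwards [ae_resolventMeasure_pos hR h ψ] with r hr using hfF r hr.1
  rw [spectralMeasure_eq_map hR h]
  constructor
  · rw [integrable_map_measure hF.aestronglyMeasurable (measurable_inv_sub l).aemeasurable]
    exact (integrable_resolventMeasure hsa h ψ hf).ofReal.congr hae.symm
  · rw [integral_map (measurable_inv_sub l).aemeasurable hF.aestronglyMeasurable,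
      integral_resolventMeasure hsa h ψ hf, integral_congr_ae hae]
    exact integral_complex_ofReal.symm

theorem exists_isBorelCalculus_indicator (hR : 0 ≤ R) (h : IsResolventAt A (-l) R) {I : Set ℝ}
    (hI : MeasurableSet I) : ∃ T : E →L[ℂ] E, IsBorelCalculus A (I.indicator 1) T := by
  have hsa : IsSelfAdjoint R := IsSelfAdjoint.of_nonneg hR
  obtain ⟨T, hT⟩ := exists_resolventCalculus_indicator hsa h (measurable_inv_sub l hI)
  refine ⟨T, fun ψ => ?_⟩
  have := isFiniteMeasure_resolventMeasure hsa h ψ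
  have hm : Measurable (I.indicator (1 : ℝ → ℂ)) := measurable_one.indicator hI
  rw [spectralMeasure_eq_map hR h]
  constructor
  · have : IsFiniteMeasure ((resolventMeasure A l ψ).map fun r => r⁻¹ - l) := inferInstance
    exact (integrable_const (1 : ℂ)).indicator hI
  · rw [integral_map (measurable_inv_sub l).aemeasurable hm.aestronglyMeasurable, hT,
      ← integral_complex_ofReal]
    refine integral_congr_ae (Eventually.of_forall fun r => ?_)
    by_cases hr : r⁻¹ - l ∈ I <;> simp [Set.indicator, hr]

theorem inner_borelCalculus_indicator (hR : 0 ≤ R) (h : IsResolventAt A (-l) R) {I : Set ℝ}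
    (hI : MeasurableSet I) (ψ : E) :
    ⟪ψ, borelCalculus A (I.indicator 1) ψ⟫_ℂ = ((spectralMeasure A ψ I).toReal : ℂ) := by
  obtain ⟨T, hT⟩ := exists_isBorelCalculus_indicator hR h hI
  rw [hT.borelCalculus_eq, (hT ψ).2]
  refine (integral_indicator_const (1 : ℂ) hI).trans ?_
  simp [Measure.real]

end BorelCalculus

section HilbertSchmidt

variable {E : Type*} [NormedAddCommGroup E] [InnerProductSpace ℂ E] [CompleteSpace E]

/-! ### Singular values -/

theorem bddBelow_singularValue_set (k : ℕ) (T : E →L[ℂ] E) :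
    BddBelow {c : ℝ | ∃ R : E →L[ℂ] E, R.toLinearMap.rank ≤ (k : Cardinal) ∧ c = ‖T - R‖} :=
  ⟨0, by rintro _ ⟨R, -, rfl⟩; exact norm_nonneg _⟩

theorem singularValue_le {k : ℕ} (T : E →L[ℂ] E) {R : E →L[ℂ] E}
    (hR : R.toLinearMap.rank ≤ (k : Cardinal)) : singularValue k T ≤ ‖T - R‖ :=
  csInf_le (bddBelow_singularValue_set k T) ⟨R, hR, rfl⟩

theorem nonempty_singularValue_set (k : ℕ) (T : E →L[ℂ] E) :
    {c : ℝ | ∃ R : E →L[ℂ] E, R.toLinearMap.rank ≤ (k : Cardinal) ∧ c = ‖T - R‖}.Nonempty :=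
  ⟨‖T - 0‖, 0, by simp [LinearMap.rank_zero], rfl⟩

theorem singularValue_nonneg (k : ℕ) (T : E →L[ℂ] E) : 0 ≤ singularValue k T := by
  refine le_csInf (nonempty_singularValue_set k T) ?_
  rintro _ ⟨R, -, rfl⟩
  exact norm_nonneg _

theorem exists_norm_sub_lt_singularValue (k : ℕ) (T : E →L[ℂ] E) {ε : ℝ} (hε : 0 < ε) :
    ∃ R : E →L[ℂ] E, R.toLinearMap.rank ≤ (k : Cardinal) ∧ ‖T - R‖ < singularValue k T + ε := by
  obtain ⟨_, ⟨R, hR, rfl⟩, hlt⟩ := exists_lt_of_csInf_lt (nonempty_singularValue_set k T)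
    (show sInf _ < singularValue k T + ε from lt_add_of_pos_right _ hε)
  exact ⟨R, hR, hlt⟩

theorem singularValue_antitone (T : E →L[ℂ] E) : Antitone fun k => singularValue k T := by
  intro j k hjk
  refine le_csInf (nonempty_singularValue_set j T) ?_
  rintro _ ⟨R, hR, rfl⟩
  exact singularValue_le T (hR.trans (by exact_mod_cast hjk))

/-- If `P` and `Q` nearly realize the two approximation numbers, then `S T - (P T + (S - P) Q) = (S
- P)(T - Q)`, and the subtracted operator has rank at most `j + k`. -/
theorem singularValue_comp_le (j k : ℕ) (S T : E →L[ℂ] E) :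
    singularValue (j + k) (S ∘L T) ≤ singularValue j S * singularValue k T := by
  have key : ∀ ε : ℝ, 0 < ε → singularValue (j + k) (S ∘L T)
      ≤ (singularValue j S + ε) * (singularValue k T + ε) := by
    intro ε hε
    obtain ⟨P, hP, hP'⟩ := exists_norm_sub_lt_singularValue j S hε
    obtain ⟨Q, hQ, hQ'⟩ := exists_norm_sub_lt_singularValue k T hε
    have hrank : (P ∘L T + (S - P) ∘L Q).toLinearMap.rank ≤ ((j + k : ℕ) : Cardinal) := by
      refine (LinearMap.rank_add_le (P ∘L T).toLinearMap ((S - P) ∘L Q).toLinearMap).trans ?_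
      push_cast
      exact add_le_add ((LinearMap.rank_comp_le_left T.toLinearMap P.toLinearMap).trans hP)
        ((LinearMap.rank_comp_le_right Q.toLinearMap (S - P).toLinearMap).trans hQ)
    refine (singularValue_le _ hrank).trans ?_
    have e : S ∘L T - (P ∘L T + (S - P) ∘L Q) = (S - P) ∘L (T - Q) := by
      ext x
      simp
      abel
    rw [e]
    exact (ContinuousLinearMap.opNorm_comp_le _ _).trans
      (mul_le_mul hP'.le hQ'.le (norm_nonneg _) ((norm_nonneg _).trans hP'.le))
  have lim : Tendsto (fun ε : ℝ => (singularValue j S + ε) * (singularValue k T + ε)) (𝓝[>] 0)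
      (𝓝 ((singularValue j S + 0) * (singularValue k T + 0))) := by
    refine Tendsto.mono_left ?_ nhdsWithin_le_nhds
    exact Continuous.tendsto (by fun_prop) 0
  rw [add_zero, add_zero] at lim
  exact ge_of_tendsto lim (by filter_upwards [self_mem_nhdsWithin] with ε hε using key ε hε)

theorem isCompactOperator_of_rank_le {k : ℕ} {R : E →L[ℂ] E}
    (hR : R.toLinearMap.rank ≤ (k : Cardinal)) : IsCompactOperator R := by
  have hfd : FiniteDimensional ℂ R.toLinearMap.range :=
    Module.rank_lt_aleph0_iff.1 (hR.trans_lt (Cardinal.natCast_lt_aleph0))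
  have : ProperSpace R.toLinearMap.range := FiniteDimensional.proper ℂ _
  have h1 : IsCompactOperator (id : R.toLinearMap.range → R.toLinearMap.range) :=
    isCompactOperator_id
  have h2 := (h1.comp_clm (R.codRestrict R.toLinearMap.range fun x => ⟨x, rfl⟩)).clm_comp
    R.toLinearMap.range.subtypeL
  exact h2

theorem isCompactOperator_of_summable_singularValue {T : E →L[ℂ] E}
    (hT : Summable fun k : ℕ => singularValue k T) : IsCompactOperator T := by
  have h : ∀ k : ℕ, ∃ R : E →L[ℂ] E, R.toLinearMap.rank ≤ (k : Cardinal) ∧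
      ‖T - R‖ < singularValue k T + 1 / (k + 1) :=
    fun k => exists_norm_sub_lt_singularValue k T (by positivity)
  choose R hR hlt using h
  have lim : Tendsto R atTop (𝓝 T) := by
    rw [tendsto_iff_norm_sub_tendsto_zero]
    refine squeeze_zero (fun _ => norm_nonneg _) (fun k => ?_)
      (by simpa using hT.tendsto_atTop_zero.add (tendsto_one_div_add_atTop_nhds_zero_nat (𝕜 := ℝ)))
    rw [norm_sub_rev]
    simpa using (hlt k).le
  exact isCompactOperator_of_tendsto lim (Eventually.of_forall fun k =>
    isCompactOperator_of_rank_le (hR k))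

/-! ### Hilbert-Schmidt operators -/

theorem HilbertBasis.tsum_enorm_inner_sq {ι : Type*} (b : HilbertBasis ι ℂ E) (x : E) :
    ∑' i, ‖⟪b i, x⟫_ℂ‖ₑ ^ 2 = ‖x‖ₑ ^ 2 := by
  have h := b.hasSum_inner_mul_inner x x
  rw [inner_self_eq_norm_sq_to_K] at h
  have h2 : HasSum (fun i => ‖⟪b i, x⟫_ℂ‖ ^ 2) (‖x‖ ^ 2) := by
    have h3 := Complex.hasSum_re h
    convert h3 using 1
    · ext i
      rw [← inner_conj_symm, RCLike.norm_conj, Complex.mul_conj']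
      norm_cast
    · norm_cast
  have h4 := h2.tsum_eq
  have e : ∀ y : ℝ, 0 ≤ y → ENNReal.ofReal (y ^ 2) = ENNReal.ofReal y ^ 2 :=
    fun y hy => ENNReal.ofReal_pow hy 2
  rw [← ofReal_norm, ← e _ (norm_nonneg x), ← h4, ENNReal.ofReal_tsum_of_nonneg
    (fun i => by positivity) h2.summable]
  simp_rw [e _ (norm_nonneg _), ofReal_norm]

theorem Orthonormal.tsum_enorm_inner_sq_le {ι : Type*} {v : ι → E} (hv : Orthonormal ℂ v) (x : E) :
    ∑' i, ‖⟪v i, x⟫_ℂ‖ₑ ^ 2 ≤ ‖x‖ₑ ^ 2 := by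
  have h1 := hv.tsum_inner_products_le x
  have h2 := hv.inner_products_summable x
  have e : ∀ y : ℝ, 0 ≤ y → ENNReal.ofReal (y ^ 2) = ENNReal.ofReal y ^ 2 :=
    fun y hy => ENNReal.ofReal_pow hy 2
  have h3 := ENNReal.ofReal_le_ofReal h1
  rw [ENNReal.ofReal_tsum_of_nonneg (fun i => by positivity) h2, e _ (norm_nonneg _),
    ofReal_norm] at h3
  simpa only [e _ (norm_nonneg _), ofReal_norm] using h3

/-- Expand both sides by Parseval and exchange the double sum. In particular the Hilbert-Schmidt
norm does not depend on the basis. -/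
theorem tsum_enorm_sq_adjoint {ι κ : Type*} (b : HilbertBasis ι ℂ E) (c : HilbertBasis κ ℂ E)
    (A : E →L[ℂ] E) :
    ∑' i, ‖A (b i)‖ₑ ^ 2 = ∑' j, ‖ContinuousLinearMap.adjoint A (c j)‖ₑ ^ 2 := by
  simp_rw [← HilbertBasis.tsum_enorm_inner_sq c (A _),
    ← HilbertBasis.tsum_enorm_inner_sq b (ContinuousLinearMap.adjoint A _)]
  rw [ENNReal.tsum_comm]
  congr! 5 with j i
  rw [ContinuousLinearMap.adjoint_inner_right, ← inner_conj_symm, ← ofReal_norm, RCLike.norm_conj,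
    ofReal_norm]

/-- The same double sum as for the adjoint, with Bessel's inequality for the incomplete system. -/
theorem Orthonormal.tsum_enorm_sq_le {ι κ : Type*} {v : ι → E} (hv : Orthonormal ℂ v)
    (b : HilbertBasis κ ℂ E) (A : E →L[ℂ] E) :
    ∑' i, ‖A (v i)‖ₑ ^ 2 ≤ ∑' j, ‖A (b j)‖ₑ ^ 2 := by
  rw [tsum_enorm_sq_adjoint b b]
  simp_rw [← HilbertBasis.tsum_enorm_inner_sq b (A _)]
  rw [ENNReal.tsum_comm]
  refine ENNReal.tsum_le_tsum fun j => ?_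
  refine le_trans (le_of_eq ?_)
    (Orthonormal.tsum_enorm_inner_sq_le hv (ContinuousLinearMap.adjoint A (b j)))
  congr! 3 with i
  rw [ContinuousLinearMap.adjoint_inner_right, ← inner_conj_symm, ← ofReal_norm, RCLike.norm_conj,
    ofReal_norm]

/-- The norm of `A` on `Kᗮ` need not be attained, so the factor `2` leaves room for an approximate
maximizer. The vector `e = 0` covers the case in which `A` vanishes on `Kᗮ`. -/
theorem exists_almost_maximizer (A : E →L[ℂ] E) (K : Submodule ℂ E) [K.HasOrthogonalProjection] :
    ∃ e ∈ Kᗮ, (e ≠ 0 → ‖e‖ = 1) ∧ ‖A - A ∘L K.starProjection‖ ≤ 2 * ‖A e‖ := by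
  set B := A - A ∘L K.starProjection with hB
  rcases eq_or_ne ‖B‖ 0 with h0 | h0
  · exact ⟨0, zero_mem _, fun h => absurd rfl h, by simp [h0]⟩
  have hpos : 0 < ‖B‖ := lt_of_le_of_ne (norm_nonneg _) (Ne.symm h0)
  obtain ⟨x, hx⟩ : ∃ x, ‖B‖ / 2 * ‖x‖ < ‖B x‖ := by
    by_contra! hcon
    have := ContinuousLinearMap.opNorm_le_bound B (by positivity) hcon
    linarith
  set y := x - K.starProjection x with hy
  have hBx : B x = A y := by simp [hB, hy]
  have hym : y ∈ Kᗮ := K.sub_starProjection_mem_orthogonal x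
  have hyn : ‖y‖ ≤ ‖x‖ := by
    rw [hy, ← Submodule.starProjection_orthogonal_val]
    exact Kᗮ.norm_starProjection_apply_le x
  have hy0 : y ≠ 0 := by
    intro h
    rw [hBx, h, map_zero, norm_zero] at hx
    exact absurd hx (not_lt.2 (by positivity))
  have hy1 : 0 < ‖y‖ := norm_pos_iff.2 hy0
  refine ⟨(‖y‖⁻¹ : ℂ) • y, Submodule.smul_mem _ _ hym, fun _ => ?_, ?_⟩
  · rw [norm_smul]
    simp [hy1.ne']
  · rw [map_smul, norm_smul, ← hBx, norm_inv, Complex.norm_real, norm_norm]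
    rw [inv_mul_eq_div, ← mul_div_assoc, le_div_iff₀ hy1]
    nlinarith

/-- The greedy choice of nearly maximizing vectors, together with the span of the previous ones. -/
def greedySpan (A : E →L[ℂ] E) : ℕ → {K : Submodule ℂ E // FiniteDimensional ℂ K}
  | 0 => ⟨⊥, inferInstance⟩
  | n + 1 =>
    haveI := (greedySpan A n).2
    ⟨(greedySpan A n).1 ⊔ ℂ ∙ (exists_almost_maximizer A (greedySpan A n).1).choose, inferInstance⟩

instance (A : E →L[ℂ] E) (n : ℕ) : FiniteDimensional ℂ (greedySpan A n).1 := (greedySpan A n).2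

/-- The greedily chosen nearly maximizing vectors. -/
def greedyVec (A : E →L[ℂ] E) (n : ℕ) : E :=
  (exists_almost_maximizer A (greedySpan A n).1).choose

theorem greedySpan_succ (A : E →L[ℂ] E) (n : ℕ) :
    (greedySpan A (n + 1)).1 = (greedySpan A n).1 ⊔ ℂ ∙ greedyVec A n := rfl

theorem greedyVec_spec (A : E →L[ℂ] E) (n : ℕ) : greedyVec A n ∈ (greedySpan A n).1ᗮ ∧
    (greedyVec A n ≠ 0 → ‖greedyVec A n‖ = 1) ∧
    ‖A - A ∘L (greedySpan A n).1.starProjection‖ ≤ 2 * ‖A (greedyVec A n)‖ :=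
  (exists_almost_maximizer A (greedySpan A n).1).choose_spec

theorem greedySpan_mono (A : E →L[ℂ] E) : Monotone fun n => (greedySpan A n).1 :=
  monotone_nat_of_le_succ fun n => by rw [greedySpan_succ]; exact le_sup_left

theorem rank_greedySpan_le (A : E →L[ℂ] E) (n : ℕ) :
    Module.rank ℂ (greedySpan A n).1 ≤ (n : Cardinal) := by
  induction n with
  | zero =>
    simp only [Nat.cast_zero]
    exact (rank_bot ℂ E).le
  | succ n ih =>
    rw [greedySpan_succ]
    refine (Submodule.rank_add_le_rank_add_rank _ _).trans ?_
    push_cast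
    refine add_le_add ih ((rank_span_le _).trans ?_)
    simp

theorem inner_greedyVec (A : E →L[ℂ] E) {m n : ℕ} (hmn : m < n) :
    ⟪greedyVec A m, greedyVec A n⟫_ℂ = 0 := by
  refine (greedyVec_spec A n).1 _ (greedySpan_mono A (Nat.succ_le_of_lt hmn) ?_)
  change greedyVec A m ∈ (greedySpan A (m + 1)).1
  rw [greedySpan_succ]
  exact Submodule.mem_sup_right (Submodule.mem_span_singleton_self _)

theorem orthonormal_greedyVec (A : E →L[ℂ] E) :
    Orthonormal ℂ fun n : {n : ℕ // greedyVec A n ≠ 0} => greedyVec A n := by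
  refine ⟨fun n => (greedyVec_spec A n).2.1 n.2, fun m n hmn => ?_⟩
  rcases lt_or_gt_of_ne (fun h => hmn (Subtype.ext h) : (m : ℕ) ≠ n) with h | h
  · exact inner_greedyVec A h
  · change ⟪greedyVec A m, greedyVec A n⟫_ℂ = 0
    rw [← inner_conj_symm, inner_greedyVec A h, map_zero]

/-- Composing `A` with the projection onto the span of the first `n` greedy vectors gives an
approximation of rank at most `n`, whose error the next greedy vector controls. -/
theorem singularValue_le_greedyVec (A : E →L[ℂ] E) (n : ℕ) :
    singularValue n A ≤ 2 * ‖A (greedyVec A n)‖ := by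
  refine (singularValue_le A (R := A ∘L (greedySpan A n).1.starProjection) ?_).trans
    (greedyVec_spec A n).2.2
  refine (LinearMap.rank_comp_le_right ((greedySpan A n).1.starProjection).toLinearMap
    A.toLinearMap).trans ?_
  refine le_trans ?_ (rank_greedySpan_le A n)
  rw [LinearMap.rank]
  exact Submodule.rank_mono (by
    rintro _ ⟨x, rfl⟩
    exact Submodule.starProjection_apply_mem _ x)

/-- The nonzero greedy vectors are orthonormal, so the sum of `‖A eₙ‖²` is at most the squared
Hilbert-Schmidt norm, while `singularValue n A ≤ 2 ‖A eₙ‖`. -/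
theorem summable_singularValue_sq {ι : Type*} (b : HilbertBasis ι ℂ E) {A : E →L[ℂ] E}
    (hA : ∑' i, ‖A (b i)‖ₑ ^ 2 ≠ ∞) : Summable fun k => singularValue k A ^ 2 := by
  have h1 := Orthonormal.tsum_enorm_sq_le (orthonormal_greedyVec A) b A
  have h2 : ∑' n : {n : ℕ // greedyVec A n ≠ 0}, ‖A (greedyVec A n)‖ₑ ^ 2
      = ∑' n, ‖A (greedyVec A n)‖ₑ ^ 2 := by
    refine tsum_subtype_eq_of_support_subset (f := fun n => ‖A (greedyVec A n)‖ₑ ^ 2)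
      (s := {n | greedyVec A n ≠ 0}) ?_
    intro n hn h0
    apply hn
    simp [h0]
  rw [h2] at h1
  have h3 : ∑' n, ‖A (greedyVec A n)‖ₑ ^ 2 ≠ ∞ := ne_top_of_le_ne_top hA h1
  have h4 : Summable fun n => ‖A (greedyVec A n)‖ ^ 2 := by
    have := ENNReal.summable_toReal h3
    simpa using this
  refine Summable.of_nonneg_of_le (fun k => sq_nonneg _) (fun k => ?_) (h4.mul_left 4)
  have := singularValue_le_greedyVec A k
  have h0 := singularValue_nonneg k A
  nlinarith [norm_nonneg (A (greedyVec A k))]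

/-- The singular value of `S T` of index `2k` is at most the product of those of `S` and `T` of
index `k`, a summable product of two square summable sequences. Odd indices follow by monotonicity.
-/
theorem isTraceClass_comp {ι κ : Type*} (b : HilbertBasis ι ℂ E) (c : HilbertBasis κ ℂ E)
    {S T : E →L[ℂ] E} (hS : ∑' i, ‖S (b i)‖ₑ ^ 2 ≠ ∞) (hT : ∑' i, ‖T (c i)‖ₑ ^ 2 ≠ ∞) :
    IsTraceClass (S ∘L T) := by
  have h1 := summable_singularValue_sq b hS
  have h2 := summable_singularValue_sq c hT
  have heven : Summable fun k => singularValue (2 * k) (S ∘L T) := by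
    refine Summable.of_nonneg_of_le (fun k => singularValue_nonneg _ _) (fun k => ?_) (h1.add h2)
    have h3 := singularValue_comp_le k k S T
    rw [← two_mul] at h3
    refine h3.trans ?_
    generalize singularValue k S = x
    generalize singularValue k T = y
    nlinarith [sq_nonneg (x - y), sq_nonneg x, sq_nonneg y]
  have hodd : Summable fun k => singularValue (2 * k + 1) (S ∘L T) :=
    Summable.of_nonneg_of_le (fun k => singularValue_nonneg _ _)
      (fun k => singularValue_antitone _ (Nat.le_succ _)) heven
  have hsum : Summable fun k => singularValue k (S ∘L T) :=
    (HasSum.even_add_odd (f := fun k => singularValue k (S ∘L T)) heven.hasSum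
      hodd.hasSum).summable
  exact ⟨isCompactOperator_of_summable_singularValue hsum, hsum⟩

end HilbertSchmidt

section KernelVector

variable {d : ℕ}

/-! ### Multiplication operators -/

theorem coeFn_mulOp {f : Space d → ℂ} (hf : MemLp f ∞ volume) (u : L2 d) :
    mulOp f u =ᵐ[volume] fun x => f x * u x := by
  rw [mulOp, dif_pos hf]
  have h1 := ContinuousLinearMap.coeFn_holder (r := 2) (ContinuousLinearMap.mul ℂ ℂ) (hf.toLp f) u
  filter_upwards [h1, hf.coeFn_toLp] with x h2 h3
  rw [← h3]
  exact h2

theorem mulOp_ext {f : Space d → ℂ} (hf : MemLp f ∞ volume) {T : L2 d →L[ℂ] L2 d}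
    (hT : ∀ u, T u =ᵐ[volume] fun x => f x * u x) : mulOp f = T := by
  ext1 u
  exact Lp.ext ((coeFn_mulOp hf u).trans (hT u).symm)

theorem inner_mulOp_left {f : Space d → ℂ} (hf : MemLp f ∞ volume) (u v : L2 d) :
    ⟪mulOp f u, v⟫_ℂ = ⟪u, mulOp (fun x => starRingEnd ℂ (f x)) v⟫_ℂ := by
  rw [L2.inner_def, L2.inner_def]
  refine integral_congr_ae ?_
  filter_upwards [coeFn_mulOp hf u, coeFn_mulOp hf.star v] with x h1 h2
  have h2' : (mulOp (fun x => starRingEnd ℂ (f x)) v) x = starRingEnd ℂ (f x) * v x := h2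
  rw [h1, h2']
  simp only [RCLike.inner_apply, map_mul]
  ring

theorem adjoint_mulOp {f : Space d → ℂ} (hf : MemLp f ∞ volume) :
    ContinuousLinearMap.adjoint (mulOp f) = mulOp fun x => starRingEnd ℂ (f x) := by
  symm
  rw [ContinuousLinearMap.eq_adjoint_iff]
  intro u v
  rw [inner_mulOp_left (f := fun x => starRingEnd ℂ (f x)) hf.star]
  simp

theorem adjoint_mulOp_ofReal {f : Space d → ℝ} (hf : MemLp (fun x => (f x : ℂ)) ∞ volume) :
    ContinuousLinearMap.adjoint (mulOp fun x => (f x : ℂ)) = mulOp fun x => (f x : ℂ) := by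
  rw [adjoint_mulOp hf]
  simp

theorem norm_mulOp_apply_le {f : Space d → ℂ} (hf : MemLp f ∞ volume) {C : ℝ}
    (hC : ∀ᵐ x, ‖f x‖ ≤ C) (u : L2 d) : ‖mulOp f u‖ ≤ C * ‖u‖ := by
  refine Lp.norm_le_mul_norm_of_ae_le_mul ?_
  filter_upwards [coeFn_mulOp hf u, hC] with x h1 h2
  rw [h1, norm_mul]
  gcongr

theorem mulOp_comp {f g : Space d → ℂ} (hf : MemLp f ∞ volume) (hg : MemLp g ∞ volume)
    (hfg : MemLp (fun x => f x * g x) ∞ volume) :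
    mulOp f ∘L mulOp g = mulOp fun x => f x * g x := by
  symm
  refine mulOp_ext hfg fun u => ?_
  filter_upwards [coeFn_mulOp hf (mulOp g u), coeFn_mulOp hg u] with x h1 h2
  rw [ContinuousLinearMap.comp_apply, h1, h2, mul_assoc]

theorem memLp_top_of_continuous_bounded {f : Space d → ℂ} (hf : AEStronglyMeasurable f volume)
    {C : ℝ} (hC : ∀ x, ‖f x‖ ≤ C) : MemLp f ∞ volume :=
  memLp_top_of_bound hf C (Eventually.of_forall hC)

/-! ### Operators given by Hilbert space valued kernels -/

instance : Fact ((2 : ℝ≥0∞) ≠ ∞) := ⟨by norm_num⟩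

instance : SecondCountableTopology (L2 d) := Lp.SecondCountableTopology

theorem countable_of_hilbertBasis {E ι : Type*} [NormedAddCommGroup E] [InnerProductSpace ℂ E]
    [TopologicalSpace.SeparableSpace E] (b : HilbertBasis ι ℂ E) : Countable ι := by
  refine Pairwise.countable_of_isOpen_disjoint (s := fun i => Metric.ball (b i) (1 / 2))
    (fun i j hij => ?_) (fun i => Metric.isOpen_ball)
    (fun i => ⟨b i, Metric.mem_ball_self (by norm_num)⟩)
  refine Metric.ball_disjoint_ball ?_
  have h1 : ‖b i - b j‖ ^ 2 = 2 := by
    rw [@norm_sub_sq ℂ, b.orthonormal.2 hij, b.orthonormal.1 i, b.orthonormal.1 j]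
    norm_num
  rw [dist_eq_norm]
  nlinarith [norm_nonneg (b i - b j)]

/-- `κ` represents the operator `A` in the sense that `A f (x) = ⟨κ x, f⟩`. -/
structure IsKernelVec (A : L2 d →L[ℂ] L2 d) (κ : Space d → L2 d) : Prop where
  meas : AEStronglyMeasurable κ volume
  apply_eq : ∀ f : L2 d, ∀ᵐ x, A f x = ⟪κ x, f⟫_ℂ

/-- The exceptional null set in `hA` depends on `f`. Restricting to combinations of finitely many `b
i` with coefficients from a countable dense set yields one null set, and continuity in the
coefficients recovers all combinations. -/
theorem ae_sum_sq_le_of_forall_ae_norm_le {ι : Type*} (b : HilbertBasis ι ℂ (L2 d))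
    {A : L2 d →L[ℂ] L2 d} {h : Space d → ℝ}
    (hA : ∀ f : L2 d, ∀ᵐ x, ‖A f x‖ ≤ h x * ‖f‖) (s : Finset ι) :
    ∀ᵐ x, ∑ i ∈ s, ‖A (b i) x‖ ^ 2 ≤ h x ^ 2 := by
  have hlin : ∀ c : EuclideanSpace ℂ s, ∀ᵐ x,
      A (∑ i : s, c i • b i) x = ∑ i : s, c i * A (b i) x := by
    intro c
    rw [map_sum]
    have h1 := Lp.coeFn_finsetSum (Finset.univ : Finset s) fun i => A (c i • b i)
    have h2 : ∀ᵐ x, ∀ i : s, A (c i • b i) x = c i * A (b i) x := by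
      rw [ae_all_iff]
      intro i
      rw [map_smul]
      filter_upwards [Lp.coeFn_smul (c i) (A (b i))] with x hx
      simpa using hx
    filter_upwards [h1, h2] with x h3 h4
    rw [h3, Finset.sum_apply]
    exact Finset.sum_congr rfl fun i _ => h4 i
  have hnorm : ∀ c : EuclideanSpace ℂ s, ‖∑ i : s, c i • b i‖ = ‖c‖ := by
    intro c
    have ho : Orthonormal ℂ fun i : s => b i := b.orthonormal.comp _ Subtype.val_injective
    have h1 := ho.inner_sum c c Finset.univ
    rw [inner_self_eq_norm_sq_to_K] at h1
    have h2 : ‖∑ i : s, c i • b i‖ ^ 2 = ‖c‖ ^ 2 := by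
      rw [EuclideanSpace.norm_sq_eq]
      simp_rw [Complex.conj_mul'] at h1
      apply Complex.ofReal_injective
      push_cast
      exact h1
    exact (sq_eq_sq₀ (norm_nonneg _) (norm_nonneg _)).1 h2
  have hall : ∀ᵐ x, ∀ n : ℕ,
      ‖∑ i : s, TopologicalSpace.denseSeq (EuclideanSpace ℂ s) n i * A (b i) x‖
      ≤ h x * ‖TopologicalSpace.denseSeq (EuclideanSpace ℂ s) n‖ := by
    rw [ae_all_iff]
    intro n
    filter_upwards [hlin (TopologicalSpace.denseSeq (EuclideanSpace ℂ s) n),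
      hA (∑ i : s, TopologicalSpace.denseSeq (EuclideanSpace ℂ s) n i • b i)] with x h1 h2
    rw [← h1, ← hnorm]
    exact h2
  filter_upwards [hall] with x hx
  have hx' : ∀ c : EuclideanSpace ℂ s, ‖∑ i : s, c i * A (b i) x‖ ≤ h x * ‖c‖ := by
    intro c
    refine (TopologicalSpace.denseRange_denseSeq (EuclideanSpace ℂ s)).induction_on
      (p := fun c : EuclideanSpace ℂ s => ‖∑ i : s, c i * A (b i) x‖ ≤ h x * ‖c‖) c ?_ hx
    exact isClosed_le (by fun_prop) (by fun_prop)
  -- Conjugate values as coefficients give `S ≤ h x * √S`, the extremal case of Cauchy-Schwarz.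
  have h1 := hx' (WithLp.toLp 2 fun i : s => starRingEnd ℂ (A (b i) x))
  set S := ∑ i ∈ s, ‖A (b i) x‖ ^ 2 with hS
  have hS' : S = ∑ i : s, ‖A (b i) x‖ ^ 2 := (Finset.sum_coe_sort s fun i => ‖A (b i) x‖ ^ 2).symm
  have hS0 : 0 ≤ S := Finset.sum_nonneg fun i _ => sq_nonneg _
  have e1 : ‖∑ i : s, starRingEnd ℂ (A (b i) x) * A (b i) x‖ = S := by
    simp_rw [Complex.conj_mul']
    rw [hS']
    have : (∑ i : s, ((‖A (b i) x‖ : ℂ)) ^ 2) = ((∑ i : s, ‖A (b i) x‖ ^ 2 : ℝ) : ℂ) := by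
      push_cast; rfl
    rw [this, Complex.norm_real, Real.norm_of_nonneg (by rw [← hS']; exact hS0)]
  have e2 : ‖(WithLp.toLp 2 fun i : s => starRingEnd ℂ (A (b i) x) : EuclideanSpace ℂ s)‖
      = Real.sqrt S := by
    rw [EuclideanSpace.norm_eq, hS']
    simp
  simp only [] at h1
  rw [e1, e2] at h1
  have h2 := Real.sq_sqrt hS0
  rcases eq_or_lt_of_le (Real.sqrt_nonneg S) with h3 | h3
  · rw [← h2, ← h3]
    simpa using sq_nonneg (h x)
  · have h4 : Real.sqrt S ≤ h x := by
      by_contra! hcon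
      nlinarith
    rw [← h2]
    gcongr

/-- A Riesz representation of the functionals `f ↦ A f (x)`, which make sense only up to null sets.
For a countable basis `b` one takes `κ x = ∑ conj (A bᵢ (x)) bᵢ`; this converges with norm at most
`h x` because all its partial sums do. -/
theorem exists_isKernelVec {A : L2 d →L[ℂ] L2 d} {h : Space d → ℝ} (h0 : ∀ x, 0 ≤ h x)
    (hA : ∀ f : L2 d, ∀ᵐ x, ‖A f x‖ ≤ h x * ‖f‖) :
    ∃ κ : Space d → L2 d, IsKernelVec A κ ∧ ∀ᵐ x, ‖κ x‖ ≤ h x := by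
  obtain ⟨w, b, -⟩ := exists_hilbertBasis ℂ (L2 d)
  have : Countable w := countable_of_hilbertBasis b
  have hgood : ∀ᵐ x, ∀ s : Finset w, ∑ i ∈ s, ‖A (b i) x‖ ^ 2 ≤ h x ^ 2 :=
    ae_all_iff.2 fun s => ae_sum_sq_le_of_forall_ae_norm_le b hA s
  set κ : Space d → L2 d := fun x => ∑' i, starRingEnd ℂ (A (b i) x) • b i with hκ
  have hsum : ∀ᵐ x, HasSum (fun i => starRingEnd ℂ (A (b i) x) • b i) (κ x) ∧ ‖κ x‖ ≤ h x := by
    filter_upwards [hgood] with x hx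
    have hs : Summable fun i => ‖A (b i) x‖ ^ 2 :=
      summable_of_sum_le (fun i => sq_nonneg _) hx
    have hm : Memℓp (fun i => starRingEnd ℂ (A (b i) x)) 2 := by
      refine memℓp_gen ?_
      simpa using hs
    have h1 := b.hasSum_repr_symm ⟨_, hm⟩
    have h2 : κ x = b.repr.symm ⟨_, hm⟩ := h1.tsum_eq
    refine ⟨by rw [h2]; exact h1, ?_⟩
    rw [h2, LinearIsometryEquiv.norm_map]
    have h3 := lp.norm_rpow_eq_tsum (p := 2) (by norm_num)
      (⟨fun i => starRingEnd ℂ (A (b i) x), hm⟩ : lp (fun _ : w => ℂ) 2)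
    simp only [ENNReal.toReal_ofNat, Real.rpow_ofNat, RCLike.norm_conj] at h3
    refine (sq_le_sq₀ (norm_nonneg _) (h0 x)).1 ?_
    rw [h3]
    exact hs.tsum_le_of_sum_le hx
  refine ⟨κ, ⟨?_, ?_⟩, hsum.mono fun x hx => hx.2⟩
  · refine aestronglyMeasurable_of_tendsto_ae (atTop : Filter (Finset w))
      (f := fun s x => ∑ i ∈ s, starRingEnd ℂ (A (b i) x) • b i) (fun s => ?_)
      (hsum.mono fun x hx => hx.1)
    refine Finset.aestronglyMeasurable_fun_sum _ fun i _ => ?_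
    exact (Complex.continuous_conj.comp_aestronglyMeasurable
      (Lp.aestronglyMeasurable (A (b i)))).smul aestronglyMeasurable_const
  · intro f
    have hf := b.hasSum_repr f
    have h1 : ∀ᵐ x, ∀ s : Finset w, A (∑ i ∈ s, b.repr f i • b i) x
        = ∑ i ∈ s, b.repr f i * A (b i) x := by
      rw [ae_all_iff]
      intro s
      rw [map_sum]
      have h2 : ∀ᵐ x, ∀ i : w, A (b.repr f i • b i) x = b.repr f i * A (b i) x := by
        rw [ae_all_iff]
        intro i
        rw [map_smul]
        filter_upwards [Lp.coeFn_smul (b.repr f i) (A (b i))] with x hx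
        simpa using hx
      filter_upwards [Lp.coeFn_finsetSum s fun i => A (b.repr f i • b i), h2] with x h3 h4
      rw [h3, Finset.sum_apply]
      exact Finset.sum_congr rfl fun i _ => h4 i
    have h2 : ∀ᵐ x, ∀ s : Finset w, ‖A f x - A (∑ i ∈ s, b.repr f i • b i) x‖
        ≤ h x * ‖f - ∑ i ∈ s, b.repr f i • b i‖ := by
      rw [ae_all_iff]
      intro s
      filter_upwards [hA (f - ∑ i ∈ s, b.repr f i • b i),
        Lp.coeFn_sub (A f) (A (∑ i ∈ s, b.repr f i • b i))] with x hx hx'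
      rw [map_sub, hx'] at hx
      exact hx
    filter_upwards [h1, h2, hsum] with x hx1 hx2 hx3
    have lim1 : Tendsto (fun s : Finset w => A (∑ i ∈ s, b.repr f i • b i) x) atTop
        (𝓝 (A f x)) := by
      rw [tendsto_iff_norm_sub_tendsto_zero]
      have lim0 : Tendsto (fun s : Finset w => h x * ‖f - ∑ i ∈ s, b.repr f i • b i‖) atTop
          (𝓝 0) := by
        have h5 : Tendsto (fun s : Finset w => ∑ i ∈ s, b.repr f i • b i) atTop (𝓝 f) := hf
        have := ((tendsto_const_nhds (x := f)).sub h5).norm.const_mul (h x)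
        simpa using this
      refine squeeze_zero (fun _ => norm_nonneg _) (fun s => ?_) lim0
      rw [norm_sub_rev]
      exact hx2 s
    have lim2 : HasSum (fun i => b.repr f i * A (b i) x) ⟪κ x, f⟫_ℂ := by
      have h5 := (hx3.1.mapL (innerSL ℂ f))
      have h6 := h5.map (starRingEnd ℂ) Complex.continuous_conj
      simp only [innerSL_apply_apply, inner_conj_symm] at h6
      refine h6.congr_fun fun i => ?_
      simp only [Function.comp_apply, inner_conj_symm, inner_smul_left,
        HilbertBasis.repr_apply_apply, RCLike.conj_conj]
      ring
    have lim3 : Tendsto (fun s : Finset w => ∑ i ∈ s, b.repr f i * A (b i) x) atTop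
        (𝓝 ⟪κ x, f⟫_ℂ) := lim2
    exact tendsto_nhds_unique (lim1.congr hx1) lim3

/-- Parseval applied to `κ x` under the integral: the Hilbert-Schmidt norm of `A` is the `L₂` norm
of `κ`. -/
theorem IsKernelVec.tsum_enorm_sq {A : L2 d →L[ℂ] L2 d} {κ : Space d → L2 d}
    (hκ : IsKernelVec A κ) {ι : Type*} (b : HilbertBasis ι ℂ (L2 d)) :
    ∑' i, ‖A (b i)‖ₑ ^ 2 = ∫⁻ x, ‖κ x‖ₑ ^ 2 := by
  have : Countable ι := countable_of_hilbertBasis b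
  have h1 : ∀ i, ‖A (b i)‖ₑ ^ 2 = ∫⁻ x, ‖⟪b i, κ x⟫_ℂ‖ₑ ^ 2 := by
    intro i
    rw [Lp.enorm_def, eLpNorm_eq_lintegral_rpow_enorm_toReal (by norm_num) (by norm_num)]
    simp only [ENNReal.toReal_ofNat, ENNReal.rpow_ofNat]
    rw [← ENNReal.rpow_natCast, ← ENNReal.rpow_mul]
    norm_num
    refine lintegral_congr_ae ?_
    filter_upwards [hκ.apply_eq (b i)] with x hx
    rw [hx, ← inner_conj_symm, ← ofReal_norm, RCLike.norm_conj, ofReal_norm]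
  simp_rw [h1]
  rw [← lintegral_tsum]
  · simp_rw [HilbertBasis.tsum_enorm_inner_sq]
  · intro i
    exact ((aestronglyMeasurable_const.inner hκ.meas).enorm).pow_const 2

theorem IsKernelVec.mulOp_comp {A : L2 d →L[ℂ] L2 d} {κ : Space d → L2 d}
    (hκ : IsKernelVec A κ) {f : Space d → ℂ} (hf : MemLp f ∞ volume) :
    IsKernelVec (mulOp f ∘L A) fun x => starRingEnd ℂ (f x) • κ x := by
  refine ⟨(Complex.continuous_conj.comp_aestronglyMeasurable hf.1).smul hκ.meas, fun u => ?_⟩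
  filter_upwards [coeFn_mulOp hf (A u), hκ.apply_eq u] with x h1 h2
  rw [ContinuousLinearMap.comp_apply, h1, h2, inner_smul_left]
  simp

theorem IsKernelVec.comp_mulOp {A : L2 d →L[ℂ] L2 d} {κ : Space d → L2 d}
    (hκ : IsKernelVec A κ) {f : Space d → ℂ} (hf : MemLp f ∞ volume) :
    IsKernelVec (A ∘L mulOp f) fun x => mulOp (fun y => starRingEnd ℂ (f y)) (κ x) := by
  refine ⟨(ContinuousLinearMap.continuous _).comp_aestronglyMeasurable hκ.meas, fun u => ?_⟩
  filter_upwards [hκ.apply_eq (mulOp f u)] with x h2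
  rw [ContinuousLinearMap.comp_apply, h2,
    inner_mulOp_left (f := fun y => starRingEnd ℂ (f y)) hf.star]
  simp

/-- Testing on a countable dense sequence gives one null set. Density then allows the `x`-dependent
test vector `f = κ x`. -/
theorem IsKernelVec.ae_norm_le {A : L2 d →L[ℂ] L2 d} {κ : Space d → L2 d}
    (hκ : IsKernelVec A κ) {h : Space d → ℝ} (h0 : ∀ x, 0 ≤ h x)
    (hA : ∀ f : L2 d, ∀ᵐ x, ‖A f x‖ ≤ h x * ‖f‖) : ∀ᵐ x, ‖κ x‖ ≤ h x := by
  have h1 : ∀ᵐ x, ∀ n : ℕ, ‖⟪κ x, TopologicalSpace.denseSeq (L2 d) n⟫_ℂ‖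
      ≤ h x * ‖TopologicalSpace.denseSeq (L2 d) n‖ := by
    rw [ae_all_iff]
    intro n
    filter_upwards [hκ.apply_eq (TopologicalSpace.denseSeq (L2 d) n),
      hA (TopologicalSpace.denseSeq (L2 d) n)] with x hx1 hx2
    rwa [hx1] at hx2
  filter_upwards [h1] with x hx
  have hx' : ‖⟪κ x, κ x⟫_ℂ‖ ≤ h x * ‖κ x‖ := by
    refine (TopologicalSpace.denseRange_denseSeq (L2 d)).induction_on
      (p := fun c : L2 d => ‖⟪κ x, c⟫_ℂ‖ ≤ h x * ‖c‖) (κ x) ?_ hx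
    exact isClosed_le (by fun_prop) (by fun_prop)
  rw [inner_self_eq_norm_sq_to_K, norm_pow, RCLike.norm_ofReal, abs_norm, sq] at hx'
  rcases eq_or_lt_of_le (norm_nonneg (κ x)) with h2 | h2
  · rw [← h2]
    exact h0 x
  · exact le_of_mul_le_mul_right hx' h2

end KernelVector

section IntegralKernel

variable {d : ℕ}

/-! ### Integral kernels and their averaged diagonals -/

/-- Self-adjointness gives `S (S f) (x) = ⟪κ x, S f⟫ = ⟪S (κ x), f⟫`, and `S (κ x)` is the function
`z ↦ ⟪κ z, κ x⟫`. -/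
theorem IsKernelVec.isIntegralKernel_sq {S : L2 d →L[ℂ] L2 d} {κ : Space d → L2 d}
    (hS : IsSelfAdjoint S) (hκ : IsKernelVec S κ) :
    IsIntegralKernel (S ∘L S) fun x z => ⟪κ x, κ z⟫_ℂ := by
  refine ⟨hκ.meas.comp_fst.inner hκ.meas.comp_snd, fun f => ?_⟩
  have key : ∀ g : L2 d, Integrable (fun z => ⟪g, κ z⟫_ℂ * f z) ∧
      ⟪g, S f⟫_ℂ = ∫ z, ⟪g, κ z⟫_ℂ * f z := by
    intro g
    have hae : (fun z => ⟪S g z, f z⟫_ℂ) =ᵐ[volume] fun z => ⟪g, κ z⟫_ℂ * f z := by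
      filter_upwards [hκ.apply_eq g] with z hz
      rw [hz, RCLike.inner_apply, inner_conj_symm, mul_comm]
    constructor
    · exact (L2.integrable_inner (𝕜 := ℂ) (S g) f).congr hae
    · rw [← integral_congr_ae hae, ← L2.inner_def]
      exact ((ContinuousLinearMap.isSelfAdjoint_iff_isSymmetric.1 hS) g f).symm
  filter_upwards [hκ.apply_eq (S f)] with x hx
  exact ⟨(key (κ x)).1, by rw [ContinuousLinearMap.comp_apply, hx, (key (κ x)).2]⟩

theorem IsIntegralKernel.ae_integrableOn {T : L2 d →L[ℂ] L2 d} {K : Space d → Space d → ℂ}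
    (hK : IsIntegralKernel T K) {J : Set (Space d)} (hJ : MeasurableSet J)
    (hJ' : volume J ≠ ∞) :
    ∀ᵐ x, IntegrableOn (K x) J ∧
      T (indicatorConstLp 2 hJ hJ' 1) x = ∫ y in J, K x y := by
  filter_upwards [hK.2 (indicatorConstLp 2 hJ hJ' 1)] with x hx
  have hae : (fun y => K x y * (indicatorConstLp 2 hJ hJ' (1 : ℂ) : L2 d) y)
      =ᵐ[volume] J.indicator (K x) := by
    filter_upwards [indicatorConstLp_coeFn (p := 2) (hs := hJ) (hμs := hJ') (c := (1 : ℂ))]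
      with y hy
    rw [hy]
    by_cases h : y ∈ J <;> simp [h]
  refine ⟨(integrable_indicator_iff hJ).1 (hx.1.congr hae), ?_⟩
  rw [hx.2, integral_congr_ae hae, integral_indicator hJ]

/-- Within a fixed ball, the sets on which the integrals of `f` and `g` agree form a λ-system
containing the π-system `𝒜`. Only sets of `𝒜` need testing, and in the application these are
countably many. -/
theorem ae_eq_of_setIntegral_eq_of_countable_generating {f g : Space d → ℂ}
    {𝒜 : Set (Set (Space d))} (hgen : borel (Space d) = MeasurableSpace.generateFrom 𝒜)
    (hpi : IsPiSystem 𝒜)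
    (hf : ∀ n : ℕ, IntegrableOn f (Metric.ball 0 n))
    (hg : ∀ n : ℕ, IntegrableOn g (Metric.ball 0 n))
    (huniv : Set.univ ∈ 𝒜)
    (h : ∀ J ∈ 𝒜, ∀ n : ℕ, ∫ y in J ∩ Metric.ball 0 n, f y = ∫ y in J ∩ Metric.ball 0 n, g y) :
    f =ᵐ[volume] g := by
  have hm : (inferInstance : MeasurableSpace (Space d)) = MeasurableSpace.generateFrom 𝒜 :=
    (BorelSpace.measurable_eq).trans hgen
  have key : ∀ n : ℕ, ∀ᵐ y, y ∈ Metric.ball (0 : Space d) n → f y = g y := by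
    intro n
    rw [← ae_restrict_iff' measurableSet_ball]
    have hi : IntegrableOn (fun y => f y - g y) (Metric.ball 0 n) := (hf n).sub (hg n)
    have h0 : ∀ J : Set (Space d), MeasurableSet J →
        ∫ y in J, (f y - g y) ∂(volume.restrict (Metric.ball 0 n)) = 0 := by
      intro J hJ
      have htot : ∫ y, (f y - g y) ∂(volume.restrict (Metric.ball 0 n)) = 0 := by
        have := h _ huniv n
        rw [Set.univ_inter] at this
        rw [integral_sub (hf n) (hg n), this, sub_self]
      induction J, hJ using MeasurableSpace.induction_on_inter hm hpi with
      | empty => simp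
      | basic J hJ =>
        have hJm : MeasurableSet J := by
          rw [BorelSpace.measurable_eq (α := Space d), hgen]
          exact MeasurableSpace.measurableSet_generateFrom hJ
        rw [Measure.restrict_restrict hJm, integral_sub
          ((hf n).mono_set Set.inter_subset_right) ((hg n).mono_set Set.inter_subset_right),
          h J hJ n, sub_self]
      | compl J hJ ih =>
        have := integral_add_compl hJ hi
        rw [ih, htot, zero_add] at this
        exact this
      | iUnion J hd hJm ih =>
        rw [integral_iUnion hJm hd hi.integrableOn]
        simp [ih]
    have := Integrable.ae_eq_zero_of_forall_setIntegral_eq_zero hi fun J hJ _ => h0 J hJ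
    filter_upwards [this] with y hy
    exact sub_eq_zero.1 hy
  filter_upwards [ae_all_iff.2 key] with y hy
  obtain ⟨n, hn⟩ := exists_nat_gt (dist y 0)
  exact hy n hn

/-- Both kernels have the same integrals over `J ∩ B(0,n)` for almost every `x`. Letting `J` run
through a countable algebra that generates the Borel sets gives one null set of `x`, outside of
which the sections agree; Fubini then gives equality on the product. -/
theorem IsIntegralKernel.ae_eq {T : L2 d →L[ℂ] L2 d} {K K' : Space d → Space d → ℂ}
    (hK : IsIntegralKernel T K) (hK' : IsIntegralKernel T K') :
    Function.uncurry K =ᵐ[(volume : Measure (Space d)).prod (volume : Measure (Space d))]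
      Function.uncurry K' := by
  set 𝒜 := generateSetAlgebra (MeasurableSpace.countableGeneratingSet (Space d)) with h𝒜
  have halg : IsSetAlgebra 𝒜 := isSetAlgebra_generateSetAlgebra
  have hcount : 𝒜.Countable := countable_generateSetAlgebra
    (MeasurableSpace.countable_countableGeneratingSet)
  have hgen : borel (Space d) = MeasurableSpace.generateFrom 𝒜 := by
    rw [h𝒜, generateFrom_generateSetAlgebra_eq,
      MeasurableSpace.generateFrom_countableGeneratingSet, BorelSpace.measurable_eq (α := Space d)]
  have hpi : IsPiSystem 𝒜 := fun s hs t ht _ => halg.inter_mem hs ht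
  have hmeas : ∀ J ∈ 𝒜, MeasurableSet J := fun J hJ => by
    rw [BorelSpace.measurable_eq (α := Space d), hgen]
    exact MeasurableSpace.measurableSet_generateFrom hJ
  have hcount' : Countable 𝒜 := hcount
  have hfin : ∀ (J : 𝒜) (n : ℕ), volume ((J : Set (Space d)) ∩ Metric.ball 0 n) ≠ ∞ := fun J n =>
    ne_top_of_le_ne_top measure_ball_lt_top.ne (measure_mono Set.inter_subset_right)
  have hall : ∀ᵐ x, ∀ (J : 𝒜) (n : ℕ), (IntegrableOn (K x) (J ∩ Metric.ball 0 n) ∧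
      IntegrableOn (K' x) (J ∩ Metric.ball 0 n)) ∧
      ∫ y in (J : Set (Space d)) ∩ Metric.ball 0 n, K x y
        = ∫ y in (J : Set (Space d)) ∩ Metric.ball 0 n, K' x y := by
    rw [ae_all_iff]
    intro J
    rw [ae_all_iff]
    intro n
    have hJm := (hmeas J J.2).inter (measurableSet_ball (x := (0 : Space d)) (ε := n))
    filter_upwards [hK.ae_integrableOn hJm (hfin J n), hK'.ae_integrableOn hJm (hfin J n)]
      with x h1 h2
    exact ⟨⟨h1.1, h2.1⟩, h1.2.symm.trans h2.2⟩
  have hsec : ∀ᵐ x, K x =ᵐ[volume] K' x := by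
    filter_upwards [hall] with x hx
    have huniv : Set.univ ∈ 𝒜 := halg.univ_mem
    refine ae_eq_of_setIntegral_eq_of_countable_generating hgen hpi (fun n => ?_) (fun n => ?_)
      huniv fun J hJ n => (hx ⟨J, hJ⟩ n).2
    · simpa using (hx ⟨Set.univ, huniv⟩ n).1.1
    · simpa using (hx ⟨Set.univ, huniv⟩ n).1.2
  have hm1 := hK.1
  have hm2 := hK'.1
  have e1 := Measure.ae_ae_of_ae_prod hm1.ae_eq_mk
  have e2 := Measure.ae_ae_of_ae_prod hm2.ae_eq_mk
  -- Fubini for null sets needs a measurable exceptional set, hence the passage to measurable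
  -- versions of both kernels.
  have hset : MeasurableSet {p | ¬ hm1.mk _ p = hm2.mk _ p} :=
    (measurableSet_eq_fun hm1.stronglyMeasurable_mk.measurable
      hm2.stronglyMeasurable_mk.measurable).compl
  have hmk : hm1.mk _ =ᵐ[(volume : Measure (Space d)).prod (volume : Measure (Space d))]
      hm2.mk _ := by
    change _ = _
    refine (Measure.measure_prod_null hset).2 ?_
    filter_upwards [hsec, e1, e2] with x h1 h2 h3
    change volume {y | ¬ hm1.mk _ (x, y) = hm2.mk _ (x, y)} = 0
    rw [← ae_iff]
    filter_upwards [h1, h2, h3] with y h4 h5 h6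
    rw [← h5, ← h6]
    exact h4
  exact hm1.ae_eq_mk.trans (hmk.trans hm2.ae_eq_mk.symm)

theorem kernelAverage_congr {K K' : Space d → Space d → ℂ}
    (h : Function.uncurry K =ᵐ[(volume : Measure (Space d)).prod (volume : Measure (Space d))]
      Function.uncurry K') (x : Space d) (ε : ℝ) : kernelAverage K x ε = kernelAverage K' x ε := by
  unfold kernelAverage
  rw [setAverage_eq, setAverage_eq]
  congr 1
  exact integral_congr_ae (ae_restrict_of_ae h)

theorem integrableOn_of_ae_norm_le {κ : Space d → L2 d} (hm : AEStronglyMeasurable κ volume)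
    {C : ℝ} (hC : ∀ᵐ x, ‖κ x‖ ≤ C) {B : Set (Space d)} (hB : volume B ≠ ∞) :
    IntegrableOn κ B :=
  Measure.integrableOn_of_bounded hB hm (ae_restrict_of_ae hC)

/-- The kernel is a Gram kernel, so its double average factors as the inner product of the average
of `κ` with itself. -/
theorem kernelAverage_inner {κ : Space d → L2 d} (hm : AEStronglyMeasurable κ volume)
    {C : ℝ} (hC : ∀ᵐ x, ‖κ x‖ ≤ C) (x : Space d) (ε : ℝ) :
    kernelAverage (fun y z => ⟪κ y, κ z⟫_ℂ) x ε
      = ((‖⨍ y in Metric.closedBall x ε, κ y‖ ^ 2 : ℝ) : ℂ) := by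
  set B := Metric.closedBall x ε
  have hBfin : volume B ≠ ∞ := measure_closedBall_lt_top.ne
  have hi := integrableOn_of_ae_norm_le hm hC hBfin
  have hint : IntegrableOn (fun p : Space d × Space d => ⟪κ p.1, κ p.2⟫_ℂ) (B ×ˢ B)
      ((volume : Measure (Space d)).prod (volume : Measure (Space d))) := by
    have hfin : ((volume : Measure (Space d)).prod (volume : Measure (Space d))) (B ×ˢ B) ≠ ∞ := by
      rw [Measure.prod_prod]
      exact ENNReal.mul_ne_top hBfin hBfin
    refine Measure.integrableOn_of_bounded (M := C * C) hfin
      (hm.comp_fst.inner hm.comp_snd) (ae_restrict_of_ae ?_)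
    have h1 : ∀ᵐ p ∂((volume : Measure (Space d)).prod (volume : Measure (Space d))), ‖κ p.1‖ ≤ C :=
      Measure.quasiMeasurePreserving_fst.ae hC
    have h2 : ∀ᵐ p ∂((volume : Measure (Space d)).prod (volume : Measure (Space d))), ‖κ p.2‖ ≤ C :=
      Measure.quasiMeasurePreserving_snd.ae hC
    filter_upwards [h1, h2] with p hp1 hp2
    exact (norm_inner_le_norm _ _).trans
      (mul_le_mul hp1 hp2 (norm_nonneg _) ((norm_nonneg _).trans hp1))
  have e : ∫ p in B ×ˢ B, ⟪κ p.1, κ p.2⟫_ℂ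
      ∂((volume : Measure (Space d)).prod (volume : Measure (Space d)))
      = ⟪∫ y in B, κ y, ∫ y in B, κ y⟫_ℂ := by
    rw [setIntegral_prod _ hint]
    simp_rw [integral_inner hi]
    have h1 : ∀ y, ⟪κ y, ∫ y in B, κ y⟫_ℂ = starRingEnd ℂ ⟪∫ y in B, κ y, κ y⟫_ℂ := fun y =>
      (inner_conj_symm _ _).symm
    simp_rw [h1]
    rw [integral_conj, integral_inner hi, inner_conj_symm]
  unfold kernelAverage
  rw [setAverage_eq, e, setAverage_eq, measureReal_prod_prod, norm_smul, inner_self_eq_norm_sq_to_K]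
  rw [Complex.real_smul]
  push_cast
  rw [Real.norm_of_nonneg (inv_nonneg.2 measureReal_nonneg)]
  push_cast
  simp only [Complex.coe_algebraMap]
  ring

theorem ae_tendsto_kernelAverage_inner {κ : Space d → L2 d} (hm : AEStronglyMeasurable κ volume)
    {C : ℝ} (hC : ∀ᵐ x, ‖κ x‖ ≤ C) :
    ∀ᵐ x, Tendsto (kernelAverage (fun y z => ⟪κ y, κ z⟫_ℂ) x) (𝓝[>] (0 : ℝ))
      (𝓝 ((‖κ x‖ ^ 2 : ℝ) : ℂ)) := by
  have hloc : LocallyIntegrable κ volume := by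
    rw [locallyIntegrable_iff]
    intro k hk
    exact integrableOn_of_ae_norm_le hm hC hk.measure_lt_top.ne
  filter_upwards [IsUnifLocDoublingMeasure.ae_tendsto_average volume hloc 1] with x hx
  -- The differentiation theorem allows moving centres; here the balls are centred at `x` itself.
  have h1 := hx (fun _ : ℝ => x) (fun ε => ε) tendsto_id (by
    filter_upwards [self_mem_nhdsWithin] with ε hε
    exact Metric.mem_closedBall_self (by simpa using le_of_lt hε))
  have h2 := (Complex.continuous_ofReal.tendsto _).comp ((h1.norm).pow 2)
  refine h2.congr fun ε => ?_
  rw [kernelAverage_inner hm hC]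
  rfl

/-- All integral kernels of `S²` have averaged diagonal `‖κ x‖²`. -/
theorem IsKernelVec.ae_kernelDiag {S : L2 d →L[ℂ] L2 d} {κ : Space d → L2 d}
    (hS : IsSelfAdjoint S) (hκ : IsKernelVec S κ) {C : ℝ} (hC : ∀ᵐ x, ‖κ x‖ ≤ C)
    {K : Space d → Space d → ℂ} (hK : IsIntegralKernel (S ∘L S) K) :
    ∀ᵐ x, Tendsto (kernelAverage K x) (𝓝[>] (0 : ℝ)) (𝓝 (kernelDiag K x)) ∧
      kernelDiag K x = ((‖κ x‖ ^ 2 : ℝ) : ℂ) := by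
  have hae := hK.ae_eq (hκ.isIntegralKernel_sq hS)
  filter_upwards [ae_tendsto_kernelAverage_inner hκ.meas hC] with x hx
  have h1 : Tendsto (kernelAverage K x) (𝓝[>] (0 : ℝ)) (𝓝 ((‖κ x‖ ^ 2 : ℝ) : ℂ)) :=
    hx.congr fun ε => (kernelAverage_congr hae x ε).symm
  have h2 : kernelDiag K x = ((‖κ x‖ ^ 2 : ℝ) : ℂ) := h1.limUnder_eq
  exact ⟨h2 ▸ h1, h2⟩

end IntegralKernel

section Trace

variable {d : ℕ}

/-! ### Traces -/

theorem exists_trace_basis (E : Type*) [NormedAddCommGroup E] [InnerProductSpace ℂ E]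
    [CompleteSpace E] : ∃ b : HilbertBasis (exists_hilbertBasis ℂ E).choose ℂ E,
      ∀ T : E →L[ℂ] E, trace T = ∑' i, ⟪b i, T (b i)⟫_ℂ := by
  obtain ⟨b, hb⟩ := (exists_hilbertBasis ℂ E).choose_spec
  refine ⟨b, fun T => ?_⟩
  rw [trace]
  simp [hb]

theorem ENNReal.tsum_mul_le_sqrt_mul_sqrt {ι : Type*} (f g : ι → ℝ≥0∞) :
    ∑' i, f i * g i ≤ (∑' i, f i ^ 2) ^ (1 / 2 : ℝ) * (∑' i, g i ^ 2) ^ (1 / 2 : ℝ) := by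
  rw [ENNReal.tsum_eq_iSup_sum]
  refine iSup_le fun s => ?_
  have h := ENNReal.inner_le_Lp_mul_Lq s f g (p := 2) (q := 2)
    (by constructor <;> norm_num)
  simp only [ENNReal.rpow_ofNat] at h
  refine h.trans ?_
  gcongr <;> exact ENNReal.sum_le_tsum s

theorem HilbertBasis.tsum_enorm_inner_mul_le {E ι : Type*} [NormedAddCommGroup E]
    [InnerProductSpace ℂ E] [CompleteSpace E] (b : HilbertBasis ι ℂ E) (x y : E) :
    ∑' i, ‖⟪b i, x⟫_ℂ‖ₑ * ‖⟪b i, y⟫_ℂ‖ₑ ≤ ‖x‖ₑ * ‖y‖ₑ := by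
  refine (ENNReal.tsum_mul_le_sqrt_mul_sqrt _ _).trans ?_
  rw [HilbertBasis.tsum_enorm_inner_sq, HilbertBasis.tsum_enorm_inner_sq]
  simp_rw [← ENNReal.rpow_natCast, ← ENNReal.rpow_mul]
  norm_num

/-- The Hilbert-Schmidt norm of `S M_w` for self-adjoint `S`. -/
theorem IsKernelVec.tsum_enorm_sq_comp_mulOp {S : L2 d →L[ℂ] L2 d} {κ : Space d → L2 d}
    (hS : IsSelfAdjoint S) (hκ : IsKernelVec S κ) {w : Space d → ℝ}
    (hw : MemLp (fun x => (w x : ℂ)) ∞ volume) {ι : Type*} (b : HilbertBasis ι ℂ (L2 d)) :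
    ∑' i, ‖S (mulOp (fun x => (w x : ℂ)) (b i))‖ₑ ^ 2
      = ∫⁻ x, ENNReal.ofReal (w x ^ 2 * ‖κ x‖ ^ 2) := by
  have h1 : ContinuousLinearMap.adjoint (S ∘L mulOp fun x => (w x : ℂ))
      = (mulOp fun x => (w x : ℂ)) ∘L S := by
    rw [ContinuousLinearMap.adjoint_comp, adjoint_mulOp_ofReal hw, hS.adjoint_eq]
  have h2 := tsum_enorm_sq_adjoint b b (S ∘L mulOp fun x => (w x : ℂ))
  rw [h1, (hκ.mulOp_comp hw).tsum_enorm_sq b] at h2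
  refine h2.trans ?_
  refine lintegral_congr fun x => ?_
  rw [← ofReal_norm, ← ENNReal.ofReal_pow (norm_nonneg _), norm_smul, mul_pow]
  simp

theorem memLp_top_ofReal {g : Space d → ℝ} (hgm : AEStronglyMeasurable g volume)
    (hg0 : ∀ x, 0 ≤ g x) (hg1 : ∀ x, g x ≤ 1) : MemLp (fun x => (g x : ℂ)) ∞ volume :=
  memLp_top_of_continuous_bounded (Complex.continuous_ofReal.comp_aestronglyMeasurable hgm)
    (C := 1) fun x => by
      rw [Complex.norm_real, Real.norm_of_nonneg (hg0 x)]
      exact hg1 x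

theorem memLp_top_sqrt {g : Space d → ℝ} (hgm : AEStronglyMeasurable g volume)
    (hg1 : ∀ x, g x ≤ 1) : MemLp (fun x => (Real.sqrt (g x) : ℂ)) ∞ volume :=
  memLp_top_ofReal (Real.continuous_sqrt.comp_aestronglyMeasurable hgm)
    (fun _ => Real.sqrt_nonneg _) fun x => Real.sqrt_le_one.2 (hg1 x)

theorem mulOp_sqrt_comp_mulOp_sqrt {g : Space d → ℝ} (hgm : AEStronglyMeasurable g volume)
    (hg0 : ∀ x, 0 ≤ g x) (hg1 : ∀ x, g x ≤ 1) :
    (mulOp fun x => (g x : ℂ))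
      = (mulOp fun x => (Real.sqrt (g x) : ℂ)) ∘L mulOp fun x => (Real.sqrt (g x) : ℂ) := by
  have hwL := memLp_top_sqrt hgm hg1
  refine mulOp_ext (memLp_top_ofReal hgm hg0 hg1) fun u => ?_
  filter_upwards [coeFn_mulOp hwL (mulOp (fun x => (Real.sqrt (g x) : ℂ)) u),
    coeFn_mulOp hwL u] with x h1 h2
  rw [ContinuousLinearMap.comp_apply, h1, h2, ← mul_assoc, ← Complex.ofReal_mul,
    Real.mul_self_sqrt (hg0 x)]

/-- The diagonal entries are `⟪S bᵢ, S G bᵢ⟫ = ∫ ⟪bᵢ, κ x⟫ ⟪G (κ x), bᵢ⟫ dx`, so by Parseval the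
trace is `∫ ⟪G (κ x), κ x⟫ dx`. The weighted bound `hgκ` is what permits summing under the integral.
The integrand is not `g x * ‖κ x‖²` pointwise, since `G` acts on the inner variable of the kernel:
the two integrals are the Hilbert-Schmidt norms of `S W` and of its adjoint `W S`, with `W² = G`. -/
theorem trace_comp_mulOp {S : L2 d →L[ℂ] L2 d} {κ : Space d → L2 d}
    (hS : IsSelfAdjoint S) (hκ : IsKernelVec S κ) {C : ℝ} (hC : ∀ᵐ x, ‖κ x‖ ≤ C)
    {g : Space d → ℝ} (hg0 : ∀ x, 0 ≤ g x) (hg1 : ∀ x, g x ≤ 1)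
    (hgi : Integrable g) (hgκ : ∀ᵐ x, ‖mulOp (fun y => (g y : ℂ)) (κ x)‖ ≤ C * g x) :
    trace ((S ∘L S) ∘L mulOp fun x => (g x : ℂ)) = ((∫ x, g x * ‖κ x‖ ^ 2 : ℝ) : ℂ) := by
  obtain ⟨b, hb⟩ := exists_trace_basis (L2 d)
  have hcount := countable_of_hilbertBasis b
  have hg := memLp_top_ofReal hgi.1 hg0 hg1
  rw [hb]
  set G := mulOp fun x => (g x : ℂ) with hG
  have hSG := hκ.comp_mulOp hg
  simp only [Complex.conj_ofReal] at hSG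
  have hF : ∀ i, ⟪b i, ((S ∘L S) ∘L G) (b i)⟫_ℂ
      = ∫ x, ⟪b i, κ x⟫_ℂ * ⟪G (κ x), b i⟫_ℂ := by
    intro i
    have h1 : ⟪b i, ((S ∘L S) ∘L G) (b i)⟫_ℂ = ⟪S (b i), (S ∘L G) (b i)⟫_ℂ :=
      ((ContinuousLinearMap.isSelfAdjoint_iff_isSymmetric.1 hS) (b i) (S (G (b i)))).symm
    rw [h1, L2.inner_def]
    refine integral_congr_ae ?_
    filter_upwards [hκ.apply_eq (b i), hSG.apply_eq (b i)] with x hx1 hx2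
    rw [hx1, hx2, RCLike.inner_apply, inner_conj_symm, mul_comm]
  have hGm : AEStronglyMeasurable (fun x => G (κ x)) volume :=
    G.continuous.comp_aestronglyMeasurable hκ.meas
  have hmeas : ∀ i, AEStronglyMeasurable (fun x => ⟪b i, κ x⟫_ℂ * ⟪G (κ x), b i⟫_ℂ) volume :=
    fun i => (aestronglyMeasurable_const.inner hκ.meas).mul
      (hGm.inner aestronglyMeasurable_const)
  have hfin : ∑' i, ∫⁻ x, ‖⟪b i, κ x⟫_ℂ * ⟪G (κ x), b i⟫_ℂ‖ₑ ≠ ∞ := by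
    rw [← lintegral_tsum fun i => (hmeas i).enorm]
    have hint : ∫⁻ x, ENNReal.ofReal (C * (C * g x)) ≠ ∞ := by
      have := ((hgi.const_mul C).const_mul C).lintegral_lt_top
      exact this.ne
    refine ne_top_of_le_ne_top hint (lintegral_mono_ae ?_)
    filter_upwards [hC, hgκ] with x h1 h2
    have h3 := HilbertBasis.tsum_enorm_inner_mul_le b (κ x) (G (κ x))
    have h4 : ∀ i, ‖⟪b i, κ x⟫_ℂ * ⟪G (κ x), b i⟫_ℂ‖ₑ
        = ‖⟪b i, κ x⟫_ℂ‖ₑ * ‖⟪b i, G (κ x)⟫_ℂ‖ₑ := by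
      intro i
      rw [enorm_mul, ← inner_conj_symm (G (κ x)), ← ofReal_norm (starRingEnd ℂ _), RCLike.norm_conj,
        ofReal_norm]
    simp_rw [h4]
    refine h3.trans ?_
    rw [← ofReal_norm, ← ofReal_norm, ← ENNReal.ofReal_mul (norm_nonneg _)]
    exact ENNReal.ofReal_le_ofReal (mul_le_mul h1 h2 (norm_nonneg _)
      ((norm_nonneg _).trans h1))
  simp_rw [hF]
  rw [← integral_tsum hmeas hfin]
  have hpars : ∀ x, ∑' i, ⟪b i, κ x⟫_ℂ * ⟪G (κ x), b i⟫_ℂ = ⟪G (κ x), κ x⟫_ℂ := by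
    intro x
    rw [← b.tsum_inner_mul_inner (G (κ x)) (κ x)]
    exact tsum_congr fun i => mul_comm _ _
  simp_rw [hpars]
  set w : Space d → ℝ := fun x => Real.sqrt (g x) with hw
  have hwg : ∀ x, w x ^ 2 = g x := fun x => Real.sq_sqrt (hg0 x)
  have hwL : MemLp (fun x => (w x : ℂ)) ∞ volume := memLp_top_sqrt hgi.1 hg1
  set W := mulOp fun x => (w x : ℂ) with hW
  have hWW : G = W ∘L W := mulOp_sqrt_comp_mulOp_sqrt hgi.1 hg0 hg1
  have hWκ : ∀ x, ⟪G (κ x), κ x⟫_ℂ = ((‖W (κ x)‖ ^ 2 : ℝ) : ℂ) := by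
    intro x
    rw [hWW, ContinuousLinearMap.comp_apply, hW, inner_mulOp_left hwL]
    simp only [Complex.conj_ofReal]
    rw [inner_self_eq_norm_sq_to_K]
    push_cast
    rfl
  simp_rw [hWκ]
  rw [integral_complex_ofReal]
  congr 1
  have hSW := hκ.comp_mulOp hwL
  simp only [Complex.conj_ofReal] at hSW
  have e1 := hSW.tsum_enorm_sq b
  have e2 := hκ.tsum_enorm_sq_comp_mulOp hS hwL b
  rw [integral_eq_lintegral_of_nonneg_ae (Eventually.of_forall fun x => sq_nonneg _)
      ((W.continuous.comp_aestronglyMeasurable hκ.meas).norm.pow 2),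
    integral_eq_lintegral_of_nonneg_ae (Eventually.of_forall fun x =>
      mul_nonneg (hg0 x) (sq_nonneg _)) (hgi.1.mul (hκ.meas.norm.pow 2))]
  congr 1
  have e3 : ∫⁻ x, ENNReal.ofReal (‖W (κ x)‖ ^ 2) = ∫⁻ x, ‖W (κ x)‖ₑ ^ 2 := by
    refine lintegral_congr fun x => ?_
    rw [ENNReal.ofReal_pow (norm_nonneg _), ofReal_norm]
  rw [e3, ← e1]
  simp_rw [← hwg]
  exact e2

/-- With `w = √g`, write `S² M_g = (S M_w) Y` and `Y = M_w⁻¹ S M_g`. The operator `M_w⁻¹` is in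
general unbounded, but `hSg` gives `|Y f (x)| ≤ C w(x) ‖f‖`. Since `w` is square integrable, `Y` is
bounded and both factors are Hilbert-Schmidt. -/
theorem isTraceClass_comp_mulOp {S : L2 d →L[ℂ] L2 d} {κ : Space d → L2 d}
    (hS : IsSelfAdjoint S) (hκ : IsKernelVec S κ) {C : ℝ} (hC0 : 0 ≤ C) (hC : ∀ᵐ x, ‖κ x‖ ≤ C)
    {g : Space d → ℝ} (hg0 : ∀ x, 0 < g x) (hg1 : ∀ x, g x ≤ 1)
    (hgi : Integrable g)
    (hSg : ∀ f : L2 d, ∀ᵐ x, ‖S (mulOp (fun y => (g y : ℂ)) f) x‖ ≤ C * g x * ‖f‖) :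
    IsTraceClass ((S ∘L S) ∘L mulOp fun x => (g x : ℂ)) := by
  have hg0' : ∀ x, 0 ≤ g x := fun x => (hg0 x).le
  have hwL := memLp_top_sqrt hgi.1 hg1
  have hWW := mulOp_sqrt_comp_mulOp_sqrt hgi.1 hg0' hg1
  set G := mulOp fun x => (g x : ℂ) with hG
  set w : Space d → ℝ := fun x => Real.sqrt (g x) with hw
  have hw0 : ∀ x, 0 < w x := fun x => Real.sqrt_pos.2 (hg0 x)
  have hwg : ∀ x, w x * w x = g x := fun x => Real.mul_self_sqrt (hg0' x)
  set W := mulOp fun x => (w x : ℂ) with hW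
  have hwm : AEStronglyMeasurable w volume := Real.continuous_sqrt.comp_aestronglyMeasurable hgi.1
  have hw2 : MemLp w 2 volume := by
    rw [memLp_two_iff_integrable_sq hwm]
    refine hgi.congr (Eventually.of_forall fun x => ?_)
    simp only [sq, hwg]
  have hbound : ∀ f : L2 d, ∀ᵐ x, ‖((w x)⁻¹ : ℂ) * S (G f) x‖ ≤ C * w x * ‖f‖ := by
    intro f
    filter_upwards [hSg f] with x hx
    rw [norm_mul, norm_inv, Complex.norm_real, Real.norm_of_nonneg (hw0 x).le,
      inv_mul_le_iff₀ (hw0 x)]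
    refine hx.trans (le_of_eq ?_)
    rw [← hwg]
    ring
  have hYm : ∀ f : L2 d, MemLp (fun x => ((w x)⁻¹ : ℂ) * S (G f) x) 2 volume := by
    intro f
    refine MemLp.of_le (hw2.const_mul (C * ‖f‖)) ?_ ?_
    · refine AEStronglyMeasurable.mul ?_ (Lp.aestronglyMeasurable _)
      have : AEMeasurable (fun x => ((w x)⁻¹ : ℂ)) volume :=
        (Complex.measurable_ofReal.comp_aemeasurable hwm.aemeasurable).inv
      exact this.aestronglyMeasurable
    · filter_upwards [hbound f] with x hx
      rw [Real.norm_of_nonneg (by have := (hw0 x).le; positivity)]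
      refine hx.trans (le_of_eq (by ring))
  let Y₀ : L2 d →ₗ[ℂ] L2 d :=
    { toFun := fun f => (hYm f).toLp _
      map_add' := fun f f' => by
        refine Lp.ext ?_
        filter_upwards [(hYm (f + f')).coeFn_toLp, (hYm f).coeFn_toLp, (hYm f').coeFn_toLp,
          Lp.coeFn_add ((hYm f).toLp _) ((hYm f').toLp _),
          Lp.coeFn_add (S (G f)) (S (G f'))] with x h1 h2 h3 h4 h5
        rw [h1, h4, Pi.add_apply, h2, h3, map_add, map_add, h5, Pi.add_apply]
        ring
      map_smul' := fun c f => by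
        refine Lp.ext ?_
        filter_upwards [(hYm (c • f)).coeFn_toLp, (hYm f).coeFn_toLp,
          Lp.coeFn_smul c ((hYm f).toLp _), Lp.coeFn_smul c (S (G f))] with x h1 h2 h4 h5
        rw [h1, RingHom.id_apply, h4, Pi.smul_apply, h2, map_smul, map_smul, h5, Pi.smul_apply]
        simp only [smul_eq_mul]
        ring }
  have hY₀ : ∀ f, ‖Y₀ f‖ ≤ C * ‖hw2.toLp w‖ * ‖f‖ := by
    intro f
    have h1 : ‖Y₀ f‖ ≤ (C * ‖f‖) * ‖hw2.toLp w‖ := by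
      refine Lp.norm_le_mul_norm_of_ae_le_mul ?_
      filter_upwards [hbound f, (hYm f).coeFn_toLp, hw2.coeFn_toLp] with x h1 h2 h3
      have h4 : Y₀ f x = ((w x)⁻¹ : ℂ) * S (G f) x := h2
      rw [h4, h3, Real.norm_of_nonneg (hw0 x).le]
      refine h1.trans (le_of_eq (by ring))
    refine h1.trans (le_of_eq (by ring))
  let Y : L2 d →L[ℂ] L2 d := Y₀.mkContinuous _ hY₀
  have hYae : ∀ f : L2 d, Y f =ᵐ[volume] fun x => ((w x)⁻¹ : ℂ) * S (G f) x :=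
    fun f => (hYm f).coeFn_toLp
  have hfactor : (S ∘L S) ∘L G = (S ∘L W) ∘L Y := by
    ext1 f
    simp only [ContinuousLinearMap.comp_apply]
    congr 1
    refine Lp.ext ?_
    filter_upwards [coeFn_mulOp hwL (Y f), hYae f] with x h1 h2
    rw [h1, h2, ← mul_assoc, mul_inv_cancel₀ (by exact_mod_cast (hw0 x).ne'), one_mul]
  have hint : ∫⁻ x, ENNReal.ofReal (C ^ 2 * g x) ≠ ∞ := (hgi.const_mul (C ^ 2)).lintegral_lt_top.ne
  obtain ⟨b, -⟩ := exists_trace_basis (L2 d)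
  rw [hfactor]
  refine isTraceClass_comp b b ?_ ?_
  · have h1 := hκ.tsum_enorm_sq_comp_mulOp hS hwL b
    refine ne_top_of_le_ne_top hint (h1.le.trans (lintegral_mono_ae ?_))
    filter_upwards [hC] with x hx
    refine ENNReal.ofReal_le_ofReal ?_
    rw [sq (w x), hwg, mul_comm]
    exact mul_le_mul_of_nonneg_right (pow_le_pow_left₀ (norm_nonneg _) hx 2) (hg0' x)
  · obtain ⟨η, hη, hη'⟩ := exists_isKernelVec (A := Y) (h := fun x => C * w x)
      (fun x => mul_nonneg hC0 (hw0 x).le) (fun f => by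
        filter_upwards [hYae f, hbound f] with x h1 h2
        rw [h1]
        exact h2)
    refine ne_top_of_le_ne_top hint ((hη.tsum_enorm_sq b).le.trans (lintegral_mono_ae ?_))
    filter_upwards [hη'] with x hx
    rw [← ofReal_norm, ← ENNReal.ofReal_pow (norm_nonneg _)]
    refine ENNReal.ofReal_le_ofReal ?_
    refine (pow_le_pow_left₀ (norm_nonneg _) hx 2).trans (le_of_eq ?_)
    rw [mul_pow, sq (w x), hwg]

end Trace

section Fourier

open FourierTransform

variable {d : ℕ}

/-! ### Fourier multipliers on `L₂(ℝ^d)` -/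

/-- The Fourier multiplier `𝓕⁻¹ M_m 𝓕`. -/
def fourierMul (m : Space d → ℂ) : L2 d →L[ℂ] L2 d :=
  ((Lp.fourierTransformₗᵢ (Space d) ℂ).symm.toContinuousLinearEquiv : L2 d →L[ℂ] L2 d) ∘L
    mulOp m ∘L ((Lp.fourierTransformₗᵢ (Space d) ℂ).toContinuousLinearEquiv : L2 d →L[ℂ] L2 d)

theorem fourierMul_apply (m : Space d → ℂ) (u : L2 d) :
    fourierMul m u = 𝓕⁻ (mulOp m (𝓕 u) : L2 d) := rfl

theorem fourier_fourierMul (m : Space d → ℂ) (u : L2 d) :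
    (𝓕 (fourierMul m u) : L2 d) = mulOp m (𝓕 u) := by
  rw [fourierMul_apply, fourier_fourierInv_eq]

theorem fourierMul_comp {f g : Space d → ℂ} (hf : MemLp f ∞ volume) (hg : MemLp g ∞ volume)
    (hfg : MemLp (fun x => f x * g x) ∞ volume) :
    fourierMul f ∘L fourierMul g = fourierMul fun x => f x * g x := by
  ext1 u
  rw [ContinuousLinearMap.comp_apply, fourierMul_apply, fourier_fourierMul, fourierMul_apply,
    ← mulOp_comp hf hg hfg]
  rfl

theorem isSelfAdjoint_fourierMul {f : Space d → ℝ} (hf : MemLp (fun x => (f x : ℂ)) ∞ volume) :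
    IsSelfAdjoint (fourierMul fun x => (f x : ℂ)) := by
  rw [ContinuousLinearMap.isSelfAdjoint_iff']
  symm
  rw [ContinuousLinearMap.eq_adjoint_iff]
  intro u v
  rw [← Lp.inner_fourier_eq, fourier_fourierMul, inner_mulOp_left hf,
    ← Lp.inner_fourier_eq u, fourier_fourierMul]
  simp

theorem fourierMul_ext {f : Space d → ℂ} {T : L2 d →L[ℂ] L2 d} (hf : MemLp f ∞ volume)
    (hT : ∀ u, (𝓕 (T u) : L2 d) =ᵐ[volume] fun x => f x * (𝓕 u : L2 d) x) : T = fourierMul f := by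
  ext1 u
  apply (Lp.fourierTransformₗᵢ (Space d) ℂ).injective
  change (𝓕 (T u) : L2 d) = 𝓕 (fourierMul f u)
  rw [fourier_fourierMul]
  exact Lp.ext ((hT u).trans (coeFn_mulOp hf _).symm)

theorem fourier_fourierMul_ae {f : Space d → ℂ} (hf : MemLp f ∞ volume) (u : L2 d) :
    (𝓕 (fourierMul f u) : L2 d) =ᵐ[volume] fun x => f x * (𝓕 u : L2 d) x := by
  rw [fourier_fourierMul]
  exact coeFn_mulOp hf _

theorem fourierMul_one : fourierMul (fun _ : Space d => (1 : ℂ)) = 1 := by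
  symm
  refine fourierMul_ext (memLp_top_const 1) ?_
  intro u
  simp

theorem fourierMul_smul (c : ℂ) {f : Space d → ℂ} (hf : MemLp f ∞ volume) :
    fourierMul (fun x => c * f x) = c • fourierMul f := by
  symm
  refine fourierMul_ext (hf.const_mul c) fun u => ?_
  rw [smul_apply, FourierTransform.fourier_smul]
  filter_upwards [Lp.coeFn_smul c (𝓕 (fourierMul f u) : L2 d), fourier_fourierMul_ae hf u]
    with x h1 h2
  rw [h1, Pi.smul_apply, h2, smul_eq_mul, mul_assoc]

theorem fourierMul_add {f g : Space d → ℂ} (hf : MemLp f ∞ volume) (hg : MemLp g ∞ volume) :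
    fourierMul (fun x => f x + g x) = fourierMul f + fourierMul g := by
  symm
  refine fourierMul_ext (hf.add hg) fun u => ?_
  rw [add_apply, FourierTransform.fourier_add]
  filter_upwards [Lp.coeFn_add (𝓕 (fourierMul f u) : L2 d) (𝓕 (fourierMul g u)),
    fourier_fourierMul_ae hf u, fourier_fourierMul_ae hg u] with x h1 h2 h3
  rw [h1, Pi.add_apply, h2, h3, add_mul]

theorem fourierMul_sub {f g : Space d → ℂ} (hf : MemLp f ∞ volume) (hg : MemLp g ∞ volume) :
    fourierMul (fun x => f x - g x) = fourierMul f - fourierMul g := by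
  have h := fourierMul_add hf (hg.const_mul (-1))
  rw [fourierMul_smul _ hg] at h
  simpa [sub_eq_add_neg] using h

theorem norm_fourierMul_le {f : Space d → ℂ} (hf : MemLp f ∞ volume) {C : ℝ} (hC0 : 0 ≤ C)
    (hC : ∀ᵐ x, ‖f x‖ ≤ C) : ‖fourierMul f‖ ≤ C := by
  refine ContinuousLinearMap.opNorm_le_bound _ hC0 fun u => ?_
  rw [← Lp.norm_fourier_eq, fourier_fourierMul, ← Lp.norm_fourier_eq u]
  exact norm_mulOp_apply_le hf hC _

theorem fourierMul_pow {f : Space d → ℂ} (hf : Continuous f) {C : ℝ} (hC : ∀ x, ‖f x‖ ≤ C)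
    (n : ℕ) : fourierMul f ^ n = fourierMul fun x => f x ^ n := by
  have hm : ∀ n : ℕ, MemLp (fun x => f x ^ n) ∞ (volume : Measure (Space d)) := fun n =>
    memLp_top_of_continuous_bounded (by fun_prop) (C := C ^ n) fun x => by
      rw [norm_pow]; exact pow_le_pow_left₀ (norm_nonneg _) (hC x) n
  induction n with
  | zero => simp only [pow_zero]; exact fourierMul_one.symm
  | succ n ih =>
    have h1 := fourierMul_comp (hm n) (by simpa using hm 1)
      (by simpa only [← pow_succ] using hm (n + 1))
    simp only [pow_succ, ih]
    exact h1

/-! ### The Laplacian as a Fourier multiplier -/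

/-- The symbol `(2π|ξ|)²` of `-Δ`. -/
def symbol (ξ : Space d) : ℝ := (2 * Real.pi) ^ 2 * ‖ξ‖ ^ 2

theorem symbol_nonneg (ξ : Space d) : 0 ≤ symbol ξ := by unfold symbol; positivity

theorem continuous_symbol : Continuous (symbol : Space d → ℝ) := by unfold symbol; fun_prop

/-- Fourier transform of the distributional equation. From left to right one tests only with smooth
functions of compact support, as the product of the symbol with `𝓕 u` is a priori merely locally
integrable. -/
theorem mem_negLaplacianGraph_iff (u v : L2 d) :
    (u, v) ∈ negLaplacianGraph d ↔
      (𝓕 v : L2 d) =ᵐ[volume] fun ξ => (symbol ξ : ℂ) * (𝓕 u : L2 d) ξ := by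
  have hT : Function.HasTemperateGrowth (fun x : Space d => Complex.ofReal (‖x‖ ^ 2)) := by
    fun_prop
  have key : ∀ φ : 𝓢(Space d, ℂ),
      (𝓕 (-Δ (Lp.toTemperedDistribution u : 𝓢'(Space d, ℂ)))) φ
        = ∫ ξ, φ ξ • ((symbol ξ : ℂ) * (𝓕 u : L2 d) ξ) := by
    intro φ
    have h1 : (𝓕 (-Δ (Lp.toTemperedDistribution u : 𝓢'(Space d, ℂ)))) φ
        = ((2 * Real.pi) ^ 2 : ℝ) • (𝓕 (TemperedDistribution.fourierMultiplierCLM ℂ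
          (fun x : Space d => Complex.ofReal (‖x‖ ^ 2))
          (Lp.toTemperedDistribution u : 𝓢'(Space d, ℂ)))) φ := by
      rw [TemperedDistribution.laplacian_eq_fourierMultiplierCLM, ← neg_smul, neg_neg]
      rfl
    rw [h1, TemperedDistribution.fourierMultiplierCLM_apply, fourier_fourierInv_eq,
      Lp.fourier_toTemperedDistribution_eq]
    rw [TemperedDistribution.smulLeftCLM_apply_apply, Lp.toTemperedDistribution_apply,
      ← integral_smul]
    refine integral_congr_ae (ae_of_all _ fun ξ => ?_)
    simp only [SchwartzMap.smulLeftCLM_apply_apply hT, symbol, smul_eq_mul, Complex.real_smul]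
    push_cast
    ring
  have hmem : (u, v) ∈ negLaplacianGraph d ↔
      -Δ (Lp.toTemperedDistribution u : 𝓢'(Space d, ℂ)) = Lp.toTemperedDistribution v := Iff.rfl
  rw [hmem]
  constructor
  · intro h
    have hl : LocallyIntegrable (fun ξ => (symbol ξ : ℂ) * (𝓕 u : L2 d) ξ) volume := by
      have := ((Lp.memLp (𝓕 u : L2 d)).locallyIntegrable (by norm_num))
      exact LocallyIntegrable.continuous_mul (g := fun ξ => (symbol ξ : ℂ))
        (Complex.continuous_ofReal.comp continuous_symbol) this
    refine ae_eq_of_integral_contDiff_smul_eq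
      ((Lp.memLp (𝓕 v : L2 d)).locallyIntegrable (by norm_num)) hl ?_
    intro g hg hgc
    have hg₁ : HasCompactSupport (Complex.ofRealCLM ∘ g) := hgc.comp_left rfl
    have hg₂ : ContDiff ℝ ((⊤ : ℕ∞) : WithTop ℕ∞) (Complex.ofRealCLM ∘ g) :=
      Complex.ofRealCLM.contDiff.comp hg
    have h2 := key (hg₁.toSchwartzMap hg₂)
    rw [h, Lp.fourier_toTemperedDistribution_eq, Lp.toTemperedDistribution_apply] at h2
    simpa using h2
  · intro h
    have h3 : 𝓕 (-Δ (Lp.toTemperedDistribution u : 𝓢'(Space d, ℂ)))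
        = 𝓕 (Lp.toTemperedDistribution v : 𝓢'(Space d, ℂ)) := by
      ext φ
      rw [key, Lp.fourier_toTemperedDistribution_eq, Lp.toTemperedDistribution_apply]
      refine integral_congr_ae ?_
      filter_upwards [h] with ξ hξ
      rw [hξ]
    have h4 := congrArg (fun T : 𝓢'(Space d, ℂ) => 𝓕⁻ T) h3
    simpa only [fourierInv_fourier_eq] using h4

/-- A submodule defines a partial linear map with that graph only if it is single valued, and this
is checked on the Fourier side. -/
theorem negLaplacian_graph : (negLaplacian d).graph = negLaplacianGraph d := by
  refine Submodule.toLinearPMap_graph_eq _ fun x hx hx0 => ?_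
  obtain ⟨u, v⟩ := x
  obtain rfl : u = 0 := hx0
  rw [mem_negLaplacianGraph_iff] at hx
  have h0 : (𝓕 v : L2 d) = 0 := by
    refine Lp.ext ?_
    have hz : (𝓕 (0 : L2 d) : L2 d) = 0 := (Lp.fourierTransformₗᵢ (Space d) ℂ).map_zero
    rw [hz] at hx
    filter_upwards [hx, Lp.coeFn_zero ℂ 2 (volume : Measure (Space d))] with ξ h1 h2
    rw [h1, h2]
    simp
  rw [← norm_eq_zero, ← Lp.norm_fourier_eq, h0, norm_zero]

theorem IsResolventAt.of_graph {E : Type*} [NormedAddCommGroup E] [InnerProductSpace ℂ E]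
    [CompleteSpace E] {A : E →ₗ.[ℂ] E} {z : ℂ} {R : E →L[ℂ] E}
    (h1 : ∀ x, (R x, x + z • R x) ∈ A.graph)
    (h2 : ∀ u v, (u, v) ∈ A.graph → R (v - z • u) = u) : IsResolventAt A z R := by
  refine ⟨fun x => ?_, fun u => h2 _ _ (A.mem_graph u)⟩
  obtain ⟨y, hy1, hy2⟩ := (LinearPMap.mem_graph_iff A).1 (h1 x)
  obtain ⟨y, hy⟩ := y
  simp only at hy1 hy2
  subst hy1
  exact ⟨hy, by rw [hy2, add_sub_cancel_right]⟩

/-- The symbol of the free resolvent `(-Δ + μ)⁻¹`. -/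
def freeSymbol (μ : ℝ) (ξ : Space d) : ℝ := (symbol ξ + μ)⁻¹

theorem symbol_add_pos {μ : ℝ} (hμ : 0 < μ) (ξ : Space d) : 0 < symbol ξ + μ := by
  have := symbol_nonneg ξ
  linarith

theorem freeSymbol_pos {μ : ℝ} (hμ : 0 < μ) (ξ : Space d) : 0 < freeSymbol μ ξ :=
  inv_pos.2 (symbol_add_pos hμ ξ)

theorem freeSymbol_le {μ : ℝ} (hμ : 0 < μ) (ξ : Space d) : freeSymbol μ ξ ≤ μ⁻¹ :=
  inv_anti₀ hμ (by linarith [symbol_nonneg ξ])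

theorem continuous_freeSymbol {μ : ℝ} (hμ : 0 < μ) :
    Continuous (freeSymbol μ : Space d → ℝ) :=
  (continuous_symbol.add continuous_const).inv₀ fun ξ => (symbol_add_pos hμ ξ).ne'

theorem memLp_freeSymbol {μ : ℝ} (hμ : 0 < μ) :
    MemLp (fun ξ => (freeSymbol μ ξ : ℂ)) ∞ (volume : Measure (Space d)) := by
  refine memLp_top_of_continuous_bounded
    (Complex.continuous_ofReal.comp (continuous_freeSymbol hμ)).aestronglyMeasurable
    (C := μ⁻¹) fun ξ => ?_
  rw [Complex.norm_real, Real.norm_eq_abs, abs_of_pos (freeSymbol_pos hμ ξ)]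
  exact freeSymbol_le hμ ξ

/-- The free resolvent `(-Δ + μ)⁻¹`. -/
def freeResolvent (d : ℕ) (μ : ℝ) : L2 d →L[ℂ] L2 d := fourierMul fun ξ => (freeSymbol μ ξ : ℂ)

theorem norm_freeResolvent_le {μ : ℝ} (hμ : 0 < μ) : ‖freeResolvent d μ‖ ≤ μ⁻¹ := by
  refine norm_fourierMul_le (memLp_freeSymbol hμ) (by positivity) (ae_of_all _ fun ξ => ?_)
  rw [Complex.norm_real, Real.norm_eq_abs, abs_of_pos (freeSymbol_pos hμ ξ)]
  exact freeSymbol_le hμ ξ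

theorem isSelfAdjoint_freeResolvent {μ : ℝ} (hμ : 0 < μ) : IsSelfAdjoint (freeResolvent d μ) :=
  isSelfAdjoint_fourierMul (memLp_freeSymbol hμ)

theorem isResolventAt_negLaplacian {μ : ℝ} (hμ : 0 < μ) :
    IsResolventAt (negLaplacian d) (-μ : ℂ) (freeResolvent d μ) := by
  have hne : ∀ ξ : Space d, (symbol ξ : ℂ) + μ ≠ 0 := fun ξ => by
    exact_mod_cast (symbol_add_pos hμ ξ).ne'
  refine IsResolventAt.of_graph (fun x => ?_) fun u v huv => ?_
  · rw [negLaplacian_graph, mem_negLaplacianGraph_iff, FourierTransform.fourier_add,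
      FourierTransform.fourier_smul]
    filter_upwards [fourier_fourierMul_ae (memLp_freeSymbol hμ) x,
      Lp.coeFn_add (𝓕 x : L2 d) ((-μ : ℂ) • (𝓕 (freeResolvent d μ x) : L2 d)),
      Lp.coeFn_smul (-μ : ℂ) (𝓕 (freeResolvent d μ x) : L2 d)] with ξ h1 h2 h3
    rw [h2, Pi.add_apply, h3, Pi.smul_apply]
    rw [freeResolvent, h1]
    simp only [freeSymbol, smul_eq_mul]
    push_cast
    field_simp [hne ξ]
    ring
  · rw [negLaplacian_graph, mem_negLaplacianGraph_iff] at huv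
    apply (Lp.fourierTransformₗᵢ (Space d) ℂ).injective
    change (𝓕 (freeResolvent d μ (v - (-μ : ℂ) • u)) : L2 d) = 𝓕 u
    refine Lp.ext ?_
    have h5 : (𝓕 (v - (-μ : ℂ) • u) : L2 d) = 𝓕 v + (μ : ℂ) • 𝓕 u := by
      rw [neg_smul, sub_neg_eq_add, FourierTransform.fourier_add,
      FourierTransform.fourier_smul]
    have h6 := fourier_fourierMul_ae (memLp_freeSymbol hμ) (v - (-μ : ℂ) • u)
    rw [h5] at h6
    filter_upwards [h6, Lp.coeFn_add (𝓕 v : L2 d) ((μ : ℂ) • (𝓕 u : L2 d)),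
      Lp.coeFn_smul (μ : ℂ) (𝓕 u : L2 d), huv] with ξ h1 h2 h3 h4
    rw [freeResolvent, h1, h2, Pi.add_apply, h3, Pi.smul_apply, h4]
    simp only [freeSymbol, smul_eq_mul]
    push_cast
    field_simp [hne ξ]

end Fourier

section Gaussian

open FourierTransform

variable {d : ℕ}

/-! ### The free heat semigroup -/

theorem exists_subseq_tendsto_ae {u : ℕ → L2 d} {v : L2 d} (h : Tendsto u atTop (𝓝 v)) :
    ∃ φ : ℕ → ℕ, StrictMono φ ∧ ∀ᵐ x, Tendsto (fun n => u (φ n) x) atTop (𝓝 (v x)) :=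
  (tendstoInMeasure_of_tendsto_Lp h).exists_seq_tendsto_ae

/-- The `L₂` inverse transform is defined by extension, the other one by an integral. They agree as
distributions, by moving the transform onto a test function with Fubini. -/
theorem fourierInv_toLp_ae {h : Space d → ℂ} (h1 : Integrable h) (h2 : MemLp h 2 volume) :
    (𝓕⁻ (h2.toLp h) : L2 d) =ᵐ[volume] fun x => 𝓕⁻ h x := by
  have hc : Continuous (𝓕⁻ h) := by
    have h3 : 𝓕⁻ h = fun x => 𝓕 h (-x) := by
      ext x; exact Real.fourierInv_eq_fourier_neg h x
    rw [h3]
    exact (VectorFourier.fourierIntegral_continuous Real.continuous_fourierChar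
      (L := innerₗ (Space d)) continuous_inner h1).comp continuous_neg
  refine ae_eq_of_integral_contDiff_smul_eq
    ((Lp.memLp (𝓕⁻ (h2.toLp h) : L2 d)).locallyIntegrable (by norm_num)) hc.locallyIntegrable ?_
  intro g hg hgc
  have hg₁ : HasCompactSupport (Complex.ofRealCLM ∘ g) := hgc.comp_left rfl
  have hg₂ : ContDiff ℝ ((⊤ : ℕ∞) : WithTop ℕ∞) (Complex.ofRealCLM ∘ g) :=
    Complex.ofRealCLM.contDiff.comp hg
  set φ : 𝓢(Space d, ℂ) := hg₁.toSchwartzMap hg₂ with hφ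
  have e1 : ∫ x, g x • (𝓕⁻ (h2.toLp h) : L2 d) x
      = (Lp.toTemperedDistribution (𝓕⁻ (h2.toLp h) : L2 d) : 𝓢'(Space d, ℂ)) φ := by
    rw [Lp.toTemperedDistribution_apply]
    simp [hφ]
  rw [e1, ← Lp.fourierInv_toTemperedDistribution_eq, TemperedDistribution.fourierInv_apply,
    Lp.toTemperedDistribution_apply]
  have e2 : ∫ x, (𝓕⁻ φ) x • (h2.toLp h) x = ∫ x, (𝓕⁻ φ) x • h x := by
    refine integral_congr_ae ?_
    filter_upwards [h2.coeFn_toLp] with x hx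
    rw [hx]
  rw [e2]
  have e3 : ∀ x, (𝓕⁻ φ) x = 𝓕 (φ : Space d → ℂ) (-x) := fun x => by
    rw [SchwartzMap.fourierInv_coe, Real.fourierInv_eq_fourier_neg]
  have e4 : ∀ x, 𝓕⁻ h x = 𝓕 (fun y => h (-y)) x := fun x => by
    rw [Real.fourierInv_eq_fourier_comp_neg]
  have e5 := VectorFourier.integral_fourierIntegral_smul_eq_flip (L := innerₗ (Space d))
      (μ := volume) (ν := volume) Real.continuous_fourierChar continuous_inner φ.integrable
      h1.comp_neg
  rw [← integral_neg_eq_self]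
  simp only [e3, neg_neg, e4]
  simp only [flip_innerₗ] at e5
  refine e5.trans (integral_congr_ae (ae_of_all _ fun x => ?_))
  simp only [hφ, HasCompactSupport.toSchwartzMap_toFun, Function.comp_apply,
    Complex.ofRealCLM_apply, smul_eq_mul, Complex.real_smul]
  rfl

/-- The heat kernel of `-Δ`. -/
def gaussKernel (d : ℕ) (t : ℝ) (y : Space d) : ℝ :=
  (4 * Real.pi * t)⁻¹ ^ ((d : ℝ) / 2) * Real.exp (-(4 * t)⁻¹ * ‖y‖ ^ 2)

theorem gaussKernel_nonneg {t : ℝ} (ht : 0 < t) (y : Space d) : 0 ≤ gaussKernel d t y := by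
  unfold gaussKernel; positivity

theorem continuous_gaussKernel (t : ℝ) : Continuous (gaussKernel d t) := by
  unfold gaussKernel; fun_prop

/-- The symbol of the free heat operator. -/
def heatSymbol (t : ℝ) (ξ : Space d) : ℝ := Real.exp (-t * symbol ξ)

theorem memLp_heatSymbol {t : ℝ} (ht : 0 < t) :
    MemLp (fun ξ => (heatSymbol t ξ : ℂ)) ∞ (volume : Measure (Space d)) := by
  refine memLp_top_of_continuous_bounded (Continuous.aestronglyMeasurable ?_) (C := 1) fun ξ => ?_
  · have := continuous_symbol (d := d)
    unfold heatSymbol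
    fun_prop
  · rw [Complex.norm_real, Real.norm_eq_abs, heatSymbol, Real.abs_exp, Real.exp_le_one_iff]
    nlinarith [symbol_nonneg ξ]

theorem integrable_exp_neg_mul_sq {b : ℝ} (hb : 0 < b) :
    Integrable fun y : Space d => Real.exp (-b * ‖y‖ ^ 2) := by
  have := (GaussianFourier.integrable_cexp_neg_mul_sq_norm_add (V := Space d) (b := (b : ℂ))
    (by simpa using hb) 0 0).re
  refine this.congr (ae_of_all _ fun y => ?_)
  simp only [zero_mul, add_zero]
  norm_cast

theorem memLp_gaussKernel {t : ℝ} (ht : 0 < t) (x : Space d) :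
    MemLp (fun y => (gaussKernel d t (x - y) : ℂ)) 2 (volume : Measure (Space d)) := by
  have hc := continuous_gaussKernel (d := d) t
  have h1 : MemLp (fun y => (gaussKernel d t y : ℂ)) 2 (volume : Measure (Space d)) := by
    rw [memLp_two_iff_integrable_sq_norm (by fun_prop)]
    have := (integrable_exp_neg_mul_sq (d := d) (b := 2 * (4 * t)⁻¹) (by positivity)).const_mul
      (((4 * Real.pi * t)⁻¹ ^ ((d : ℝ) / 2)) ^ 2)
    refine this.congr (ae_of_all _ fun y => ?_)
    simp only [gaussKernel]
    rw [Complex.norm_real, Real.norm_eq_abs, sq_abs, mul_pow, ← Real.exp_nat_mul]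
    congr 2
    push_cast
    ring
  exact h1.comp_measurePreserving (Measure.measurePreserving_sub_left volume x)

/-- The kernel vector of the free heat operator. -/
def gaussVec {t : ℝ} (ht : 0 < t) (x : Space d) : L2 d := (memLp_gaussKernel ht x).toLp _

theorem inner_gaussVec {t : ℝ} (ht : 0 < t) (x : Space d) (f : L2 d) :
    ⟪gaussVec ht x, f⟫_ℂ = ∫ y, (gaussKernel d t (x - y) : ℂ) * f y := by
  rw [L2.inner_def]
  refine integral_congr_ae ?_
  filter_upwards [(memLp_gaussKernel ht x).coeFn_toLp] with y hy
  rw [gaussVec, hy, RCLike.inner_apply, Complex.conj_ofReal, mul_comm]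

theorem integrable_gaussKernel_mul {t : ℝ} (ht : 0 < t) (x : Space d) (f : L2 d) :
    Integrable fun y => (gaussKernel d t (x - y) : ℂ) * f y :=
  (memLp_gaussKernel ht x).integrable_mul (Lp.memLp f)

/-- Convergence in `L₂` gives convergence almost everywhere along a subsequence. A kernel formula
therefore needs to be proved only on a dense set such as the Schwartz functions. -/
theorem isClosed_kernelVec (T : L2 d →L[ℂ] L2 d) (κ : Space d → L2 d) :
    IsClosed {f : L2 d | ∀ᵐ x, T f x = ⟪κ x, f⟫_ℂ} := by
  refine IsSeqClosed.isClosed fun u v hu huv => ?_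
  obtain ⟨φ, hφ, hx⟩ := exists_subseq_tendsto_ae ((T.continuous.tendsto v).comp huv)
  have h1 : ∀ᵐ x, ∀ n, T (u n) x = ⟪κ x, u n⟫_ℂ := ae_all_iff.2 hu
  change ∀ᵐ x, _
  filter_upwards [hx, h1] with x h2 h3
  simp only [Function.comp_apply, h3] at h2
  refine tendsto_nhds_unique h2 ?_
  exact (((innerSL ℂ (κ x)).continuous.tendsto v).comp huv).comp hφ.tendsto_atTop

theorem fourier_gaussian_eq_gaussKernel {t : ℝ} (ht : 0 < t) (x w : Space d) :
    𝓕 (fun v : Space d => Complex.exp (-(((2 * Real.pi) ^ 2 * t : ℝ) : ℂ) * ‖v‖ ^ 2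
      + 2 * Real.pi * Complex.I * (⟪x, v⟫_ℝ : ℝ))) w = (gaussKernel d t (x - w) : ℂ) := by
  set b : ℝ := (2 * Real.pi) ^ 2 * t with hb
  have hb0 : 0 < b := by positivity
  rw [fourier_gaussian_innerProductSpace' (b := (b : ℂ)) (by simpa using hb0) x w,
    gaussKernel, finrank_euclideanSpace, Fintype.card_fin]
  have hpi : (Real.pi : ℂ) ≠ 0 := by exact_mod_cast Real.pi_pos.ne'
  have htc : (t : ℂ) ≠ 0 := by exact_mod_cast ht.ne'
  have h1 : (Real.pi / b : ℂ) = (((4 * Real.pi * t)⁻¹ : ℝ) : ℂ) := by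
    rw [hb]
    push_cast
    field_simp
    norm_num
  have h2 : ((d : ℂ) / 2) = (((d : ℝ) / 2 : ℝ) : ℂ) := by push_cast; ring
  have h3 : (-Real.pi ^ 2 * ‖x - w‖ ^ 2 / b : ℂ) = ((-(4 * t)⁻¹ * ‖x - w‖ ^ 2 : ℝ) : ℂ) := by
    rw [hb]
    push_cast
    field_simp
    norm_num
  rw [h1, h2, h3, ← Complex.ofReal_cpow (by positivity), ← Complex.ofReal_exp,
    ← Complex.ofReal_mul]

/-- Moves the transform from `φ` to the modulated Gaussian, whose Fourier transform is the
translated heat kernel. -/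
theorem fourierInv_heatSymbol_mul {t : ℝ} (ht : 0 < t) (φ : 𝓢(Space d, ℂ)) (x : Space d) :
    𝓕⁻ (fun ξ => (heatSymbol t ξ : ℂ) * (𝓕 φ) ξ) x
      = ∫ y, (gaussKernel d t (x - y) : ℂ) * φ y := by
  rw [Real.fourierInv_eq]
  have J : Integrable (fun v : Space d =>
      Complex.exp (-(((2 * Real.pi) ^ 2 * t : ℝ) : ℂ) * ‖v‖ ^ 2
      + 2 * Real.pi * Complex.I * (⟪x, v⟫_ℝ : ℝ))) :=
    GaussianFourier.integrable_cexp_neg_mul_sq_norm_add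
      (by rw [Complex.ofReal_re]; positivity) _ _
  have e5 := VectorFourier.integral_fourierIntegral_smul_eq_flip (L := innerₗ (Space d))
      (μ := volume) (ν := volume) Real.continuous_fourierChar continuous_inner J
      φ.integrable
  have e6 : ∀ y, (gaussKernel d t (x - y) : ℂ) * φ y
      = 𝓕 (fun v : Space d => Complex.exp (-(((2 * Real.pi) ^ 2 * t : ℝ) : ℂ) * ‖v‖ ^ 2
      + 2 * Real.pi * Complex.I * (⟪x, v⟫_ℝ : ℝ))) y • φ y := fun y => by
    rw [fourier_gaussian_eq_gaussKernel ht, smul_eq_mul]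
  simp only [e6]
  refine Eq.trans (integral_congr_ae (ae_of_all _ fun v => ?_)) e5.symm
  have e8 : VectorFourier.fourierIntegral Real.fourierChar volume (innerₗ (Space d)).flip φ v
      = (𝓕 φ) v := by rw [flip_innerₗ]; rfl
  simp only [e8]
  rw [Circle.smul_def, Real.fourierChar_apply, smul_eq_mul, smul_eq_mul, ← mul_assoc,
    heatSymbol, symbol, Complex.ofReal_exp, ← Complex.exp_add, real_inner_comm]
  congr 2
  push_cast
  ring

theorem fourierMul_heatSymbol_toLp {t : ℝ} (ht : 0 < t) (φ : 𝓢(Space d, ℂ)) :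
    ∀ᵐ x, fourierMul (fun ξ => (heatSymbol t ξ : ℂ)) (φ.toLp 2) x
      = ⟪gaussVec ht x, φ.toLp 2⟫_ℂ := by
  set g : Space d → ℂ := fun ξ => (heatSymbol t ξ : ℂ) * (𝓕 φ) ξ with hg
  have hg2 : MemLp g 2 volume := ((𝓕 φ).memLp 2).mul (memLp_heatSymbol ht)
  have hg1 : Integrable g := by
    rw [← memLp_one_iff_integrable]
    exact ((𝓕 φ).memLp 1).mul (memLp_heatSymbol ht)
  have e1 : fourierMul (fun ξ => (heatSymbol t ξ : ℂ)) (φ.toLp 2) = 𝓕⁻ (hg2.toLp g) := by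
    rw [fourierMul_apply, SchwartzMap.toLp_fourier_eq]
    congr 1
    refine Lp.ext ?_
    filter_upwards [coeFn_mulOp (memLp_heatSymbol ht) ((𝓕 φ).toLp 2), hg2.coeFn_toLp,
      (𝓕 φ).coeFn_toLp 2] with x h1 h2 h3
    rw [h1, h2, h3]
  rw [e1]
  filter_upwards [fourierInv_toLp_ae hg1 hg2] with x hx
  rw [hx, inner_gaussVec, fourierInv_heatSymbol_mul ht]
  refine integral_congr_ae ?_
  filter_upwards [φ.coeFn_toLp 2] with y hy
  rw [hy]

theorem fourierMul_heatSymbol_apply {t : ℝ} (ht : 0 < t) (f : L2 d) :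
    ∀ᵐ x, fourierMul (fun ξ => (heatSymbol t ξ : ℂ)) f x = ⟪gaussVec ht x, f⟫_ℂ :=
  (SchwartzMap.denseRange_toLpCLM (E := Space d) (F := ℂ) (p := 2)
    (μ := volume) ENNReal.ofNat_ne_top).induction_on (p := fun f : L2 d =>
    ∀ᵐ x, fourierMul (fun ξ => (heatSymbol t ξ : ℂ)) f x = ⟪gaussVec ht x, f⟫_ℂ) f
    (isClosed_kernelVec _ _) (fourierMul_heatSymbol_toLp ht)

end Gaussian

section Domination

variable {d : ℕ}

/-! ### Pointwise domination of operators -/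

/-- `|T f| ≤ P h` whenever `|f| ≤ h`. -/
def Dominated (T P : L2 d →L[ℂ] L2 d) : Prop :=
  ∀ f h : L2 d, (∀ᵐ x, (‖f x‖ : ℂ) ≤ h x) → ∀ᵐ x, (‖T f x‖ : ℂ) ≤ P h x

theorem Dominated.comp {T P T' P' : L2 d →L[ℂ] L2 d} (h : Dominated T P)
    (h' : Dominated T' P') : Dominated (T * T') (P * P') :=
  fun f g hfg => h _ _ (h' f g hfg)

theorem Dominated.one : Dominated (1 : L2 d →L[ℂ] L2 d) 1 := fun _ _ h => h

theorem Dominated.zero : Dominated (0 : L2 d →L[ℂ] L2 d) 0 := fun f h _ => by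
  simp only [zero_apply]
  filter_upwards [Lp.coeFn_zero ℂ 2 (volume : Measure (Space d))] with x hx
  rw [hx]
  simp

theorem Dominated.pow {T P : L2 d →L[ℂ] L2 d} (h : Dominated T P) (n : ℕ) :
    Dominated (T ^ n) (P ^ n) := by
  induction n with
  | zero => simpa using Dominated.one
  | succ n ih => rw [pow_succ, pow_succ]; exact ih.comp h

theorem Dominated.add {T P T' P' : L2 d →L[ℂ] L2 d} (h : Dominated T P)
    (h' : Dominated T' P') : Dominated (T + T') (P + P') := by
  intro f g hfg
  filter_upwards [h f g hfg, h' f g hfg, Lp.coeFn_add (T f) (T' f), Lp.coeFn_add (P g) (P' g)]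
    with x h1 h2 h3 h4
  rw [add_apply, add_apply, h3, h4]
  refine le_trans ?_ (add_le_add h1 h2)
  rw [← Complex.ofReal_add]
  exact Complex.real_le_real.2 (norm_add_le _ _)

theorem Dominated.smul {T P : L2 d →L[ℂ] L2 d} (h : Dominated T P) {c : ℂ} {r : ℝ}
    (hc : ‖c‖ = r) : Dominated (c • T) ((r : ℂ) • P) := by
  intro f g hfg
  filter_upwards [h f g hfg, Lp.coeFn_smul c (T f), Lp.coeFn_smul (r : ℂ) (P g)]
    with x h1 h2 h3
  rw [smul_apply, smul_apply, h2, h3, Pi.smul_apply,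
    Pi.smul_apply, norm_smul, hc, Complex.ofReal_mul, smul_eq_mul]
  refine mul_le_mul_of_nonneg_left h1 ?_
  rw [← hc]
  exact Complex.zero_le_real.2 (norm_nonneg _)

theorem Dominated.sum {ι : Type*} (s : Finset ι) {T P : ι → L2 d →L[ℂ] L2 d}
    (h : ∀ i, Dominated (T i) (P i)) : Dominated (∑ i ∈ s, T i) (∑ i ∈ s, P i) := by
  classical
  induction s using Finset.induction_on with
  | empty => simpa using Dominated.zero
  | insert i s hi ih => rw [Finset.sum_insert hi, Finset.sum_insert hi]; exact (h i).add ih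

/-- Operator convergence gives, after passing to a subsequence twice, convergence almost everywhere
of both sides, and the order relation is closed. -/
theorem Dominated.of_tendsto {T P : L2 d →L[ℂ] L2 d} {Tn Pn : ℕ → L2 d →L[ℂ] L2 d}
    (h : ∀ n, Dominated (Tn n) (Pn n)) (hT : Tendsto Tn atTop (𝓝 T))
    (hP : Tendsto Pn atTop (𝓝 P)) : Dominated T P := by
  intro f g hfg
  have hTf : Tendsto (fun n => Tn n f) atTop (𝓝 (T f)) :=
    ((ContinuousLinearMap.apply ℂ (L2 d) f).continuous.tendsto T).comp hT
  have hPg : Tendsto (fun n => Pn n g) atTop (𝓝 (P g)) :=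
    ((ContinuousLinearMap.apply ℂ (L2 d) g).continuous.tendsto P).comp hP
  obtain ⟨φ, hφ, h1⟩ := exists_subseq_tendsto_ae hTf
  obtain ⟨ψ, hψ, h2⟩ := exists_subseq_tendsto_ae (hPg.comp hφ.tendsto_atTop)
  have h3 : ∀ᵐ x, ∀ n, (‖Tn n f x‖ : ℂ) ≤ Pn n g x := ae_all_iff.2 fun n => h n f g hfg
  filter_upwards [h1, h2, h3] with x h4 h5 h6
  have h7 : Tendsto (fun n => (‖Tn (φ (ψ n)) f x‖ : ℂ)) atTop (𝓝 (‖T f x‖ : ℂ)) :=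
    ((Complex.continuous_ofReal.comp continuous_norm).tendsto _).comp
      (h4.comp hψ.tendsto_atTop)
  exact le_of_tendsto_of_tendsto' h7 h5 fun n => h6 _

/-- The modulus of an `L₂` function. -/
def absL2 (f : L2 d) : L2 d :=
  MemLp.toLp (fun x => (‖f x‖ : ℂ)) ((Lp.memLp f).norm.ofReal)

theorem absL2_ae (f : L2 d) : absL2 f =ᵐ[volume] fun x => (‖f x‖ : ℂ) := MemLp.coeFn_toLp _

theorem norm_absL2 (f : L2 d) : ‖absL2 f‖ = ‖f‖ := by
  refine le_antisymm (Lp.norm_le_norm_of_ae_le ?_) (Lp.norm_le_norm_of_ae_le ?_)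
  all_goals
    filter_upwards [absL2_ae f] with x hx
    rw [hx]
    simp

theorem le_absL2 (f : L2 d) : ∀ᵐ x, (‖f x‖ : ℂ) ≤ absL2 f x := by
  filter_upwards [absL2_ae f] with x hx
  rw [hx]

theorem Dominated.mulOp {f : Space d → ℂ} (hf : MemLp f ∞ volume) {C : ℝ}
    (hC : ∀ᵐ x, ‖f x‖ ≤ C) : Dominated (mulOp f) ((C : ℂ) • 1) := by
  intro u h huh
  filter_upwards [coeFn_mulOp hf u, huh, hC, Lp.coeFn_smul (C : ℂ) h] with x h1 h2 h3 h4
  rw [h1, smul_apply, one_apply_eq_self, h4, Pi.smul_apply,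
    norm_mul, Complex.ofReal_mul, smul_eq_mul]
  exact mul_le_mul (Complex.real_le_real.2 h3) h2 (Complex.zero_le_real.2 (norm_nonneg _))
    (Complex.zero_le_real.2 ((norm_nonneg _).trans h3))

theorem Dominated.freeHeat {t : ℝ} (ht : 0 < t) :
    Dominated (fourierMul fun ξ : Space d => (heatSymbol t ξ : ℂ))
      (fourierMul fun ξ => (heatSymbol t ξ : ℂ)) := by
  intro f h hfh
  filter_upwards [fourierMul_heatSymbol_apply ht f, fourierMul_heatSymbol_apply ht h] with x h1 h2
  rw [h1, h2, inner_gaussVec, inner_gaussVec]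
  have i1 := integrable_gaussKernel_mul ht x f
  have i2 := integrable_gaussKernel_mul ht x h
  have h3 : ∫ y, (gaussKernel d t (x - y) : ℂ) * h y
      = ((∫ y, gaussKernel d t (x - y) * (h y).re : ℝ) : ℂ) := by
    refine Eq.trans (integral_congr_ae ?_) integral_complex_ofReal
    filter_upwards [hfh] with y hy
    -- The order on `ℂ` compares only numbers with equal imaginary part, so a majorant of `‖f y‖` is
    -- automatically real and nonnegative.
    have : h y = ((h y).re : ℂ) := by
      have h0 : (0 : ℂ) ≤ h y := le_trans (Complex.zero_le_real.2 (norm_nonneg _)) hy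
      exact Complex.eq_re_of_ofReal_le (r := 0) (by simpa using h0)
    rw [this]
    simp
  rw [h3]
  refine Complex.real_le_real.2 ((norm_integral_le_integral_norm _).trans ?_)
  refine integral_mono_ae i1.norm ?_ ?_
  · refine i2.re.congr (ae_of_all _ fun y => ?_)
    simp
  · filter_upwards [hfh] with y hy
    rw [norm_mul, Complex.norm_real, Real.norm_eq_abs, abs_of_nonneg (gaussKernel_nonneg ht _)]
    exact mul_le_mul_of_nonneg_left (by simpa using (Complex.le_def.1 hy).1)
      (gaussKernel_nonneg ht _)

/-- A Riemann sum for the Laplace transform representing `1/a`. -/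
theorem abs_riemann_sub_inv_le {h a : ℝ} (hh : 0 < h) (ha : 0 < a) (N : ℕ) :
    |h * ∑ k ∈ Finset.range N, Real.exp (-(h * (k + 1)) * a) - a⁻¹|
      ≤ h + a⁻¹ * Real.exp (-(h * N) * a) := by
  set q := Real.exp (-(h * a)) with hq
  have hq1 : q < 1 := by rw [hq, Real.exp_lt_one_iff]; nlinarith [mul_pos hh ha]
  have hq0 : 0 < q := Real.exp_pos _
  have hs : ∑ k ∈ Finset.range N, Real.exp (-(h * (k + 1)) * a) = q * ((1 - q ^ N) / (1 - q)) := by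
    have : ∀ k : ℕ, Real.exp (-(h * (k + 1)) * a) = q * q ^ k := fun k => by
      rw [hq, ← Real.exp_nat_mul, ← Real.exp_add]; congr 1; ring
    simp only [this, ← Finset.mul_sum]
    rw [geom_sum_eq hq1.ne, ← neg_sub (1 : ℝ) (q ^ N), ← neg_sub 1 q, neg_div_neg_eq]
  have hN : Real.exp (-(h * N) * a) = q ^ N := by
    rw [hq, ← Real.exp_nat_mul]; congr 1; ring
  rw [hs, hN]
  have h1 : 0 < 1 - q := by linarith
  -- The full geometric series sums to `h q / (1 - q)`, which lies between `a⁻¹ - h` and `a⁻¹` by `1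
  -- + x ≤ eˣ` at `x = ± h a`; the remaining error is the tail of the series.
  have hup : h * q / (1 - q) ≤ a⁻¹ := by
    rw [div_le_iff₀ h1, inv_mul_eq_div, le_div_iff₀ ha]
    have := Real.add_one_le_exp (h * a)
    have h2 : q * Real.exp (h * a) = 1 := by rw [hq, ← Real.exp_add]; simp
    nlinarith
  have hlo : a⁻¹ - h ≤ h * q / (1 - q) := by
    rw [le_div_iff₀ h1]
    have := Real.add_one_le_exp (-(h * a))
    rw [← hq] at this
    have h3 : (a⁻¹ - h) * (1 - q) - h * q = a⁻¹ * ((1 - h * a) - q) := by field_simp; ring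
    have h4 : a⁻¹ * ((1 - h * a) - q) ≤ 0 :=
      mul_nonpos_of_nonneg_of_nonpos (by positivity) (by linarith)
    linarith
  have hqN : 0 ≤ q ^ N := by positivity
  have e : h * (q * ((1 - q ^ N) / (1 - q))) = h * q / (1 - q) - h * q / (1 - q) * q ^ N := by
    field_simp
  have e2 : h * q / (1 - q) * q ^ N ≤ a⁻¹ * q ^ N := mul_le_mul_of_nonneg_right hup hqN
  have e3 : 0 ≤ h * q / (1 - q) * q ^ N := by positivity
  have e4 : 0 ≤ a⁻¹ * q ^ N := by positivity
  rw [e, abs_le]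
  constructor <;> linarith

theorem fourierMul_sum {ι : Type*} (s : Finset ι) {f : ι → Space d → ℂ}
    (hf : ∀ i, MemLp (f i) ∞ volume) :
    fourierMul (fun x => ∑ i ∈ s, f i x) = ∑ i ∈ s, fourierMul (f i) := by
  classical
  induction s using Finset.induction_on with
  | empty =>
    simp only [Finset.sum_empty]
    have h := fourierMul_smul (d := d) 0 (f := fun _ => 1) (memLp_top_const 1)
    simpa using h
  | insert i s hi ih =>
    simp only [Finset.sum_insert hi]
    rw [← ih, fourierMul_add (hf i)]
    exact memLp_finsetSum s fun i _ => hf i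

theorem tendsto_fourierMul {m : ℕ → Space d → ℂ} {m₀ : Space d → ℂ}
    (hm : ∀ n, MemLp (m n) ∞ volume) (hm₀ : MemLp m₀ ∞ volume) {c : ℕ → ℝ}
    (hc : Tendsto c atTop (𝓝 0)) (hb : ∀ n x, ‖m n x - m₀ x‖ ≤ c n) :
    Tendsto (fun n => fourierMul (m n)) atTop (𝓝 (fourierMul m₀)) := by
  rw [tendsto_iff_norm_sub_tendsto_zero]
  refine squeeze_zero (fun n => norm_nonneg _) (fun n => ?_) hc
  rw [← fourierMul_sub (hm n) hm₀]
  exact norm_fourierMul_le ((hm n).sub hm₀) ((norm_nonneg _).trans (hb n 0))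
    (ae_of_all _ (hb n))

/-- The resolvent is the Laplace transform `∫ e^{-μt} e^{tΔ} dt` of a positivity preserving
semigroup. Riemann sums with step `1/(n+1)` and `(n+1)²` nodes reach up to time `n + 1`, and they
converge in operator norm because the symbol plus `μ` is bounded below by `μ`. -/
theorem Dominated.freeResolvent {μ : ℝ} (hμ : 0 < μ) :
    Dominated (freeResolvent d μ) (freeResolvent d μ) := by
  have key : Tendsto (fun n : ℕ => fourierMul fun ξ : Space d =>
      ∑ k ∈ Finset.range ((n + 1) ^ 2), (((1 / ((n : ℝ) + 1)
        * Real.exp (-(1 / ((n : ℝ) + 1) * (k + 1)) * μ) : ℝ) : ℂ)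
        * (heatSymbol (1 / ((n : ℝ) + 1) * (k + 1)) ξ : ℂ)))
      atTop (𝓝 (DensityOfStates.freeResolvent d μ)) := by
    refine tendsto_fourierMul (c := fun n : ℕ => 1 / ((n : ℝ) + 1)
      + μ⁻¹ * Real.exp (-((n : ℝ) + 1) * μ)) (fun n => ?_) (memLp_freeSymbol hμ) ?_ ?_
    · exact memLp_finsetSum _ fun k _ => (memLp_heatSymbol (by positivity)).const_mul _
    · have h1 : Tendsto (fun n : ℕ => Real.exp (-((n : ℝ) + 1) * μ)) atTop (𝓝 0) := by
        refine Real.tendsto_exp_neg_atTop_nhds_zero.comp (f := fun n : ℕ => ((n : ℝ) + 1) * μ) ?_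
          |>.congr fun n => by rw [Function.comp_apply, neg_mul]
        exact (tendsto_atTop_add_const_right _ _ tendsto_natCast_atTop_atTop).atTop_mul_const hμ
      simpa using tendsto_one_div_add_atTop_nhds_zero_nat.add (h1.const_mul μ⁻¹)
    · intro n ξ
      have ha := symbol_add_pos hμ ξ
      have hn : (0 : ℝ) < 1 / ((n : ℝ) + 1) := by positivity
      have h1 := abs_riemann_sub_inv_le hn ha ((n + 1) ^ 2)
      have e : ∀ k : ℕ, (((1 / ((n : ℝ) + 1)
        * Real.exp (-(1 / ((n : ℝ) + 1) * (k + 1)) * μ) : ℝ) : ℂ)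
        * (heatSymbol (1 / ((n : ℝ) + 1) * (k + 1)) ξ : ℂ))
        = ((1 / ((n : ℝ) + 1) *
          Real.exp (-(1 / ((n : ℝ) + 1) * (k + 1)) * (symbol ξ + μ)) : ℝ) : ℂ) := fun k => by
        rw [← Complex.ofReal_mul, heatSymbol, mul_assoc, ← Real.exp_add]
        congr 3
        ring
      simp only [e]
      rw [← Complex.ofReal_sum, ← Complex.ofReal_sub, Complex.norm_real, ← Finset.mul_sum,
        Real.norm_eq_abs]
      refine h1.trans ?_
      have h2 : (symbol ξ + μ)⁻¹ ≤ μ⁻¹ := freeSymbol_le hμ ξ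
      have h3 : (1 / ((n : ℝ) + 1) * (((n + 1) ^ 2 : ℕ) : ℝ)) = n + 1 := by
        push_cast
        field_simp
      rw [h3]
      have h4 : Real.exp (-((n : ℝ) + 1) * (symbol ξ + μ)) ≤ Real.exp (-((n : ℝ) + 1) * μ) := by
        refine Real.exp_le_exp.2 ?_
        have : 0 ≤ ((n : ℝ) + 1) * symbol ξ := mul_nonneg (by positivity) (symbol_nonneg ξ)
        nlinarith
      have := mul_le_mul h2 h4 (Real.exp_pos _).le (by positivity)
      linarith
  refine Dominated.of_tendsto (fun n => ?_) key key
  have hm : ∀ k : ℕ, MemLp (fun ξ : Space d => (heatSymbol (1 / ((n : ℝ) + 1) * (k + 1)) ξ : ℂ))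
      ∞ volume := fun k => memLp_heatSymbol (by positivity)
  rw [fourierMul_sum _ fun k => (hm k).const_mul _]
  refine Dominated.sum _ fun k => ?_
  rw [fourierMul_smul _ (hm k)]
  refine (Dominated.freeHeat (by positivity)).smul ?_
  rw [Complex.norm_real, Real.norm_eq_abs, abs_of_pos (by positivity)]

end Domination

section Resolvent

variable {d : ℕ}

/-! ### The resolvent of the Schrödinger operator -/

/-- The operator `(-Δ + V + l)⁻¹`, as a Neumann series. -/
def schrodingerResolvent (V : Space d → ℝ) (l : ℝ) : L2 d →L[ℂ] L2 d :=
  freeResolvent d l * ∑' n : ℕ, (-(mulOp (fun x => (V x : ℂ)) * freeResolvent d l)) ^ n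

variable {V : Space d → ℝ} {M l : ℝ}

theorem norm_mulOp_le {f : Space d → ℂ} (hf : MemLp f ∞ volume) {C : ℝ} (hC0 : 0 ≤ C)
    (hC : ∀ᵐ x, ‖f x‖ ≤ C) : ‖mulOp f‖ ≤ C :=
  ContinuousLinearMap.opNorm_le_bound _ hC0 fun u => norm_mulOp_apply_le hf hC u

theorem norm_neg_mulOp_mul_freeResolvent_lt (hV : MemLp (fun x => (V x : ℂ)) ∞ volume)
    (hM : 0 ≤ M) (hVM : ∀ᵐ x, ‖(V x : ℂ)‖ ≤ M) (hl : M < l) :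
    ‖-(mulOp (fun x => (V x : ℂ)) * freeResolvent d l)‖ < 1 := by
  have hl0 : 0 < l := hM.trans_lt hl
  rw [norm_neg]
  calc ‖mulOp (fun x => (V x : ℂ)) * freeResolvent d l‖
      ≤ M * l⁻¹ := (norm_mul_le _ _).trans (mul_le_mul (norm_mulOp_le hV hM hVM)
        (norm_freeResolvent_le hl0) (norm_nonneg _) hM)
    _ < 1 := by rw [← div_eq_mul_inv, div_lt_one hl0]; exact hl

/-- With `R` the free resolvent and `W` the multiplication by `V`, one has `(H + l) R = 1 + W R`,
and the Neumann series `B` inverts the right side since `‖W R‖ ≤ M / l < 1`. -/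
theorem isResolventAt_schrodinger (hV : MemLp (fun x => (V x : ℂ)) ∞ volume)
    (hM : 0 ≤ M) (hVM : ∀ᵐ x, ‖(V x : ℂ)‖ ≤ M) (hl : M < l) :
    IsResolventAt (schrodinger V) (-l : ℂ) (schrodingerResolvent V l) := by
  have hn := norm_neg_mulOp_mul_freeResolvent_lt hV hM hVM hl
  have h0 := isResolventAt_negLaplacian (d := d) (hM.trans_lt hl)
  rw [schrodingerResolvent]
  set W := mulOp (fun x => (V x : ℂ)) with hW
  set R := freeResolvent d l with hR
  have e1 := mul_neg_geom_series _ hn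
  have e2 := geom_series_mul_neg _ hn
  rw [sub_neg_eq_add] at e1 e2
  set B := ∑' n : ℕ, (-(W * R)) ^ n with hB
  constructor
  · intro x
    obtain ⟨h1, h2⟩ := h0.1 (B x)
    refine ⟨h1, ?_⟩
    have h3 : B x + W (R (B x)) = x := by
      have := congrArg (fun T : L2 d →L[ℂ] L2 d => T x) e1
      simpa using this
    change W (R (B x)) + negLaplacian d ⟨R (B x), h1⟩ - (-l : ℂ) • R (B x) = x
    rw [add_sub_assoc, h2, add_comm, h3]
  · intro u
    have h1 := h0.2 u
    set y := negLaplacian d u - (-l : ℂ) • (u : L2 d) with hy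
    change R (B (W (u : L2 d) + negLaplacian d u - (-l : ℂ) • (u : L2 d))) = u
    rw [add_sub_assoc, ← hy]
    have h3 : B (y + W (R y)) = y := by
      have := congrArg (fun T : L2 d →L[ℂ] L2 d => T y) e2
      simpa using this
    rw [h1, add_comm] at h3
    rw [h3, h1]

theorem exists_sqrt_fourierMul {f : Space d → ℝ} (hf : Continuous f) (hf0 : ∀ x, 0 ≤ f x) {C : ℝ}
    (hC : ∀ x, f x ≤ C) : ∃ S : L2 d →L[ℂ] L2 d, IsSelfAdjoint S ∧
      S * S = fourierMul (fun x => (f x : ℂ)) ∧ ‖S‖ ≤ Real.sqrt C := by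
  have hm : MemLp (fun x => ((Real.sqrt (f x) : ℝ) : ℂ)) ∞ (volume : Measure (Space d)) := by
    refine memLp_top_of_continuous_bounded
      (Complex.continuous_ofReal.comp hf.sqrt).aestronglyMeasurable (C := Real.sqrt C) fun x => ?_
    rw [Complex.norm_real, Real.norm_eq_abs, abs_of_nonneg (Real.sqrt_nonneg _)]
    exact Real.sqrt_le_sqrt (hC x)
  have hsq : (fun x => ((Real.sqrt (f x) : ℝ) : ℂ) * ((Real.sqrt (f x) : ℝ) : ℂ))
      = fun x => (f x : ℂ) := by
    ext x
    rw [← Complex.ofReal_mul, Real.mul_self_sqrt (hf0 x)]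
  have hmf : MemLp (fun x => (f x : ℂ)) ∞ (volume : Measure (Space d)) := by
    refine memLp_top_of_continuous_bounded
      (Complex.continuous_ofReal.comp hf).aestronglyMeasurable (C := C) fun x => ?_
    rw [Complex.norm_real, Real.norm_eq_abs, abs_of_nonneg (hf0 x)]
    exact hC x
  refine ⟨fourierMul fun x => ((Real.sqrt (f x) : ℝ) : ℂ), isSelfAdjoint_fourierMul hm, ?_, ?_⟩
  · have := fourierMul_comp hm hm (by rw [hsq]; exact hmf)
    rw [hsq] at this
    exact this
  · refine norm_fourierMul_le hm (Real.sqrt_nonneg _) (ae_of_all _ fun x => ?_)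
    rw [Complex.norm_real, Real.norm_eq_abs, abs_of_nonneg (Real.sqrt_nonneg _)]
    exact Real.sqrt_le_sqrt (hC x)

/-- `‖R₀ y‖² ≤ l⁻¹ ⟨R₀ y, y⟩` for the free resolvent. -/
theorem norm_sq_freeResolvent_le {l : ℝ} (hl : 0 < l) (y : L2 d) :
    ‖freeResolvent d l y‖ ^ 2 ≤ l⁻¹ * (⟪freeResolvent d l y, y⟫_ℂ).re := by
  obtain ⟨S, hS, hSS, hSn⟩ := exists_sqrt_fourierMul (continuous_freeSymbol (d := d) hl)
    (fun x => (freeSymbol_pos hl x).le) (freeSymbol_le hl)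
  have h1 : freeResolvent d l y = S (S y) := by
    rw [freeResolvent, ← hSS]; rfl
  have h2 : (⟪S (S y), y⟫_ℂ).re = ‖S y‖ ^ 2 := by
    have := ContinuousLinearMap.adjoint_inner_left S y (S y)
    rw [hS.adjoint_eq] at this
    rw [this, inner_self_eq_norm_sq_to_K]
    norm_cast
  rw [h1, h2]
  have h3 : ‖S (S y)‖ ≤ Real.sqrt l⁻¹ * ‖S y‖ :=
    (S.le_opNorm _).trans (mul_le_mul_of_nonneg_right hSn (norm_nonneg _))
  calc ‖S (S y)‖ ^ 2 ≤ (Real.sqrt l⁻¹ * ‖S y‖) ^ 2 := by gcongr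
    _ = l⁻¹ * ‖S y‖ ^ 2 := by rw [mul_pow, Real.sq_sqrt (by positivity)]

/-- Write `x = (1 + W R) y`. Then `⟪R y, x⟫ = ⟪R y, y⟫ + ⟪R y, W R y⟫` has real part at least `(l -
M) ‖R y‖²`, where the first term is handled by `norm_sq_freeResolvent_le`. -/
theorem schrodingerResolvent_nonneg (hV : MemLp (fun x => (V x : ℂ)) ∞ volume)
    (hM : 0 ≤ M) (hVM : ∀ᵐ x, ‖(V x : ℂ)‖ ≤ M) (hl : M < l) :
    0 ≤ schrodingerResolvent V l := by
  have hn := norm_neg_mulOp_mul_freeResolvent_lt hV hM hVM hl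
  have hl0 : 0 < l := hM.trans_lt hl
  have hsa := isSelfAdjoint_freeResolvent (d := d) hl0
  have hpos := norm_sq_freeResolvent_le (d := d) hl0
  have hWsa := adjoint_mulOp_ofReal hV
  have hWn := norm_mulOp_apply_le hV hVM
  rw [schrodingerResolvent]
  set W := mulOp (fun x => (V x : ℂ)) with hW
  set R := freeResolvent d l with hR
  have e1 := mul_neg_geom_series _ hn
  rw [sub_neg_eq_add] at e1
  set B := ∑' n : ℕ, (-(W * R)) ^ n with hB
  have h3 : ∀ x, B x + W (R (B x)) = x := fun x => by
    have := congrArg (fun T : L2 d →L[ℂ] L2 d => T x) e1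
    simpa using this
  have hRs : ∀ u v, ⟪R u, v⟫_ℂ = ⟪u, R v⟫_ℂ := fun u v => by
    have := ContinuousLinearMap.adjoint_inner_left R v u
    rwa [hsa.adjoint_eq] at this
  have hWs : ∀ u v, ⟪W u, v⟫_ℂ = ⟪u, W v⟫_ℂ := fun u v => by
    have := ContinuousLinearMap.adjoint_inner_left W v u
    rwa [hWsa] at this
  rw [ContinuousLinearMap.nonneg_iff_isPositive, ContinuousLinearMap.isPositive_def']
  have hsymm : IsSelfAdjoint (R * B) := by
    rw [ContinuousLinearMap.isSelfAdjoint_iff']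
    symm
    rw [ContinuousLinearMap.eq_adjoint_iff]
    intro u v
    change ⟪R (B u), v⟫_ℂ = ⟪u, R (B v)⟫_ℂ
    -- Substituting `u = (1 + W R) B u` and `v = (1 + W R) B v` makes both sides visibly symmetric
    -- in `R` and `W`.
    nth_rewrite 2 [← h3 u]
    nth_rewrite 1 [← h3 v]
    rw [inner_add_right, inner_add_left, hRs, hWs]
  refine ⟨hsymm, fun x => ?_⟩
  rw [ContinuousLinearMap.reApplyInnerSelf_apply]
  change 0 ≤ RCLike.re ⟪R (B x), x⟫_ℂ
  nth_rewrite 2 [← h3 x]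
  rw [inner_add_right]
  set y := B x
  have h4 : ‖⟪R y, W (R y)⟫_ℂ‖ ≤ M * ‖R y‖ ^ 2 := by
    refine (norm_inner_le_norm _ _).trans ?_
    have := mul_le_mul_of_nonneg_left (hWn (R y)) (norm_nonneg (R y))
    linarith
  have h5 := hpos y
  have h6 : -(M * ‖R y‖ ^ 2) ≤ (⟪R y, W (R y)⟫_ℂ).re :=
    (abs_le.1 ((Complex.abs_re_le_norm _).trans h4)).1
  change 0 ≤ (⟪R y, y⟫_ℂ + ⟪R y, W (R y)⟫_ℂ).re
  rw [Complex.add_re]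
  have h7 : l * ‖R y‖ ^ 2 ≤ (⟪R y, y⟫_ℂ).re := by
    rw [inv_mul_eq_div, le_div_iff₀ hl0] at h5
    linarith
  nlinarith [sq_nonneg ‖R y‖]

/-- The Neumann series for the constant potential `-M`. It majorizes the series for `V` term by
term, which is how domination of the resolvent of `H` arises. -/
theorem freeResolvent_mul_geom_series (hM : 0 ≤ M) (hl : M < l) :
    freeResolvent d l * ∑' n : ℕ, ((M : ℂ) • freeResolvent d l) ^ n = freeResolvent d (l - M) := by
  have hl0 : 0 < l := hM.trans_lt hl
  have hlM : 0 < l - M := sub_pos.2 hl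
  have hn : ‖(M : ℂ) • freeResolvent d l‖ < 1 := by
    rw [norm_smul, Complex.norm_real, Real.norm_eq_abs, abs_of_nonneg hM]
    calc M * ‖freeResolvent d l‖ ≤ M * l⁻¹ :=
          mul_le_mul_of_nonneg_left (norm_freeResolvent_le hl0) hM
      _ < 1 := by rw [← div_eq_mul_inv, div_lt_one hl0]; exact hl
  have h1 : freeResolvent d (l - M) * (1 - (M : ℂ) • freeResolvent d l) = freeResolvent d l := by
    have hm1 := memLp_freeSymbol (d := d) hl0
    have hm2 := memLp_freeSymbol (d := d) hlM
    have e : (1 - (M : ℂ) • freeResolvent d l)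
        = fourierMul fun ξ : Space d => 1 - (M : ℂ) * (freeSymbol l ξ : ℂ) := by
      rw [fourierMul_sub (memLp_top_const 1) (hm1.const_mul _), fourierMul_one,
        fourierMul_smul _ hm1]
      rfl
    have e2 : (fun ξ : Space d => (freeSymbol (l - M) ξ : ℂ)
        * (1 - (M : ℂ) * (freeSymbol l ξ : ℂ))) = fun ξ => (freeSymbol l ξ : ℂ) := by
      ext ξ
      have n1 := (symbol_add_pos hl0 ξ).ne'
      have n2 := (symbol_add_pos hlM ξ).ne'
      have : freeSymbol (l - M) ξ * (1 - M * freeSymbol l ξ) = freeSymbol l ξ := by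
        unfold freeSymbol
        field_simp
        ring
      exact_mod_cast this
    have e3 := fourierMul_comp hm2 ((memLp_top_const (1 : ℂ)).sub (hm1.const_mul (M : ℂ)))
      (by
        have : MemLp (fun ξ : Space d => (freeSymbol (l - M) ξ : ℂ)
          * (1 - (M : ℂ) * (freeSymbol l ξ : ℂ))) ∞ volume := by rw [e2]; exact hm1
        exact this)
    rw [e]
    refine Eq.trans e3 ?_
    change fourierMul (fun ξ : Space d => (freeSymbol (l - M) ξ : ℂ)
        * (1 - (M : ℂ) * (freeSymbol l ξ : ℂ))) = _
    rw [e2]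
    rfl
  nth_rewrite 1 [← h1]
  rw [mul_assoc, mul_neg_geom_series _ hn, mul_one]

theorem Dominated.schrodingerResolvent (hV : MemLp (fun x => (V x : ℂ)) ∞ volume)
    (hM : 0 ≤ M) (hVM : ∀ᵐ x, ‖(V x : ℂ)‖ ≤ M) (hl : M < l) :
    Dominated (schrodingerResolvent V l) (DensityOfStates.freeResolvent d (l - M)) := by
  have hl0 : 0 < l := hM.trans_lt hl
  have hR := Dominated.freeResolvent (d := d) hl0
  have hn := norm_neg_mulOp_mul_freeResolvent_lt hV hM hVM hl
  rw [← freeResolvent_mul_geom_series hM hl, DensityOfStates.schrodingerResolvent]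
  have hn2 : ‖(M : ℂ) • DensityOfStates.freeResolvent d l‖ < 1 := by
    rw [norm_smul, Complex.norm_real, Real.norm_eq_abs, abs_of_nonneg hM]
    calc M * ‖DensityOfStates.freeResolvent d l‖ ≤ M * l⁻¹ :=
          mul_le_mul_of_nonneg_left (norm_freeResolvent_le hl0) hM
      _ < 1 := by rw [← div_eq_mul_inv, div_lt_one hl0]; exact hl
  refine hR.comp ?_
  refine Dominated.of_tendsto (fun n => ?_)
    (summable_geometric_of_norm_lt_one hn).hasSum.tendsto_sum_nat
    (summable_geometric_of_norm_lt_one hn2).hasSum.tendsto_sum_nat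
  refine Dominated.sum _ fun k => ?_
  refine Dominated.pow ?_ k
  have h1 := ((Dominated.mulOp hV hVM).comp hR).smul (c := -1) (r := 1) (by simp)
  convert! h1 using 1
  · simp
  · simp

end Resolvent

section Semigroup

variable {d : ℕ}

/-! ### The Schrödinger semigroup -/

/-- Quantitative form of `(1 + x/n)⁻ⁿ → e⁻ˣ` along even `n`, uniform in `x ≥ 0`. -/
theorem abs_inv_one_add_div_pow_sub_exp_le {x : ℝ} (hx : 0 ≤ x) {m : ℕ} (hm : 0 < m) :
    |((1 + x / (2 * m : ℕ))⁻¹) ^ (2 * m) - Real.exp (-x)| ≤ 2 / m := by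
  have hm' : (0 : ℝ) < m := Nat.cast_pos.2 hm
  set y : ℝ := x / (2 * m : ℕ) with hy
  have hy0 : 0 ≤ y := by positivity
  have hxy : x = (2 * m : ℕ) * y := by
    rw [hy]; push_cast; field_simp
  have h1 : 0 < 1 + y := by linarith
  have hp : 0 < (1 + y) ^ (2 * m) := by positivity
  have hexp : Real.exp (-x) = Real.exp (-y) ^ (2 * m) := by
    rw [← Real.exp_nat_mul, hxy]; congr 1; ring
  have hle : Real.exp (-x) * (1 + y) ^ (2 * m) ≤ 1 := by
    rw [hexp, ← mul_pow]
    refine pow_le_one₀ (by positivity) ?_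
    have := Real.add_one_le_exp y
    have h2 : Real.exp (-y) * Real.exp y = 1 := by rw [← Real.exp_add]; simp
    nlinarith [Real.exp_pos (-y)]
  have hge : 1 - (2 * m : ℕ) * y ^ 2 ≤ Real.exp (-x) * (1 + y) ^ (2 * m) := by
    rw [hexp, ← mul_pow]
    have h3 : 1 - y ^ 2 ≤ Real.exp (-y) * (1 + y) := by
      have := Real.add_one_le_exp (-y)
      nlinarith
    have h4 := one_add_mul_le_pow (a := Real.exp (-y) * (1 + y) - 1)
      (by have : 0 ≤ Real.exp (-y) * (1 + y) := by positivity
          linarith) (2 * m)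
    rw [add_sub_cancel] at h4
    refine le_trans ?_ h4
    have : (0 : ℝ) ≤ (2 * m : ℕ) := by positivity
    nlinarith
  -- The error is at most `2 m y² / (1 + y)^{2m}`. The even exponent lets the denominator, as the
  -- square of a Bernoulli bound, absorb `y²` uniformly in `x`.
  have hsq : (m * y) ^ 2 ≤ (1 + y) ^ (2 * m) := by
    rw [mul_comm 2 m, pow_mul]
    refine pow_le_pow_left₀ (by positivity) ?_ 2
    have := one_add_mul_le_pow (a := y) (by linarith) m
    linarith
  have e : ((1 + y)⁻¹) ^ (2 * m) - Real.exp (-x)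
      = (1 - Real.exp (-x) * (1 + y) ^ (2 * m)) / (1 + y) ^ (2 * m) := by
    rw [inv_pow]; field_simp
  rw [e, abs_of_nonneg (div_nonneg (by linarith) hp.le), div_le_div_iff₀ hp hm']
  have h5 : (1 - Real.exp (-x) * (1 + y) ^ (2 * m)) * m ≤ (2 * m : ℕ) * y ^ 2 * m :=
    mul_le_mul_of_nonneg_right (by linarith) hm'.le
  push_cast at h5
  nlinarith

/-- The function with `heatFun l t (1 / (x + l)) = e^{-tx}`, continuous on `ℝ`. -/
def heatFun (l t r : ℝ) : ℝ := Real.exp (t * l) * expNegInvGlue (r / t)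

theorem continuous_heatFun (l t : ℝ) : Continuous (heatFun l t) := by
  unfold heatFun
  have : Continuous expNegInvGlue := (expNegInvGlue.contDiff (n := 0)).continuous
  fun_prop

theorem expNegInvGlue_of_pos {r t : ℝ} (hr : 0 < r) (ht : 0 < t) :
    expNegInvGlue (r / t) = Real.exp (-(t * r⁻¹)) := by
  rw [expNegInvGlue, if_neg (not_le.2 (div_pos hr ht)), inv_div, div_eq_mul_inv]

theorem heatFun_half_mul_self (l : ℝ) {t : ℝ} (ht : 0 < t) (r : ℝ) :
    heatFun l (t / 2) r * heatFun l (t / 2) r = heatFun l t r := by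
  unfold heatFun
  rcases le_or_gt r 0 with hr | hr
  · rw [expNegInvGlue.zero_of_nonpos (div_nonpos_of_nonpos_of_nonneg hr (by positivity)),
      expNegInvGlue.zero_of_nonpos (div_nonpos_of_nonpos_of_nonneg hr ht.le)]
    simp
  · rw [expNegInvGlue_of_pos hr (half_pos ht), expNegInvGlue_of_pos hr ht,
      ← Real.exp_add, ← Real.exp_add, ← Real.exp_add]
    congr 1
    ring

/-! ### The semigroup and its exponential formula for an operator with nonnegative resolvent -/

section Abstract

variable {E : Type*} [NormedAddCommGroup E] [InnerProductSpace ℂ E] [CompleteSpace E]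
  {A : E →ₗ.[ℂ] E} {R : E →L[ℂ] E} {l t : ℝ}

/-- The operator `e^{-tA}` in terms of the resolvent `R = (A + l)⁻¹`. -/
def heatOfResolvent (R : E →L[ℂ] E) (l t : ℝ) : E →L[ℂ] E := cfc (heatFun l t) R

theorem isBorelCalculus_exp (hR : 0 ≤ R) (h : IsResolventAt A (-l : ℂ) R) (ht : 0 < t) :
    IsBorelCalculus A (fun x => (Real.exp (-t * x) : ℂ)) (heatOfResolvent R l t) := by
  refine isBorelCalculus_cfc hR h (continuous_heatFun l t) ?_ ?_
  · fun_prop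
  · intro r hr
    rw [heatFun, expNegInvGlue_of_pos hr ht, ← Real.exp_add]
    congr 2
    ring

theorem isSelfAdjoint_heatOfResolvent : IsSelfAdjoint (heatOfResolvent R l t) :=
  cfc_predicate _ _

theorem heatOfResolvent_half_mul (ht : 0 < t) :
    heatOfResolvent R l (t / 2) * heatOfResolvent R l (t / 2) = heatOfResolvent R l t := by
  have hc := (continuous_heatFun l (t / 2)).continuousOn (s := spectrum ℝ R)
  have h := cfc_mul _ _ R hc hc
  simp only [heatFun_half_mul_self _ ht] at h
  exact h.symm

theorem heatOfResolvent_eq_smul :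
    heatOfResolvent R l t = (Real.exp (t * l) : ℂ) • heatOfResolvent R 0 t := by
  have h := cfc_const_mul (Real.exp (t * l)) (heatFun 0 t) R (continuous_heatFun 0 t).continuousOn
  rw [heatOfResolvent, heatOfResolvent]
  have e : (fun r => Real.exp (t * l) * heatFun 0 t r) = heatFun l t := by
    ext r
    simp [heatFun]
  rw [e] at h
  exact h

theorem IsResolventAt.eq_cfc (hR : 0 ≤ R) (h : IsResolventAt A (-l : ℂ) R) {k : ℝ} (hk : 0 < k)
    {R' : E →L[ℂ] E} (h' : IsResolventAt A (-((l + k : ℝ) : ℂ)) R') :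
    R' = cfc (fun r : ℝ => r * (1 + k * r)⁻¹) R := by
  have hsa : IsSelfAdjoint R := IsSelfAdjoint.of_nonneg hR
  have hspec : ∀ r ∈ spectrum ℝ R, 0 < 1 + k * r := fun r hr => by
    have := spectrum_nonneg_of_nonneg hR hr
    positivity
  have hc1 : ContinuousOn (fun r : ℝ => (1 + k * r)⁻¹) (spectrum ℝ R) :=
    ContinuousOn.inv₀ (by fun_prop) fun r hr => (hspec r hr).ne'
  have hc2 : ContinuousOn (fun r : ℝ => 1 + k * r) (spectrum ℝ R) := by fun_prop
  have e : (1 : E →L[ℂ] E) + ((-l : ℂ) - (-((l + k : ℝ) : ℂ))) • R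
      = cfc (fun r : ℝ => 1 + k * r) R := by
    rw [cfc_add (a := R) (fun _ : ℝ => (1 : ℝ)) (fun r => k * r), cfc_const_one ℝ R,
      cfc_const_mul_id k R]
    congr 1
    have : ((-l : ℂ) - (-((l + k : ℝ) : ℂ))) = (k : ℂ) := by push_cast; ring
    rw [this]
    rfl
  have h1 : cfc (fun r : ℝ => 1 + k * r) R * cfc (fun r : ℝ => (1 + k * r)⁻¹) R = 1 := by
    rw [← cfc_mul _ _ R hc2 hc1, ← cfc_const_one ℝ R]
    exact cfc_congr fun r hr => mul_inv_cancel₀ (hspec r hr).ne'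
  have h2 : cfc (fun r : ℝ => (1 + k * r)⁻¹) R * cfc (fun r : ℝ => 1 + k * r) R = 1 := by
    rw [← cfc_mul _ _ R hc1 hc2, ← cfc_const_one ℝ R]
    exact cfc_congr fun r hr => inv_mul_cancel₀ (hspec r hr).ne'
  have h3 := h.shift (z' := -((l + k : ℝ) : ℂ)) (by rw [e]; exact h1) (by rw [e]; exact h2)
  rw [h'.eq h3, cfc_mul (fun r : ℝ => r) _ R (by fun_prop) hc1, cfc_id' ℝ R]

/-- In the variable `r = 1/(x + l)` the function of `R` given by `k R'` is `(1 + t (x + l) /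
(2(m+1)))⁻¹`. The scalar exponential limit, uniform on `[0, ∞)`, therefore gives a bound in operator
norm. -/
theorem norm_resolvent_pow_sub_le (hR : 0 ≤ R) (h : IsResolventAt A (-l : ℂ) R) (ht : 0 < t)
    {k : ℝ} {m : ℕ} (hk : k = (2 * (m + 1) : ℕ) / t)
    {R' : E →L[ℂ] E} (h' : IsResolventAt A (-((l + k : ℝ) : ℂ)) R') :
    ‖((k : ℂ) • R') ^ (2 * (m + 1)) - heatOfResolvent R 0 t‖ ≤ 2 / ((m : ℝ) + 1) := by
  have hsa : IsSelfAdjoint R := IsSelfAdjoint.of_nonneg hR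
  have hk0 : 0 < k := by rw [hk]; positivity
  rw [h.eq_cfc hR hk0 h', heatOfResolvent]
  have hspec : ∀ r ∈ spectrum ℝ R, 0 ≤ r := fun r hr => spectrum_nonneg_of_nonneg hR hr
  have hc1 : ContinuousOn (fun r : ℝ => r * (1 + k * r)⁻¹) (spectrum ℝ R) :=
    continuousOn_id.mul (ContinuousOn.inv₀ (by fun_prop) fun r hr => by
      have := hspec r hr
      positivity)
  have hc2 : ContinuousOn (fun r : ℝ => k * (r * (1 + k * r)⁻¹)) (spectrum ℝ R) :=
    continuousOn_const.mul hc1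
  have e : ((k : ℂ) • cfc (fun r : ℝ => r * (1 + k * r)⁻¹) R) ^ (2 * (m + 1))
      = cfc (fun r : ℝ => (k * (r * (1 + k * r)⁻¹)) ^ (2 * (m + 1))) R := by
    rw [cfc_pow _ _ R hc2, cfc_const_mul k _ R hc1]
    rfl
  rw [e, ← cfc_sub (a := R) (fun r : ℝ => (k * (r * (1 + k * r)⁻¹)) ^ (2 * (m + 1))) _ (hc2.pow _)
     (continuous_heatFun 0 t).continuousOn]
  refine norm_cfc_le (by positivity) fun r hr => ?_
  -- The point `r = 0` stands for infinite energy, where both functions vanish.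
  rcases (hspec r hr).eq_or_lt with h0 | h0
  · rw [← h0]
    simp [heatFun, expNegInvGlue]
    positivity
  · have h1 := abs_inv_one_add_div_pow_sub_exp_le (x := t * r⁻¹) (by positivity) (Nat.succ_pos m)
    rw [heatFun, mul_zero, Real.exp_zero, one_mul, expNegInvGlue_of_pos h0 ht, Real.norm_eq_abs]
    have h2 : k * (r * (1 + k * r)⁻¹) = (1 + t * r⁻¹ / (2 * (m + 1) : ℕ))⁻¹ := by
      rw [hk]
      field_simp
      ring
    rw [h2]
    simpa using h1

end Abstract

/-! ### Domination of the Schrödinger semigroup by the free one -/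

variable {V : Space d → ℝ} {M l : ℝ}

theorem heatOp_eq_heatOfResolvent (hV : MemLp (fun x => (V x : ℂ)) ∞ volume)
    (hM : 0 ≤ M) (hVM : ∀ᵐ x, ‖(V x : ℂ)‖ ≤ M) (hl : M < l) {t : ℝ} (ht : 0 < t) :
    heatOp V t = heatOfResolvent (schrodingerResolvent V l) l t :=
  (isBorelCalculus_exp (schrodingerResolvent_nonneg hV hM hVM hl)
    (isResolventAt_schrodinger hV hM hVM hl) ht).borelCalculus_eq

theorem isBorelCalculus_heatOp (hV : MemLp (fun x => (V x : ℂ)) ∞ volume)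
    (hM : 0 ≤ M) (hVM : ∀ᵐ x, ‖(V x : ℂ)‖ ≤ M) {t : ℝ} (ht : 0 < t) :
    IsBorelCalculus (schrodinger V) (fun x => (Real.exp (-t * x) : ℂ)) (heatOp V t) := by
  rw [heatOp_eq_heatOfResolvent hV hM hVM (lt_add_one M) ht]
  exact isBorelCalculus_exp (schrodingerResolvent_nonneg hV hM hVM (lt_add_one M))
    (isResolventAt_schrodinger hV hM hVM (lt_add_one M)) ht

theorem isSelfAdjoint_heatOp (hV : MemLp (fun x => (V x : ℂ)) ∞ volume)
    (hM : 0 ≤ M) (hVM : ∀ᵐ x, ‖(V x : ℂ)‖ ≤ M) {t : ℝ} (ht : 0 < t) :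
    IsSelfAdjoint (heatOp V t) := by
  rw [heatOp_eq_heatOfResolvent hV hM hVM (lt_add_one M) ht]
  exact isSelfAdjoint_heatOfResolvent

theorem heatOp_half_comp (hV : MemLp (fun x => (V x : ℂ)) ∞ volume)
    (hM : 0 ≤ M) (hVM : ∀ᵐ x, ‖(V x : ℂ)‖ ≤ M) {t : ℝ} (ht : 0 < t) :
    heatOp V (t / 2) ∘L heatOp V (t / 2) = heatOp V t := by
  rw [heatOp_eq_heatOfResolvent hV hM hVM (lt_add_one M) ht,
    heatOp_eq_heatOfResolvent hV hM hVM (lt_add_one M) (half_pos ht)]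
  exact heatOfResolvent_half_mul ht

theorem tendsto_resolvent_pow (hV : MemLp (fun x => (V x : ℂ)) ∞ volume)
    (hM : 0 ≤ M) (hVM : ∀ᵐ x, ‖(V x : ℂ)‖ ≤ M) (hl : M < l) {t : ℝ} (ht : 0 < t) :
    Tendsto (fun m : ℕ => ((((2 * (m + 1) : ℕ) / t : ℝ) : ℂ)
      • schrodingerResolvent V (l + (2 * (m + 1) : ℕ) / t)) ^ (2 * (m + 1))) atTop
      (𝓝 (heatOfResolvent (schrodingerResolvent V l) 0 t)) := by
  rw [tendsto_iff_norm_sub_tendsto_zero]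
  refine squeeze_zero (fun n => norm_nonneg _) (g := fun m : ℕ => 2 / ((m : ℝ) + 1))
    (fun m => ?_) ?_
  · have hk : (0 : ℝ) < (2 * (m + 1) : ℕ) / t := by positivity
    exact norm_resolvent_pow_sub_le (schrodingerResolvent_nonneg hV hM hVM hl)
      (isResolventAt_schrodinger hV hM hVM hl) ht rfl
      (isResolventAt_schrodinger hV hM hVM (hl.trans (lt_add_of_pos_right _ hk)))
  · have := (tendsto_one_div_add_atTop_nhds_zero_nat (𝕜 := ℝ)).const_mul 2
    rw [mul_zero] at this
    exact this.congr fun n => by ring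

theorem tendsto_freeResolvent_pow {μ t : ℝ} (hμ : 0 < μ) (ht : 0 < t) :
    Tendsto (fun m : ℕ => ((((2 * (m + 1) : ℕ) / t : ℝ) : ℂ)
      • freeResolvent d (μ + (2 * (m + 1) : ℕ) / t)) ^ (2 * (m + 1))) atTop
      (𝓝 ((Real.exp (-(t * μ)) : ℂ) • fourierMul fun ξ => (heatSymbol t ξ : ℂ))) := by
  have hms := memLp_heatSymbol (d := d) ht
  rw [← fourierMul_smul _ hms]
  have e : ∀ m : ℕ, ((((2 * (m + 1) : ℕ) / t : ℝ) : ℂ)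
      • freeResolvent d (μ + (2 * (m + 1) : ℕ) / t)) ^ (2 * (m + 1))
      = fourierMul fun ξ : Space d => ((((2 * (m + 1) : ℕ) / t : ℝ) : ℂ)
        * (freeSymbol (μ + (2 * (m + 1) : ℕ) / t) ξ : ℂ)) ^ (2 * (m + 1)) := fun m => by
    have hp : 0 < μ + (2 * (m + 1) : ℕ) / t := by positivity
    rw [freeResolvent, ← fourierMul_smul _ (memLp_freeSymbol hp)]
    refine fourierMul_pow (continuous_const.mul
      (Complex.continuous_ofReal.comp (continuous_freeSymbol hp)))
      (C := (2 * (m + 1) : ℕ) / t * (μ + (2 * (m + 1) : ℕ) / t)⁻¹) (fun ξ => ?_) _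
    rw [Pi.mul_apply, Function.comp_apply, ← Complex.ofReal_mul, Complex.norm_real,
      Real.norm_eq_abs, abs_of_nonneg (mul_nonneg (by positivity) (freeSymbol_pos hp ξ).le)]
    exact mul_le_mul_of_nonneg_left (freeSymbol_le hp ξ) (by positivity)
  simp only [e]
  have hb : ∀ (m : ℕ) (ξ : Space d), (((2 * (m + 1) : ℕ) / t : ℝ)
        * (freeSymbol (μ + (2 * (m + 1) : ℕ) / t) ξ))
        = (1 + t * (symbol ξ + μ) / (2 * (m + 1) : ℕ))⁻¹ := fun m ξ => by
    have := symbol_nonneg ξ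
    have h1 : symbol ξ + (μ + (2 * (m + 1) : ℕ) / t) ≠ 0 := by positivity
    have h2 : 1 + t * (symbol ξ + μ) / (2 * (m + 1) : ℕ) ≠ 0 := by positivity
    have h3 : (((2 * (m + 1) : ℕ)) : ℝ) ≠ 0 := by positivity
    unfold freeSymbol
    rw [← div_eq_mul_inv, div_eq_iff h1, eq_comm, inv_mul_eq_iff_eq_mul₀ h2]
    field_simp
    ring
  refine tendsto_fourierMul (c := fun m : ℕ => 2 / ((m : ℝ) + 1)) (fun m => ?_)
    (hms.const_mul _) ?_ fun m ξ => ?_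
  · have hp : 0 < μ + (2 * (m + 1) : ℕ) / t := by positivity
    refine memLp_top_of_continuous_bounded (((continuous_const.mul
      (Complex.continuous_ofReal.comp (continuous_freeSymbol hp))).pow _).aestronglyMeasurable)
      (C := 1) fun ξ => ?_
    rw [← Complex.ofReal_mul, hb, ← Complex.ofReal_pow, Complex.norm_real,
      Real.norm_eq_abs]
    have := symbol_nonneg ξ
    rw [abs_of_nonneg (by positivity)]
    refine pow_le_one₀ (by positivity) (inv_le_one_of_one_le₀ ?_)
    have : 0 ≤ t * (symbol ξ + μ) / (2 * (m + 1) : ℕ) := by positivity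
    linarith
  · have := (tendsto_one_div_add_atTop_nhds_zero_nat (𝕜 := ℝ)).const_mul 2
    rw [mul_zero] at this
    exact this.congr fun n => by ring
  · have := symbol_nonneg ξ
    have h1 := abs_inv_one_add_div_pow_sub_exp_le (x := t * (symbol ξ + μ)) (by positivity)
      (Nat.succ_pos m)
    rw [← Complex.ofReal_mul, hb, ← Complex.ofReal_pow, ← Complex.ofReal_mul,
      ← Complex.ofReal_sub, Complex.norm_real, Real.norm_eq_abs]
    have h2 : Real.exp (-(t * μ)) * heatSymbol t ξ = Real.exp (-(t * (symbol ξ + μ))) := by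
      rw [heatSymbol, ← Real.exp_add]; congr 1; ring
    rw [h2]
    simpa using h1

/-- Apply the exponential formula to `H + M + 1` and to `-Δ + 1`. At each stage the resolvent of the
first is dominated by that of the second, so `e^{-t(H+M+1)}` is dominated by `e^{-t} e^{tΔ}`;
multiplying by `e^{t(M+1)}` leaves the factor `e^{tM}`. -/
theorem Dominated.heatOp (hV : MemLp (fun x => (V x : ℂ)) ∞ volume)
    (hM : 0 ≤ M) (hVM : ∀ᵐ x, ‖(V x : ℂ)‖ ≤ M) {t : ℝ} (ht : 0 < t) :
    Dominated (heatOp V t)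
      ((Real.exp (t * M) : ℂ) • fourierMul fun ξ : Space d => (heatSymbol t ξ : ℂ)) := by
  have hl : M < M + 1 := lt_add_one M
  have h1 : Dominated (heatOfResolvent (DensityOfStates.schrodingerResolvent V (M + 1)) 0 t)
      ((Real.exp (-(t * 1)) : ℂ) • fourierMul fun ξ : Space d => (heatSymbol t ξ : ℂ)) := by
    refine Dominated.of_tendsto (fun m => ?_) (tendsto_resolvent_pow hV hM hVM hl ht)
      (tendsto_freeResolvent_pow one_pos ht)
    refine Dominated.pow (Dominated.smul ?_ ?_) _
    · have h2 := Dominated.schrodingerResolvent hV hM hVM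
        (l := M + 1 + (2 * (m + 1) : ℕ) / t) (by
          have : (0 : ℝ) < (2 * (m + 1) : ℕ) / t := by positivity
          linarith)
      have e : M + 1 + ((2 * (m + 1) : ℕ) : ℝ) / t - M = 1 + (2 * (m + 1) : ℕ) / t := by ring
      rwa [e] at h2
    · rw [Complex.norm_real, Real.norm_eq_abs, abs_of_nonneg (by positivity)]
  have h4 := h1.smul (c := (Real.exp (t * (M + 1)) : ℂ)) (r := Real.exp (t * (M + 1)))
    (by rw [Complex.norm_real, Real.norm_eq_abs, Real.abs_exp])
  rw [← heatOfResolvent_eq_smul, ← heatOp_eq_heatOfResolvent hV hM hVM hl ht, smul_smul,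
    ← Complex.ofReal_mul, ← Real.exp_add] at h4
  have e : t * (M + 1) + -(t * 1) = t * M := by ring
  rwa [e] at h4

end Semigroup

section Weighted

variable {d : ℕ}

/-! ### Weighted estimates for the Schrödinger semigroup -/

theorem one_le_bracket (x : Space d) : 1 ≤ bracket x := by
  rw [bracket, Real.one_le_sqrt]
  nlinarith [sq_nonneg ‖x‖]

theorem bracket_pos (x : Space d) : 0 < bracket x := one_pos.trans_le (one_le_bracket x)

theorem continuous_bracket : Continuous (bracket : Space d → ℝ) := by
  unfold bracket; fun_prop

theorem continuous_bracket_rpow (p : ℝ) : Continuous fun x : Space d => bracket x ^ p :=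
  continuous_bracket.rpow_const fun x => Or.inl (bracket_pos x).ne'

theorem bracket_rpow_pos (p : ℝ) (x : Space d) : 0 < bracket x ^ p :=
  Real.rpow_pos_of_pos (bracket_pos x) _

theorem bracket_rpow_neg_le_one {p : ℝ} (hp : 0 ≤ p) (x : Space d) : bracket x ^ (-p) ≤ 1 :=
  Real.rpow_le_one_of_one_le_of_nonpos (one_le_bracket x) (by linarith)

theorem memLp_bracket_rpow {p : ℝ} (hp : 0 ≤ p) :
    MemLp (fun x : Space d => ((bracket x ^ (-p) : ℝ) : ℂ)) ∞ volume := by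
  refine memLp_top_of_continuous_bounded
    (Complex.continuous_ofReal.comp (continuous_bracket_rpow _)).aestronglyMeasurable (C := 1)
    fun x => ?_
  rw [Complex.norm_real, Real.norm_eq_abs, abs_of_pos (bracket_rpow_pos _ x)]
  exact bracket_rpow_neg_le_one hp x

/-- Peetre's inequality. -/
theorem bracket_le_mul (x y : Space d) :
    bracket x ≤ Real.sqrt 2 * (bracket y * bracket (x - y)) := by
  unfold bracket
  rw [← Real.sqrt_mul (by positivity), ← Real.sqrt_mul (by positivity)]
  refine Real.sqrt_le_sqrt ?_
  have h : ‖x‖ ≤ ‖y‖ + ‖x - y‖ := by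
    have := norm_add_le y (x - y)
    simpa using this
  have h1 : ‖x‖ ^ 2 ≤ (‖y‖ + ‖x - y‖) ^ 2 := by gcongr
  nlinarith [sq_nonneg (‖y‖ - ‖x - y‖), sq_nonneg (‖y‖ * ‖x - y‖)]

theorem bracket_rpow_neg_le_mul {p : ℝ} (hp : 0 ≤ p) (x y : Space d) :
    bracket y ^ (-p) ≤ Real.sqrt 2 ^ p * (bracket x ^ (-p) * bracket (x - y) ^ p) := by
  have h := Real.rpow_le_rpow (bracket_pos x).le (bracket_le_mul x y) hp
  rw [Real.mul_rpow (by positivity) (mul_pos (bracket_pos _) (bracket_pos _)).le,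
    Real.mul_rpow (bracket_pos _).le (bracket_pos _).le] at h
  rw [Real.rpow_neg (bracket_pos _).le, Real.rpow_neg (bracket_pos _).le,
    inv_le_iff_one_le_mul₀ (bracket_rpow_pos p y)]
  have hx := bracket_rpow_pos p x
  have : bracket x ^ p * (bracket x ^ p)⁻¹ = 1 := mul_inv_cancel₀ hx.ne'
  have h2 := mul_le_mul_of_nonneg_right h (inv_pos.2 hx).le
  rw [this] at h2
  linarith

theorem exists_bracket_rpow_le_exp {p : ℝ} (hp : 0 ≤ p) {a : ℝ} (ha : 0 < a) :
    ∃ C : ℝ, 0 ≤ C ∧ ∀ y : Space d, bracket y ^ p ≤ C * Real.exp (a * ‖y‖ ^ 2) := by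
  -- Chosen so that `b * p ≤ a`; the denominator `p + 1` also covers `p = 0`.
  set b : ℝ := a / (p + 1) with hb
  have hp1 : 0 < p + 1 := by linarith
  have hb0 : 0 < b := by positivity
  refine ⟨(b⁻¹) ^ p * Real.exp a, by positivity, fun y => ?_⟩
  have h0 : bracket y ≤ b⁻¹ * Real.exp (b * (1 + ‖y‖ ^ 2)) := by
    have h1 : bracket y ≤ 1 + ‖y‖ ^ 2 := by
      unfold bracket
      rw [Real.sqrt_le_left (by positivity)]
      nlinarith [sq_nonneg ‖y‖, sq_nonneg (‖y‖ ^ 2)]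
    have h2 := Real.add_one_le_exp (b * (1 + ‖y‖ ^ 2))
    rw [inv_mul_eq_div, le_div_iff₀ hb0]
    nlinarith
  refine (Real.rpow_le_rpow (bracket_pos y).le h0 hp).trans ?_
  rw [Real.mul_rpow (by positivity) (by positivity), mul_assoc]
  refine mul_le_mul_of_nonneg_left ?_ (by positivity)
  rw [← Real.exp_mul, ← Real.exp_add]
  refine Real.exp_le_exp.2 ?_
  have h3 : b * p ≤ a := by
    rw [hb, div_mul_eq_mul_div, div_le_iff₀ hp1]
    nlinarith
  have h4 : 0 ≤ 1 + ‖y‖ ^ 2 := by positivity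
  nlinarith

/-- Moving the weight from `y` to `x` costs `⟨x - y⟩^p` by Peetre's inequality. Half of the Gaussian
exponent absorbs this factor, and the other half is the Gaussian at time `2t`. -/
theorem exists_gaussKernel_mul_bracket_le {t : ℝ} (ht : 0 < t) {p : ℝ} (hp : 0 ≤ p) :
    ∃ C : ℝ, 0 ≤ C ∧ ∀ x y : Space d, gaussKernel d t (x - y) * bracket y ^ (-p)
      ≤ C * bracket x ^ (-p) * gaussKernel d (2 * t) (x - y) := by
  obtain ⟨C, hC0, hC⟩ := exists_bracket_rpow_le_exp (d := d) hp
    (a := (4 * (2 * t))⁻¹) (by positivity)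
  set c1 := (4 * Real.pi * t)⁻¹ ^ ((d : ℝ) / 2) with hc1
  set c2 := (4 * Real.pi * (2 * t))⁻¹ ^ ((d : ℝ) / 2) with hc2
  have hc1' : 0 < c1 := by positivity
  have hc2' : 0 < c2 := by positivity
  refine ⟨c1 / c2 * Real.sqrt 2 ^ p * C, by positivity, fun x y => ?_⟩
  have h1 := bracket_rpow_neg_le_mul hp x y
  have h2 := hC (x - y)
  have hG := gaussKernel_nonneg ht (x - y)
  have hx := bracket_rpow_pos (-p) x
  have h3 : bracket y ^ (-p) ≤ Real.sqrt 2 ^ p * (bracket x ^ (-p)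
      * (C * Real.exp ((4 * (2 * t))⁻¹ * ‖x - y‖ ^ 2))) :=
    h1.trans (by gcongr)
  refine (mul_le_mul_of_nonneg_left h3 hG).trans (le_of_eq ?_)
  have h4 : Real.exp (-(4 * t)⁻¹ * ‖x - y‖ ^ 2) * Real.exp ((4 * (2 * t))⁻¹ * ‖x - y‖ ^ 2)
      = Real.exp (-(4 * (2 * t))⁻¹ * ‖x - y‖ ^ 2) := by
    rw [← Real.exp_add]
    congr 1
    field_simp
    ring
  rw [gaussKernel, gaussKernel, ← hc1, ← hc2, ← h4]
  field_simp

theorem norm_gaussVec {t : ℝ} (ht : 0 < t) (x : Space d) :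
    ‖gaussVec ht x‖ = ‖gaussVec (d := d) ht 0‖ := by
  rw [gaussVec, gaussVec, Lp.norm_toLp, Lp.norm_toLp]
  congr 1
  have h0 := memLp_gaussKernel (d := d) ht 0
  have h := eLpNorm_comp_measurePreserving h0.aestronglyMeasurable (p := 2)
    (measurePreserving_sub_right volume x)
  rw [← h]
  congr 1
  ext y
  simp

variable {V : Space d → ℝ} {M : ℝ}

/-- Domination reduces to the free heat operator, the weight passes through the Gaussian, and
Cauchy-Schwarz concludes because the norm of `gaussVec` is independent of `x`. -/
theorem exists_norm_heatOp_mulOp_le (hV : MemLp (fun x => (V x : ℂ)) ∞ volume)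
    (hM : 0 ≤ M) (hVM : ∀ᵐ x, ‖(V x : ℂ)‖ ≤ M) {t : ℝ} (ht : 0 < t) {p : ℝ} (hp : 0 ≤ p) :
    ∃ C : ℝ, 0 ≤ C ∧ ∀ f : L2 d, ∀ᵐ x,
      ‖heatOp V t (mulOp (fun x => ((bracket x ^ (-p) : ℝ) : ℂ)) f) x‖
        ≤ C * bracket x ^ (-p) * ‖f‖ := by
  obtain ⟨C, hC0, hC⟩ := exists_gaussKernel_mul_bracket_le (d := d) ht hp
  have ht2 : 0 < 2 * t := by positivity
  refine ⟨Real.exp (t * M) * (C * ‖gaussVec (d := d) ht2 0‖), by positivity, fun f => ?_⟩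
  set u := mulOp (fun x => ((bracket x ^ (-p) : ℝ) : ℂ)) f with hu
  have hD := Dominated.heatOp hV hM hVM ht u (absL2 u) (le_absL2 u)
  filter_upwards [hD, fourierMul_heatSymbol_apply ht (absL2 u),
    Lp.coeFn_smul (Real.exp (t * M) : ℂ)
      (fourierMul (fun ξ : Space d => (heatSymbol t ξ : ℂ)) (absL2 u))] with x h1 h2 h3
  rw [smul_apply, h3, Pi.smul_apply, h2, smul_eq_mul] at h1
  have h4 := ((Complex.le_def.1 h1).1).trans (Complex.re_le_norm _)
  rw [Complex.ofReal_re, norm_mul, Complex.norm_real, Real.norm_eq_abs, Real.abs_exp] at h4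
  refine h4.trans ?_
  rw [mul_assoc, mul_assoc]
  refine mul_le_mul_of_nonneg_left ?_ (Real.exp_pos _).le
  rw [inner_gaussVec]
  have i2 := (integrable_gaussKernel_mul ht2 x (absL2 f)).norm
  have h5 : ‖∫ y, (gaussKernel d t (x - y) : ℂ) * (absL2 u) y‖
      ≤ ∫ y, C * bracket x ^ (-p) * ‖(gaussKernel d (2 * t) (x - y) : ℂ) * (absL2 f) y‖ := by
    refine norm_integral_le_of_norm_le (i2.const_mul _) ?_
    filter_upwards [absL2_ae u, absL2_ae f, coeFn_mulOp (memLp_bracket_rpow hp) f] with y e1 e2 e3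
    rw [e1, e2, hu, e3]
    simp only [norm_mul, Complex.norm_real, norm_norm]
    rw [Real.norm_eq_abs, Real.norm_eq_abs, Real.norm_eq_abs,
      abs_of_nonneg (gaussKernel_nonneg ht _), abs_of_nonneg (gaussKernel_nonneg ht2 _),
      abs_of_pos (bracket_rpow_pos _ _), ← mul_assoc, ← mul_assoc]
    exact mul_le_mul_of_nonneg_right (hC x y) (norm_nonneg _)
  refine h5.trans ?_
  rw [integral_const_mul]
  have h6 : ∫ y, ‖(gaussKernel d (2 * t) (x - y) : ℂ) * (absL2 f) y‖
      = ‖⟪gaussVec ht2 x, absL2 f⟫_ℂ‖ := by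
    rw [inner_gaussVec]
    have e : ∫ y, (gaussKernel d (2 * t) (x - y) : ℂ) * (absL2 f) y
        = ((∫ y, ‖(gaussKernel d (2 * t) (x - y) : ℂ) * (absL2 f) y‖ : ℝ) : ℂ) := by
      refine Eq.trans (integral_congr_ae ?_) integral_complex_ofReal
      filter_upwards [absL2_ae f] with y e2
      rw [e2, norm_mul, Complex.norm_real, Complex.norm_real, norm_norm, Real.norm_eq_abs,
        abs_of_nonneg (gaussKernel_nonneg ht2 _), Complex.ofReal_mul]
    rw [e, Complex.norm_real, Real.norm_eq_abs, abs_of_nonneg]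
    exact integral_nonneg fun y => norm_nonneg _
  rw [h6]
  have h7 := norm_inner_le_norm (𝕜 := ℂ) (gaussVec ht2 x) (absL2 f)
  rw [norm_gaussVec, norm_absL2] at h7
  have h8 := mul_le_mul_of_nonneg_left h7 (mul_nonneg hC0 (bracket_rpow_pos (-p) x).le)
  refine h8.trans (le_of_eq ?_)
  ring

theorem exists_isKernelVec_heatOp (hV : MemLp (fun x => (V x : ℂ)) ∞ volume)
    (hM : 0 ≤ M) (hVM : ∀ᵐ x, ‖(V x : ℂ)‖ ≤ M) {t : ℝ} (ht : 0 < t) :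
    ∃ κ : Space d → L2 d, ∃ C : ℝ, 0 ≤ C ∧ IsKernelVec (heatOp V t) κ ∧ ∀ᵐ x, ‖κ x‖ ≤ C := by
  -- With exponent `0` the weight is trivial and the estimate is the plain `L₂` to `L_∞` bound.
  obtain ⟨C, hC0, hC⟩ := exists_norm_heatOp_mulOp_le hV hM hVM ht le_rfl
  have h1 : mulOp (fun x : Space d => ((bracket x ^ (-(0 : ℝ)) : ℝ) : ℂ)) = 1 := by
    refine mulOp_ext (memLp_bracket_rpow le_rfl) fun u => ae_of_all _ fun x => ?_
    simp
  rw [h1] at hC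
  obtain ⟨κ, hκ, hκC⟩ := exists_isKernelVec (h := fun _ => C) (fun _ => hC0) (A := heatOp V t)
    (fun f => by
      filter_upwards [hC f] with x hx
      simpa using hx)
  exact ⟨κ, C, hC0, hκ, hκC⟩

theorem IsKernelVec.exists_norm_mulOp_le (hV : MemLp (fun x => (V x : ℂ)) ∞ volume)
    (hM : 0 ≤ M) (hVM : ∀ᵐ x, ‖(V x : ℂ)‖ ≤ M) {t : ℝ} (ht : 0 < t) {p : ℝ} (hp : 0 ≤ p)
    {κ : Space d → L2 d} (hκ : IsKernelVec (heatOp V t) κ) :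
    ∃ C : ℝ, 0 ≤ C ∧ (∀ f : L2 d, ∀ᵐ x,
      ‖heatOp V t (mulOp (fun x => ((bracket x ^ (-p) : ℝ) : ℂ)) f) x‖
        ≤ C * bracket x ^ (-p) * ‖f‖) ∧
      ∀ᵐ x, ‖mulOp (fun x => ((bracket x ^ (-p) : ℝ) : ℂ)) (κ x)‖ ≤ C * bracket x ^ (-p) := by
  obtain ⟨C, hC0, hC⟩ := exists_norm_heatOp_mulOp_le hV hM hVM ht hp
  refine ⟨C, hC0, hC, ?_⟩
  have h := (hκ.comp_mulOp (memLp_bracket_rpow hp)).ae_norm_le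
    (h := fun x => C * bracket x ^ (-p)) (fun x => mul_nonneg hC0 (bracket_rpow_pos _ x).le) hC
  simpa using h

end Weighted

section Laplace

/-! ### Laplace transforms of measures on the line -/

theorem hasDerivAt_exp_neg_mul (s u : ℝ) :
    HasDerivAt (fun u : ℝ => Real.exp (-s * u)) (-(s * Real.exp (-s * u))) u := by
  have h := ((hasDerivAt_id u).const_mul (-s)).exp
  simp only [id, mul_one] at h
  convert! h using 1
  ring

theorem tendsto_exp_neg_mul_atTop {s : ℝ} (hs : 0 < s) :
    Tendsto (fun u : ℝ => Real.exp (-s * u)) atTop (𝓝 0) := by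
  refine Real.tendsto_exp_atBot.comp ?_
  exact tendsto_id.const_mul_atTop_of_neg (by linarith)

theorem lintegral_Ioi_exp_neg_mul {s : ℝ} (hs : 0 < s) (t : ℝ) :
    ∫⁻ u in Set.Ioi t, ENNReal.ofReal (s * Real.exp (-s * u))
      = ENNReal.ofReal (Real.exp (-s * t)) := by
  have hd : ∀ u ∈ Set.Ici t, HasDerivAt (fun u : ℝ => -Real.exp (-s * u))
      (s * Real.exp (-s * u)) u := fun u _ => by
    have h := (hasDerivAt_exp_neg_mul s u).neg
    rw [neg_neg] at h
    exact h
  have hpos : ∀ u ∈ Set.Ioi t, 0 ≤ s * Real.exp (-s * u) := fun u _ => by positivity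
  have hlim : Tendsto (fun u : ℝ => -Real.exp (-s * u)) atTop (𝓝 0) := by
    simpa using (tendsto_exp_neg_mul_atTop hs).neg
  rw [← ofReal_integral_eq_lintegral_ofReal
    (integrableOn_Ioi_deriv_of_nonneg' hd hpos hlim)
    (ae_of_all _ fun u => by positivity),
    integral_Ioi_of_hasDerivAt_of_nonneg' hd hpos hlim]
  simp

/-- The Laplace transform of a measure in terms of its distribution function. -/
theorem lintegral_exp_neg_mul (m : Measure ℝ) [SFinite m] {s : ℝ} (hs : 0 < s) :
    ∫⁻ t, ENNReal.ofReal (Real.exp (-s * t)) ∂m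
      = ∫⁻ u, ENNReal.ofReal (s * Real.exp (-s * u)) * m (Set.Iio u) := by
  have hmeas : MeasurableSet {p : ℝ × ℝ | p.1 < p.2} :=
    measurableSet_lt measurable_fst measurable_snd
  have h1 : ∀ t, ENNReal.ofReal (Real.exp (-s * t))
      = ∫⁻ u, {p : ℝ × ℝ | p.1 < p.2}.indicator
          (fun p => ENNReal.ofReal (s * Real.exp (-s * p.2))) (t, u) := fun t => by
    rw [← lintegral_Ioi_exp_neg_mul hs, ← lintegral_indicator measurableSet_Ioi]
    rfl
  simp only [h1]
  rw [lintegral_lintegral_swap]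
  · refine lintegral_congr fun u => ?_
    have : ∀ t, {p : ℝ × ℝ | p.1 < p.2}.indicator
          (fun p => ENNReal.ofReal (s * Real.exp (-s * p.2))) (t, u)
        = (Set.Iio u).indicator (fun _ => ENNReal.ofReal (s * Real.exp (-s * u))) t := fun t => rfl
    simp only [this]
    rw [lintegral_indicator measurableSet_Iio, lintegral_const, Measure.restrict_apply_univ]
  · refine Measurable.aemeasurable ?_
    refine Measurable.indicator ?_ hmeas
    fun_prop

/-- Markov's inequality for `e^{-st}`, which is at least `e^{-su}` on `(-∞, u)`. -/
theorem measure_Iio_le (m : Measure ℝ) {s : ℝ} (hs : 0 < s) (u : ℝ) :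
    m (Set.Iio u) ≤ ENNReal.ofReal (Real.exp (s * u))
      * ∫⁻ t, ENNReal.ofReal (Real.exp (-s * t)) ∂m := by
  rw [← lintegral_const_mul _ (by fun_prop), ← lintegral_indicator_one measurableSet_Iio]
  refine lintegral_mono fun t => ?_
  by_cases ht : t < u
  · rw [Set.indicator_of_mem (Set.mem_Iio.2 ht), Pi.one_apply, ← ENNReal.ofReal_mul (by positivity),
      ← Real.exp_add, ENNReal.one_le_ofReal, Real.one_le_exp_iff]
    nlinarith
  · rw [Set.indicator_of_notMem (by simpa using ht)]
    exact zero_le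

theorem measurable_measure_Iio (m : Measure ℝ) : Measurable fun u => m (Set.Iio u) :=
  Monotone.measurable fun _ _ h => measure_mono (Set.Iio_subset_Iio h)

/-- By `lintegral_exp_neg_mul` each Laplace transform is an integral of the distribution function `σ
i (-∞, u)` against `s e^{-su} du`. The common lower bound `a` makes these functions converge
pointwise, and the Laplace bound at `s / 2` dominates them, so no mass escapes to `+∞`. -/
theorem tendsto_lintegral_exp_neg_mul {ι : Type*} {F : Filter ι} [F.IsCountablyGenerated]
    [F.NeBot] {σ : ι → Measure ℝ} [∀ i, SFinite (σ i)] {ν : Measure ℝ} {a : ℝ}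
    (ha : ∀ i, σ i (Set.Iio a) = 0)
    (hC : ∀ s : ℝ, 0 < s → ∃ C : ℝ, 0 ≤ C ∧ ∀ᶠ i in F,
      ∫⁻ t, ENNReal.ofReal (Real.exp (-s * t)) ∂(σ i) ≤ ENNReal.ofReal C)
    (hν : ∀ u v : ℝ, ν (Set.Ico u v) ≠ ∞ ∧
      Tendsto (fun i => (σ i (Set.Ico u v)).toReal) F (𝓝 (ν (Set.Ico u v)).toReal))
    {s : ℝ} (hs : 0 < s) :
    Integrable (fun t => Real.exp (-s * t)) ν ∧
    Tendsto (fun i => ∫⁻ t, ENNReal.ofReal (Real.exp (-s * t)) ∂(σ i)) F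
      (𝓝 (∫⁻ t, ENNReal.ofReal (Real.exp (-s * t)) ∂ν)) := by
  -- Only bounded intervals can be compared with `ν`, so the half-line is exhausted by `[a - n, a)`.
  have hνa : ν (Set.Iio a) = 0 := by
    have h1 : Set.Iio a = ⋃ n : ℕ, Set.Ico (a - n) a := by
      ext x
      simp only [Set.mem_Iio, Set.mem_iUnion, Set.mem_Ico]
      constructor
      · intro hx
        obtain ⟨n, hn⟩ := exists_nat_ge (a - x)
        exact ⟨n, by linarith, hx⟩
      · rintro ⟨n, -, hx⟩
        exact hx
    rw [h1, measure_iUnion_null_iff]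
    intro n
    obtain ⟨h2, h3⟩ := hν (a - n) a
    have h4 : ∀ i, (σ i (Set.Ico (a - n) a)).toReal = 0 := fun i => by
      rw [measure_mono_null Set.Ico_subset_Iio_self (ha i), ENNReal.toReal_zero]
    simp only [h4] at h3
    have h5 := tendsto_nhds_unique h3 tendsto_const_nhds
    exact (ENNReal.toReal_eq_zero_iff _).1 h5 |>.resolve_right h2
  have hIco : ∀ (m : Measure ℝ), m (Set.Iio a) = 0 → ∀ u, m (Set.Iio u) = m (Set.Ico a u) := by
    intro m hm u
    refine le_antisymm ?_ (measure_mono Set.Ico_subset_Iio_self)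
    have h1 : Set.Iio u ⊆ Set.Iio a ∪ Set.Ico a u := fun x hx => by
      rcases lt_or_ge x a with h | h
      · exact Or.inl h
      · exact Or.inr ⟨h, hx⟩
    refine (measure_mono h1).trans ((measure_union_le _ _).trans ?_)
    rw [hm, zero_add]
  have hloc : IsLocallyFiniteMeasure ν := ⟨fun x => ⟨Set.Ico (x - 1) (x + 1),
    Ico_mem_nhds (by linarith) (by linarith), lt_top_iff_ne_top.2 (hν _ _).1⟩⟩
  -- Markov's inequality at `s / 2` gives growth at most `e^{su/2}`, and `e^{-su}` beats this with
  -- `e^{-su/2}` to spare.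
  obtain ⟨C, hC0, hCs⟩ := hC (s / 2) (half_pos hs)
  have hbound : ∀ᶠ i in F, ∀ u, σ i (Set.Iio u)
      ≤ ENNReal.ofReal (Real.exp (s / 2 * u)) * ENNReal.ofReal C := by
    filter_upwards [hCs] with i hi u
    exact (measure_Iio_le (σ i) (half_pos hs) u).trans (by gcongr)
  have hfin : ∀ᶠ i in F, ∀ u, σ i (Set.Iio u) ≠ ∞ := by
    filter_upwards [hbound] with i hi u
    exact ne_top_of_le_ne_top (ENNReal.mul_ne_top ENNReal.ofReal_ne_top ENNReal.ofReal_ne_top)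
      (hi u)
  have hpt : ∀ u, Tendsto (fun i => σ i (Set.Iio u)) F (𝓝 (ν (Set.Iio u))) := by
    intro u
    have h1 := (hν a u).2
    rw [← hIco ν hνa] at h1
    have h2 : ∀ i, (σ i (Set.Ico a u)).toReal = (σ i (Set.Iio u)).toReal := fun i => by
      rw [hIco _ (ha i)]
    simp only [h2] at h1
    have h3 := ENNReal.tendsto_ofReal h1
    rw [ENNReal.ofReal_toReal (by rw [hIco ν hνa]; exact (hν a u).1)] at h3
    refine h3.congr' ?_
    filter_upwards [hfin] with i hi using ENNReal.ofReal_toReal (hi u)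
  have hlim : Tendsto (fun i => ∫⁻ t, ENNReal.ofReal (Real.exp (-s * t)) ∂(σ i)) F
      (𝓝 (∫⁻ t, ENNReal.ofReal (Real.exp (-s * t)) ∂ν)) := by
    simp only [lintegral_exp_neg_mul _ hs]
    refine tendsto_lintegral_filter_of_dominated_convergence
      ((Set.Ioi a).indicator fun u =>
        ENNReal.ofReal (2 * C) * ENNReal.ofReal (s / 2 * Real.exp (-(s / 2) * u))) ?_ ?_ ?_ ?_
    · refine Eventually.of_forall fun i => ?_
      exact Measurable.mul (by fun_prop) (measurable_measure_Iio _)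
    · filter_upwards [hbound] with i hi
      refine ae_of_all _ fun u => ?_
      by_cases hu : a < u
      · rw [Set.indicator_of_mem (Set.mem_Ioi.2 hu)]
        refine (mul_le_mul_right (hi u) _).trans (le_of_eq ?_)
        rw [← ENNReal.ofReal_mul (by positivity), ← ENNReal.ofReal_mul (by positivity),
          ← ENNReal.ofReal_mul (by positivity)]
        have : Real.exp (-s * u) * Real.exp (s / 2 * u) = Real.exp (-(s / 2) * u) := by
          rw [← Real.exp_add]; congr 1; ring
        rw [← this]
        congr 1
        ring
      · have : σ i (Set.Iio u) = 0 :=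
          measure_mono_null (Set.Iio_subset_Iio (not_lt.1 hu)) (ha i)
        rw [this, mul_zero]
        exact zero_le
    · rw [lintegral_indicator measurableSet_Ioi, lintegral_const_mul _ (by fun_prop),
        lintegral_Ioi_exp_neg_mul (half_pos hs)]
      exact ENNReal.mul_ne_top ENNReal.ofReal_ne_top ENNReal.ofReal_ne_top
    · refine ae_of_all _ fun u => ?_
      exact ENNReal.Tendsto.const_mul (hpt u) (Or.inr ENNReal.ofReal_ne_top)
  refine ⟨⟨by fun_prop, ?_⟩, hlim⟩
  obtain ⟨C', -, hC'⟩ := hC s hs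
  rw [hasFiniteIntegral_iff_ofReal (ae_of_all _ fun t => (Real.exp_pos _).le)]
  exact (le_of_tendsto hlim hC').trans_lt ENNReal.ofReal_lt_top

/-- An Abelian theorem: if `m (-∞, u) ~ L e^u` then `∫ e^{-rt} dm(t) ~ L / (r - 1)`. -/
theorem tendsto_sub_one_mul_laplace (m : Measure ℝ) [SFinite m] {C L : ℝ}
    (h0 : m (Set.Iio 0) = 0) (hC : ∀ u, m (Set.Iio u) ≤ ENNReal.ofReal (C * Real.exp u))
    (hL : Tendsto (fun u => (m (Set.Iio u)).toReal * Real.exp (-u)) atTop (𝓝 L)) :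
    (∀ r : ℝ, 1 < r → ∫⁻ t, ENNReal.ofReal (Real.exp (-r * t)) ∂m ≠ ∞) ∧
    Tendsto (fun r : ℝ => (r - 1) * (∫⁻ t, ENNReal.ofReal (Real.exp (-r * t)) ∂m).toReal)
      (𝓝[>] 1) (𝓝 L) := by
  have hC0 : 0 ≤ max C 0 := le_max_right _ _
  set n : ℝ → ℝ := fun u => (m (Set.Iio u)).toReal * Real.exp (-u) with hn
  have hn_meas : Measurable n :=
    (measurable_measure_Iio m).ennreal_toReal.mul (by fun_prop)
  have hn0 : ∀ u, 0 ≤ n u := fun u => by positivity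
  have hfin : ∀ u, m (Set.Iio u) ≠ ∞ := fun u => ne_top_of_le_ne_top ENNReal.ofReal_ne_top (hC u)
  have hnC : ∀ u, n u ≤ max C 0 := fun u => by
    have h1 : m (Set.Iio u) ≤ ENNReal.ofReal (max C 0 * Real.exp u) :=
      (hC u).trans (ENNReal.ofReal_le_ofReal
        (mul_le_mul_of_nonneg_right (le_max_left _ _) (Real.exp_pos _).le))
    have h2 := ENNReal.toReal_le_of_le_ofReal (by positivity) h1
    calc n u ≤ max C 0 * Real.exp u * Real.exp (-u) :=
          mul_le_mul_of_nonneg_right h2 (Real.exp_pos _).le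
      _ = max C 0 := by rw [mul_assoc, ← Real.exp_add]; simp
  have hint : ∀ r : ℝ, 1 < r → Integrable (fun u => r * (Real.exp (-(r - 1) * u) * n u))
      (volume.restrict (Set.Ioi 0)) := fun r hr => by
    have h1 : IntegrableOn (fun u : ℝ => Real.exp (-(r - 1) * u)) (Set.Ioi 0) :=
      exp_neg_integrableOn_Ioi 0 (by linarith)
    refine (Integrable.mul_bdd (c := max C 0) h1 hn_meas.aestronglyMeasurable
      (ae_of_all _ fun u => ?_)).const_mul r
    rw [Real.norm_eq_abs, abs_of_nonneg (hn0 u)]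
    exact hnC u
  have hkey : ∀ r : ℝ, 1 < r → ∫⁻ t, ENNReal.ofReal (Real.exp (-r * t)) ∂m
      = ENNReal.ofReal (∫ u in Set.Ioi 0, r * (Real.exp (-(r - 1) * u) * n u)) := fun r hr => by
    have hr0 : 0 < r := by linarith
    rw [lintegral_exp_neg_mul m hr0, ofReal_integral_eq_lintegral_ofReal (hint r hr)
      (ae_of_all _ fun u => mul_nonneg hr0.le (mul_nonneg (Real.exp_pos _).le (hn0 u))),
      ← lintegral_indicator measurableSet_Ioi]
    refine lintegral_congr fun u => ?_
    by_cases hu : 0 < u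
    · rw [Set.indicator_of_mem (Set.mem_Ioi.2 hu)]
      conv_lhs => rw [← ENNReal.ofReal_toReal (hfin u)]
      rw [← ENNReal.ofReal_mul (by positivity)]
      congr 1
      have : Real.exp (-r * u) = Real.exp (-(r - 1) * u) * Real.exp (-u) := by
        rw [← Real.exp_add]; congr 1; ring
      rw [this, hn]
      ring
    · rw [Set.indicator_of_notMem (by simpa using hu),
        measure_mono_null (Set.Iio_subset_Iio (not_lt.1 hu)) h0, mul_zero]
  -- Substituting `y = (r - 1) u` removes the singularity: as `r ↓ 1` the argument `y / (r - 1)`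
  -- tends to infinity, where the bounded function `n` tends to `L`.
  have hscale : ∀ r : ℝ, 1 < r →
      (r - 1) * (∫⁻ t, ENNReal.ofReal (Real.exp (-r * t)) ∂m).toReal
      = r * ∫ y in Set.Ioi 0, Real.exp (-y) * n ((r - 1)⁻¹ * y) := fun r hr => by
    have hr1 : 0 < r - 1 := by linarith
    rw [hkey r hr, ENNReal.toReal_ofReal (integral_nonneg fun u =>
      mul_nonneg (by linarith) (mul_nonneg (Real.exp_pos _).le (hn0 u))), integral_const_mul]
    have h1 := integral_comp_mul_left_Ioi (fun y => Real.exp (-y) * n ((r - 1)⁻¹ * y)) 0 hr1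
    rw [mul_zero] at h1
    have h2 : ∀ x, (r - 1)⁻¹ * ((r - 1) * x) = x := fun x => by field_simp
    simp only [h2, smul_eq_mul] at h1
    simp only [neg_mul]
    rw [h1]
    field_simp
  refine ⟨fun r hr => by rw [hkey r hr]; exact ENNReal.ofReal_ne_top, ?_⟩
  have hlim : Tendsto (fun r : ℝ => r * ∫ y in Set.Ioi 0, Real.exp (-y) * n ((r - 1)⁻¹ * y))
      (𝓝[>] 1) (𝓝 (1 * ∫ y in Set.Ioi (0 : ℝ), Real.exp (-y) * L)) := by
    refine (tendsto_id.mono_left nhdsWithin_le_nhds).mul ?_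
    refine tendsto_integral_filter_of_dominated_convergence
      (fun y => Real.exp (-y) * max C 0) ?_ ?_ ?_ ?_
    · refine Eventually.of_forall fun r => Measurable.aestronglyMeasurable ?_
      exact (by fun_prop : Measurable fun y : ℝ => Real.exp (-y)).mul
        (hn_meas.comp (by fun_prop))
    · refine Eventually.of_forall fun r => ae_of_all _ fun y => ?_
      rw [norm_mul, Real.norm_eq_abs, Real.norm_eq_abs, Real.abs_exp, abs_of_nonneg (hn0 _)]
      exact mul_le_mul_of_nonneg_left (hnC _) (Real.exp_pos _).le
    · have := exp_neg_integrableOn_Ioi 0 (b := 1) one_pos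
      simp only [neg_mul, one_mul] at this
      exact Integrable.mul_const this _
    · refine (ae_restrict_iff' measurableSet_Ioi).2 (ae_of_all _ fun y hy => ?_)
      refine Tendsto.const_mul _ (hL.comp ?_)
      refine Tendsto.atTop_mul_const hy ?_
      refine tendsto_inv_nhdsGT_zero.comp ?_
      refine tendsto_nhdsWithin_iff.2 ⟨?_, ?_⟩
      · have : Tendsto (fun r : ℝ => r - 1) (𝓝 1) (𝓝 (1 - 1)) :=
          tendsto_id.sub_const 1
        rw [sub_self] at this
        exact this.mono_left nhdsWithin_le_nhds
      · filter_upwards [self_mem_nhdsWithin] with r hr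
        exact sub_pos.2 (Set.mem_Ioi.1 hr)
  have hone : ∫ y in Set.Ioi (0 : ℝ), Real.exp (-y) * L = L := by
    rw [integral_mul_const, integral_exp_neg_Ioi_zero, one_mul]
  rw [hone, one_mul] at hlim
  refine hlim.congr' ?_
  filter_upwards [self_mem_nhdsWithin] with r hr using (hscale r hr).symm

end Laplace

section DensityOfStatesLimit

variable {d : ℕ}

/-! ### Local traces and the density of states -/

theorem measurable_indicator_ball (r : ℝ) :
    Measurable ((Metric.ball (0 : Space d) r).indicator (1 : Space d → ℝ)) :=
  measurable_one.indicator Metric.isOpen_ball.measurableSet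

theorem memLp_indicator_ball (r : ℝ) :
    MemLp (fun x => (((Metric.ball (0 : Space d) r).indicator (1 : Space d → ℝ) x : ℝ) : ℂ))
      ∞ volume := by
  refine memLp_top_of_continuous_bounded
    (Complex.measurable_ofReal.comp (measurable_indicator_ball r)).aestronglyMeasurable
    (C := 1) fun x => ?_
  rw [Complex.norm_real]
  by_cases hx : x ∈ Metric.ball (0 : Space d) r <;> simp [Set.indicator, hx]

theorem ballCutoff_eq (r : ℝ) : ballCutoff d r
    = mulOp fun x => (((Metric.ball (0 : Space d) r).indicator (1 : Space d → ℝ) x : ℝ) : ℂ) := by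
  rw [ballCutoff]
  congr 1
  ext x
  by_cases hx : x ∈ Metric.ball (0 : Space d) r <;> simp [Set.indicator, hx]

theorem inner_ballCutoff (r : ℝ) (u v : L2 d) :
    ⟪u, ballCutoff d r v⟫_ℂ = ⟪ballCutoff d r u, v⟫_ℂ := by
  have h := ContinuousLinearMap.adjoint_inner_left (ballCutoff d r) v u
  rw [ballCutoff_eq, adjoint_mulOp_ofReal (memLp_indicator_ball r)] at h
  rw [ballCutoff_eq]
  exact h.symm

/-- The measure `∑ ⟨χ eᵢ, E(·) χ eᵢ⟩`, `χ` the indicator function of `B(0, r)`. -/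
def localMeasure (V : Space d → ℝ) {ι : Type*} (b : HilbertBasis ι ℂ (L2 d)) (r : ℝ) :
    Measure ℝ :=
  Measure.sum fun i => spectralMeasure (schrodinger V) (ballCutoff d r (b i))

variable {V : Space d → ℝ} {M : ℝ}

theorem isFiniteMeasure_spectralMeasure (hV : MemLp (fun x => (V x : ℂ)) ∞ volume)
    (hM : 0 ≤ M) (hVM : ∀ᵐ x, ‖(V x : ℂ)‖ ≤ M) (ψ : L2 d) :
    IsFiniteMeasure (spectralMeasure (schrodinger V) ψ) := by
  have hR := schrodingerResolvent_nonneg hV hM hVM (lt_add_one M)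
  have hres := isResolventAt_schrodinger hV hM hVM (lt_add_one M)
  rw [spectralMeasure_eq_map hR hres]
  have := isFiniteMeasure_resolventMeasure (IsSelfAdjoint.of_nonneg hR) hres ψ
  infer_instance

theorem spectralMeasure_Iio_eq_zero (hV : MemLp (fun x => (V x : ℂ)) ∞ volume)
    (hM : 0 ≤ M) (hVM : ∀ᵐ x, ‖(V x : ℂ)‖ ≤ M) (ψ : L2 d) :
    spectralMeasure (schrodinger V) ψ (Set.Iio (-(M + 1))) = 0 := by
  have hR := schrodingerResolvent_nonneg hV hM hVM (lt_add_one M)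
  have hres := isResolventAt_schrodinger hV hM hVM (lt_add_one M)
  rw [spectralMeasure_eq_map hR hres,
    Measure.map_apply (measurable_inv_sub _) measurableSet_Iio]
  refine measure_mono_null ?_ (ae_iff.1 (ae_resolventMeasure_pos hR hres ψ))
  intro r hr hr'
  have h1 : 0 < r⁻¹ := inv_pos.2 hr'.1
  have h2 : r⁻¹ - (M + 1) < -(M + 1) := hr
  linarith

theorem lintegral_exp_spectralMeasure (hV : MemLp (fun x => (V x : ℂ)) ∞ volume)
    (hM : 0 ≤ M) (hVM : ∀ᵐ x, ‖(V x : ℂ)‖ ≤ M) {t : ℝ} (ht : 0 < t) (ψ : L2 d) :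
    ∫⁻ x, ENNReal.ofReal (Real.exp (-t * x)) ∂(spectralMeasure (schrodinger V) ψ)
      = ‖heatOp V (t / 2) ψ‖ₑ ^ 2 := by
  obtain ⟨h1, h2⟩ := isBorelCalculus_heatOp hV hM hVM ht ψ
  have hS := isSelfAdjoint_heatOp hV hM hVM (half_pos ht)
  rw [← heatOp_half_comp hV hM hVM ht] at h2
  have h3 : ⟪ψ, (heatOp V (t / 2) ∘L heatOp V (t / 2)) ψ⟫_ℂ
      = ((‖heatOp V (t / 2) ψ‖ ^ 2 : ℝ) : ℂ) := by
    have h := (ContinuousLinearMap.isSelfAdjoint_iff_isSymmetric.1 hS) ψ (heatOp V (t / 2) ψ)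
    refine Eq.trans h.symm ?_
    refine (inner_self_eq_norm_sq_to_K (𝕜 := ℂ) _).trans ?_
    norm_cast
  have h4 : Integrable (fun x => Real.exp (-t * x)) (spectralMeasure (schrodinger V) ψ) := by
    exact h1.re.congr (ae_of_all _ fun x => Complex.ofReal_re _)
  rw [h3] at h2
  have h5 : ‖heatOp V (t / 2) ψ‖ ^ 2
      = ∫ x, Real.exp (-t * x) ∂(spectralMeasure (schrodinger V) ψ) := by
    apply Complex.ofReal_injective
    rw [h2]
    exact integral_complex_ofReal
  rw [← ofReal_integral_eq_lintegral_ofReal h4 (ae_of_all _ fun x => (Real.exp_pos _).le), ← h5,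
    ENNReal.ofReal_pow (norm_nonneg _), ofReal_norm]

/-- By `⟪ψ, e^{-tH} ψ⟫ = ‖e^{-tH/2} ψ‖²` the left side is the squared Hilbert-Schmidt norm of
`e^{-tH/2} M_χ`, which the kernel vector computes. -/
theorem lintegral_exp_localMeasure (hV : MemLp (fun x => (V x : ℂ)) ∞ volume)
    (hM : 0 ≤ M) (hVM : ∀ᵐ x, ‖(V x : ℂ)‖ ≤ M) {t : ℝ} (ht : 0 < t)
    {κ : Space d → L2 d} (hκ : IsKernelVec (heatOp V (t / 2)) κ)
    {ι : Type*} (b : HilbertBasis ι ℂ (L2 d)) (r : ℝ) :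
    ∫⁻ x, ENNReal.ofReal (Real.exp (-t * x)) ∂(localMeasure V b r)
      = ∫⁻ x in Metric.ball (0 : Space d) r, ENNReal.ofReal (‖κ x‖ ^ 2) := by
  have hS := isSelfAdjoint_heatOp hV hM hVM (half_pos ht)
  rw [localMeasure, lintegral_sum_measure]
  simp only [lintegral_exp_spectralMeasure hV hM hVM ht, ballCutoff_eq]
  rw [hκ.tsum_enorm_sq_comp_mulOp hS (memLp_indicator_ball r) b,
    ← lintegral_indicator Metric.isOpen_ball.measurableSet]
  refine lintegral_congr fun x => ?_
  by_cases hx : x ∈ Metric.ball (0 : Space d) r <;> simp [Set.indicator, hx]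

theorem trace_ballCutoff_spectralProjection (hV : MemLp (fun x => (V x : ℂ)) ∞ volume)
    (hM : 0 ≤ M) (hVM : ∀ᵐ x, ‖(V x : ℂ)‖ ≤ M)
    {b : HilbertBasis (exists_hilbertBasis ℂ (L2 d)).choose ℂ (L2 d)}
    (hb : ∀ T : L2 d →L[ℂ] L2 d, trace T = ∑' i, ⟪b i, T (b i)⟫_ℂ) (r : ℝ) {I : Set ℝ}
    (hI : MeasurableSet I) :
    trace (ballCutoff d r ∘L spectralProjection V I ∘L ballCutoff d r)
      = ((localMeasure V b r I).toReal : ℂ) := by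
  have hR := schrodingerResolvent_nonneg hV hM hVM (lt_add_one M)
  have hres := isResolventAt_schrodinger hV hM hVM (lt_add_one M)
  have hfin := isFiniteMeasure_spectralMeasure hV hM hVM
  rw [hb, localMeasure, Measure.sum_apply _ hI, ENNReal.tsum_toReal_eq fun i => measure_ne_top _ _,
    Complex.ofReal_tsum]
  refine tsum_congr fun i => ?_
  rw [ContinuousLinearMap.comp_apply, ContinuousLinearMap.comp_apply, inner_ballCutoff]
  exact inner_borelCalculus_indicator hR hres hI _

theorem ballVol_pos {r : ℝ} (hr : 0 < r) : 0 < ballVol d r :=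
  ENNReal.toReal_pos (Metric.measure_ball_pos volume 0 hr).ne' measure_ball_lt_top.ne

theorem ballVol_eq (hd : 0 < d) {r : ℝ} (hr : 0 ≤ r) : ballVol d r = r ^ d * ballVol d 1 := by
  have : Nonempty (Fin d) := ⟨⟨0, hd⟩⟩
  rw [ballVol, Measure.addHaar_ball volume (0 : Space d) hr, ENNReal.toReal_mul, ballVol,
    ENNReal.toReal_ofReal (by positivity), finrank_euclideanSpace, Fintype.card_fin]

theorem setLIntegral_ball_le {κ : Space d → L2 d} {C : ℝ} (hC : ∀ᵐ x, ‖κ x‖ ≤ C) (r : ℝ) :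
    ∫⁻ x in Metric.ball (0 : Space d) r, ENNReal.ofReal (‖κ x‖ ^ 2)
      ≤ ENNReal.ofReal (C ^ 2 * ballVol d r) := by
  calc ∫⁻ x in Metric.ball (0 : Space d) r, ENNReal.ofReal (‖κ x‖ ^ 2)
      ≤ ∫⁻ x in Metric.ball (0 : Space d) r, ENNReal.ofReal (C ^ 2) := by
        refine lintegral_mono_ae (ae_restrict_of_ae ?_)
        filter_upwards [hC] with x hx
        exact ENNReal.ofReal_le_ofReal (pow_le_pow_left₀ (norm_nonneg _) hx 2)
    _ = ENNReal.ofReal (C ^ 2 * ballVol d r) := by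
        rw [lintegral_const, Measure.restrict_apply_univ, ENNReal.ofReal_mul (sq_nonneg _),
          ballVol, ENNReal.ofReal_toReal measure_ball_lt_top.ne]

/-- The Laplace convergence lemma applied to the normalized local measures. The sup bound on the
kernel vector gives a Laplace bound independent of the radius, for every positive time and not only
for `t`. -/
theorem tendsto_average_norm_sq (hV : MemLp (fun x => (V x : ℂ)) ∞ volume)
    (hM : 0 ≤ M) (hVM : ∀ᵐ x, ‖(V x : ℂ)‖ ≤ M) {ν : Measure ℝ} (hν : IsDensityOfStates V ν)
    {t : ℝ} (ht : 0 < t) {κ : Space d → L2 d} (hκ : IsKernelVec (heatOp V (t / 2)) κ) :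
    Integrable (fun x => Real.exp (-t * x)) ν ∧
    Tendsto (fun r : ℝ => (ballVol d r)⁻¹
      * (∫⁻ x in Metric.ball (0 : Space d) r, ENNReal.ofReal (‖κ x‖ ^ 2)).toReal) atTop
      (𝓝 (∫ x, Real.exp (-t * x) ∂ν)) := by
  obtain ⟨b, hb⟩ := exists_trace_basis (L2 d)
  have hcount := countable_of_hilbertBasis b
  have hfin := isFiniteMeasure_spectralMeasure hV hM hVM
  have hsf : ∀ r, SFinite (localMeasure V b r) := fun r => by
    unfold localMeasure; infer_instance
  have key := tendsto_lintegral_exp_neg_mul (F := (atTop : Filter ℝ))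
    (σ := fun r => ENNReal.ofReal ((ballVol d r)⁻¹) • localMeasure V b r) (ν := ν)
    (a := -(M + 1)) ?_ ?_ ?_ ht
  · obtain ⟨k1, k2⟩ := key
    refine ⟨k1, ?_⟩
    simp only [lintegral_smul_measure, smul_eq_mul,
      lintegral_exp_localMeasure hV hM hVM ht hκ b] at k2
    rw [← ofReal_integral_eq_lintegral_ofReal k1 (ae_of_all _ fun x => (Real.exp_pos _).le)] at k2
    have k3 := (ENNReal.tendsto_toReal ENNReal.ofReal_ne_top).comp k2
    rw [ENNReal.toReal_ofReal (integral_nonneg fun x => (Real.exp_pos _).le)] at k3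
    refine k3.congr fun r => ?_
    rw [Function.comp_apply, ENNReal.toReal_mul, ENNReal.toReal_ofReal]
    exact inv_nonneg.2 ENNReal.toReal_nonneg
  · intro r
    rw [Measure.smul_apply, localMeasure, Measure.sum_apply _ measurableSet_Iio]
    simp only [spectralMeasure_Iio_eq_zero hV hM hVM, tsum_zero, smul_zero]
  · intro s hs
    obtain ⟨η, C, hC0, hη, hηC⟩ := exists_isKernelVec_heatOp hV hM hVM (half_pos hs)
    refine ⟨C ^ 2, sq_nonneg _, ?_⟩
    filter_upwards [eventually_gt_atTop 0] with r hr
    rw [lintegral_smul_measure, smul_eq_mul, lintegral_exp_localMeasure hV hM hVM hs hη]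
    refine (mul_le_mul_right (setLIntegral_ball_le hηC r) _).trans (le_of_eq ?_)
    have := ballVol_pos (d := d) hr
    rw [← ENNReal.ofReal_mul (by positivity)]
    congr 1
    field_simp
  · intro u v
    obtain ⟨h1, h2⟩ := hν (Set.Ico u v) Set.ordConnected_Ico (Metric.isBounded_Ico u v)
    refine ⟨h1, ?_⟩
    simp only [trace_ballCutoff_spectralProjection hV hM hVM hb _ measurableSet_Ico] at h2
    have h3 := (Complex.continuous_re.tendsto _).comp h2
    refine h3.congr fun r => ?_
    rw [Function.comp_apply, ← Complex.ofReal_inv, ← Complex.ofReal_mul, Complex.ofReal_re,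
      Measure.smul_apply, smul_eq_mul, ENNReal.toReal_mul, ENNReal.toReal_ofReal]
    exact inv_nonneg.2 ENNReal.toReal_nonneg

/-! ### Weighted integrals -/

theorem integrable_bracket_rpow {r : ℝ} (hd : 0 < d) (hr : 1 < r) :
    Integrable fun x : Space d => bracket x ^ (-(d * r)) := by
  have hd' : (0 : ℝ) < d := Nat.cast_pos.2 hd
  have h := integrable_rpow_neg_one_add_norm_sq (E := Space d) (μ := volume) (r := d * r)
    (by rw [finrank_euclideanSpace, Fintype.card_fin]; nlinarith)
  refine h.congr (ae_of_all _ fun x => ?_)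
  simp only [bracket]
  rw [Real.sqrt_eq_rpow, ← Real.rpow_mul (by positivity)]
  congr 1
  ring

/-- In the variable `d log ⟨x⟩` the weight `⟨x⟩^{-dr}` becomes `e^{-rt}`, while the sublevel sets
remain balls, of volume asymptotic to `|B(0,1)| e^u`. -/
theorem setOf_log_bracket_lt (hd : 0 < d) (u : ℝ) :
    {x : Space d | d * Real.log (bracket x) < u}
      = Metric.ball 0 (Real.sqrt (Real.exp (u / d) ^ 2 - 1)) := by
  have hd' : (0 : ℝ) < d := Nat.cast_pos.2 hd
  ext x
  rw [Set.mem_ofPred_eq, mem_ball_zero_iff, Real.lt_sqrt (norm_nonneg _), ← lt_div_iff₀' hd',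
    Real.log_lt_iff_lt_exp (bracket_pos x), bracket, Real.sqrt_lt' (Real.exp_pos _)]
  constructor <;> intro h <;> linarith

/-- Push `‖κ‖² dx` forward under `d log ⟨x⟩`. The ball averages say that the distribution function
of the image is asymptotic to `L |B(0,1)| e^u`, and the Abelian theorem gives the behaviour of its
Laplace transform as `r ↓ 1`. -/
theorem tendsto_weighted_integral (hd : 0 < d) {κ : Space d → L2 d}
    (hκm : AEStronglyMeasurable κ volume) {C : ℝ} (hC : ∀ᵐ x, ‖κ x‖ ≤ C) {L : ℝ}
    (hL : Tendsto (fun r : ℝ => (ballVol d r)⁻¹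
      * (∫⁻ x in Metric.ball (0 : Space d) r, ENNReal.ofReal (‖κ x‖ ^ 2)).toReal) atTop (𝓝 L)) :
    Tendsto (fun r : ℝ => (ballVol d 1)⁻¹ * ((r - 1)
      * ∫ x : Space d, bracket x ^ (-(d * r)) * ‖κ x‖ ^ 2)) (𝓝[>] 1) (𝓝 L) := by
  have hd' : (0 : ℝ) < d := Nat.cast_pos.2 hd
  have hB := ballVol_pos (d := d) one_pos
  set τ : Space d → ℝ := fun x => d * Real.log (bracket x) with hτ
  have hτm : Measurable τ := by
    have := (continuous_bracket (d := d)).measurable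
    exact measurable_const.mul (Real.measurable_log.comp this)
  have hkm : AEMeasurable (fun x => ENNReal.ofReal (‖κ x‖ ^ 2)) (volume : Measure (Space d)) :=
    (hκm.norm.pow 2).aemeasurable.ennreal_ofReal
  set m : Measure ℝ := (volume.withDensity fun x => ENNReal.ofReal (‖κ x‖ ^ 2)).map τ with hm
  set ρ : ℝ → ℝ := fun u => Real.sqrt (Real.exp (u / d) ^ 2 - 1) with hρ
  have hmIio : ∀ u, m (Set.Iio u)
      = ∫⁻ x in Metric.ball (0 : Space d) (ρ u), ENNReal.ofReal (‖κ x‖ ^ 2) := fun u => by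
    rw [hm, Measure.map_apply hτm measurableSet_Iio,
      withDensity_apply _ (hτm measurableSet_Iio), ← setOf_log_bracket_lt hd]
    rfl
  have hρle : ∀ u, ρ u ≤ Real.exp (u / d) := fun u => by
    rw [hρ]
    refine (Real.sqrt_le_sqrt (sub_le_self _ zero_le_one)).trans (le_of_eq ?_)
    exact Real.sqrt_sq (Real.exp_pos _).le
  have hexp : ∀ u, Real.exp u = Real.exp (u / d) ^ d := fun u => by
    rw [← Real.exp_nat_mul]; congr 1; field_simp
  have hlap : ∀ r, ∫⁻ t, ENNReal.ofReal (Real.exp (-r * t)) ∂m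
      = ∫⁻ x, ENNReal.ofReal (bracket x ^ (-(d * r)) * ‖κ x‖ ^ 2) := fun r => by
    rw [hm, lintegral_map (by fun_prop) hτm, lintegral_withDensity_eq_lintegral_mul₀ hkm
      (by fun_prop)]
    refine lintegral_congr fun x => ?_
    rw [Pi.mul_apply, mul_comm, ← ENNReal.ofReal_mul (Real.exp_pos _).le,
      Real.rpow_def_of_pos (bracket_pos x)]
    congr 3
    rw [hτ]
    ring
  have hρtop : Tendsto ρ atTop atTop := by
    refine Real.tendsto_sqrt_atTop.comp ?_
    refine tendsto_atTop_add_const_right _ (-1) ?_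
    refine (tendsto_pow_atTop two_ne_zero).comp ?_
    exact Real.tendsto_exp_atTop.comp (tendsto_id.atTop_div_const hd')
  have hm0 : m (Set.Iio 0) = 0 := by
    rw [hmIio]
    have : ρ 0 = 0 := by simp [hρ]
    rw [this]
    simp
  have hmC : ∀ u, m (Set.Iio u) ≤ ENNReal.ofReal (C ^ 2 * ballVol d 1 * Real.exp u) := by
    intro u
    rw [hmIio]
    refine (setLIntegral_ball_le hC _).trans (ENNReal.ofReal_le_ofReal ?_)
    rw [ballVol_eq hd (Real.sqrt_nonneg _), mul_assoc]
    refine mul_le_mul_of_nonneg_left ?_ (sq_nonneg _)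
    rw [mul_comm]
    refine mul_le_mul_of_nonneg_left ?_ hB.le
    rw [hexp u]
    exact pow_le_pow_left₀ (Real.sqrt_nonneg _) (hρle u) d
  have hmL : Tendsto (fun u => (m (Set.Iio u)).toReal * Real.exp (-u)) atTop
      (𝓝 (L * ballVol d 1)) := by
    have h1 := hL.comp hρtop
    -- The ratio of the volume of `B(0, ρ u)` to `|B(0,1)| e^u` tends to `1`.
    have h2 : Tendsto (fun u : ℝ => (ρ u * Real.exp (-(u / d))) ^ d) atTop (𝓝 1) := by
      have h3 : ∀ u : ℝ, ρ u * Real.exp (-(u / d))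
          = Real.sqrt (1 - Real.exp (-(2 / d) * u)) := fun u => by
        have e1 : Real.exp (-(u / d)) = Real.sqrt (Real.exp (-(u / d)) ^ 2) :=
          (Real.sqrt_sq (Real.exp_pos _).le).symm
        rw [e1, hρ, ← Real.sqrt_mul' _ (sq_nonneg _)]
        congr 1
        have e2 : Real.exp (u / d) * Real.exp (-(u / d)) = 1 := by rw [← Real.exp_add]; simp
        have e3 : Real.exp (-(u / d)) ^ 2 = Real.exp (-(2 / d) * u) := by
          rw [← Real.exp_nat_mul]; congr 1; push_cast; ring
        rw [sub_mul, ← mul_pow, e2, e3, one_pow, one_mul]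
      simp only [h3]
      have h4 := tendsto_exp_neg_mul_atTop (s := 2 / (d : ℝ)) (by positivity)
      have h5 := ((tendsto_const_nhds (x := (1 : ℝ))).sub h4).sqrt.pow d
      simpa using h5
    have h3 := (h1.mul h2).mul_const (ballVol d 1)
    rw [mul_one] at h3
    refine h3.congr' ?_
    filter_upwards [eventually_gt_atTop 0] with u hu
    have hρ0 : 0 < ρ u := by
      refine Real.sqrt_pos.2 ?_
      have : 1 < Real.exp (u / d) := Real.one_lt_exp_iff.2 (by positivity)
      nlinarith
    rw [hmIio, Function.comp_apply, ballVol_eq hd hρ0.le, mul_pow, Real.exp_neg u, hexp u,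
      Real.exp_neg, inv_pow]
    field_simp
  have hlim := (tendsto_sub_one_mul_laplace m hm0 hmC hmL).2
  have h1 := hlim.const_mul (ballVol d 1)⁻¹
  have h2 : (ballVol d 1)⁻¹ * (L * ballVol d 1) = L := by field_simp
  rw [h2] at h1
  refine h1.congr fun r => ?_
  rw [hlap, integral_eq_lintegral_of_nonneg_ae
    (ae_of_all _ fun x => mul_nonneg (bracket_rpow_pos _ x).le (sq_nonneg _))
    ((continuous_bracket_rpow _).aestronglyMeasurable.mul (hκm.norm.pow 2))]

end DensityOfStatesLimit

end DensityOfStates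

end

/-! ### The trace formulas -/

theorem mainTheorem8 (d : ℕ) (hd : 2 ≤ d)
    (V : Space d → ℝ)
    (hV : MemLp V ∞ (volume : Measure (Space d)))
    (ν : Measure ℝ) (hν : IsDensityOfStates V ν)
    (s : ℝ) (hs : 0 < s) :
    Integrable (fun t : ℝ => Real.exp (-s * t)) ν ∧
    (∃ K : Space d → Space d → ℂ,
      IsIntegralKernel (heatOp V s) K) ∧
    (∀ K : Space d → Space d → ℂ,
      IsIntegralKernel (heatOp V s) K →
      (∀ᵐ x : Space d,
        Tendsto (kernelAverage K x) (𝓝[>] (0 : ℝ))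
          (𝓝 (kernelDiag K x))) ∧
      (∀ r : ℝ, 1 < r → Integrable fun x : Space d =>
        ((bracket x ^ (-(d * r)) : ℝ) : ℂ) * kernelDiag K x) ∧
      Tendsto (fun r : ℝ => (ballVol d 1 : ℂ)⁻¹ * (((r - 1 : ℝ) : ℂ) *
          ∫ x : Space d,
            ((bracket x ^ (-(d * r)) : ℝ) : ℂ) * kernelDiag K x))
        (𝓝[>] (1 : ℝ)) (𝓝 ((∫ t, Real.exp (-s * t) ∂ν : ℝ) : ℂ))) ∧
    (∀ r : ℝ, 1 < r → IsTraceClass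
      (heatOp V s ∘L
        mulOp fun x => ((bracket x ^ (-(d * r)) : ℝ) : ℂ))) ∧
    Tendsto (fun r : ℝ => (ballVol d 1 : ℂ)⁻¹ * (((r - 1 : ℝ) : ℂ) *
        trace (heatOp V s ∘L
          mulOp fun x => ((bracket x ^ (-(d * r)) : ℝ) : ℂ))))
      (𝓝[>] (1 : ℝ)) (𝓝 ((∫ t, Real.exp (-s * t) ∂ν : ℝ) : ℂ)) := by
  have hd0 : 0 < d := by omega
  set M : ℝ := (eLpNorm V ∞ volume).toReal with hM_def
  have hM : 0 ≤ M := ENNReal.toReal_nonneg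
  have hVM : ∀ᵐ x, ‖(V x : ℂ)‖ ≤ M := by
    filter_upwards [ae_le_eLpNormEssSup (f := V) (μ := volume)] with x hx
    rw [Complex.norm_real, hM_def, ← toReal_enorm]
    refine ENNReal.toReal_mono hV.2.ne ?_
    rwa [eLpNorm_exponent_top]
  have hVC : MemLp (fun x => (V x : ℂ)) ∞ (volume : Measure (Space d)) := hV.ofReal
  have hs2 : 0 < s / 2 := half_pos hs
  have hS := isSelfAdjoint_heatOp hVC hM hVM hs2
  have hSS := heatOp_half_comp hVC hM hVM hs
  obtain ⟨κ, C, hC0, hκ, hκC⟩ := exists_isKernelVec_heatOp hVC hM hVM hs2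
  obtain ⟨hint, havg⟩ := tendsto_average_norm_sq hVC hM hVM hν hs hκ
  have hlim := (Complex.continuous_ofReal.tendsto _).comp
    (tendsto_weighted_integral hd0 hκ.meas hκC havg)
  have hg0 : ∀ (r : ℝ) (x : Space d), 0 < bracket x ^ (-(d * r)) := fun r x => bracket_rpow_pos _ x
  have hp : ∀ r : ℝ, 1 < r → (0 : ℝ) ≤ d * r := fun r hr =>
    mul_nonneg (Nat.cast_nonneg d) (by linarith)
  have hg1 : ∀ r : ℝ, 1 < r → ∀ x : Space d, bracket x ^ (-(d * r)) ≤ 1 := fun r hr x =>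
    bracket_rpow_neg_le_one (hp r hr) x
  have hgi : ∀ r : ℝ, 1 < r → Integrable fun x : Space d => bracket x ^ (-(d * r)) :=
    fun r hr => integrable_bracket_rpow hd0 hr
  refine ⟨hint, ⟨_, hSS ▸ hκ.isIntegralKernel_sq hS⟩, fun K hK => ?_, fun r hr => ?_, ?_⟩
  · rw [← hSS] at hK
    have hdiag := hκ.ae_kernelDiag hS hκC hK
    have hcongr : ∀ r : ℝ, (fun x : Space d => ((bracket x ^ (-(d * r)) : ℝ) : ℂ) * kernelDiag K x)
        =ᵐ[volume] fun x => ((bracket x ^ (-(d * r)) * ‖κ x‖ ^ 2 : ℝ) : ℂ) := fun r => by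
      filter_upwards [hdiag] with x hx
      rw [hx.2, Complex.ofReal_mul]
    refine ⟨hdiag.mono fun x hx => hx.1, fun r hr => ?_, ?_⟩
    · refine Integrable.congr (Integrable.ofReal ?_) (hcongr r).symm
      refine Integrable.mul_bdd (c := C ^ 2) (hgi r hr) (hκ.meas.norm.pow 2) ?_
      filter_upwards [hκC] with x hx
      rw [Real.norm_eq_abs, abs_of_nonneg (sq_nonneg _)]
      exact pow_le_pow_left₀ (norm_nonneg _) hx 2
    -- The two integrals agree for every `r`, so integrability plays no role in this identification.
    · refine hlim.congr fun r => ?_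
      rw [integral_congr_ae (hcongr r), integral_complex_ofReal, Function.comp_apply]
      push_cast
      rfl
  · obtain ⟨C', hC'0, hC', -⟩ := hκ.exists_norm_mulOp_le hVC hM hVM hs2 (hp r hr)
    rw [← hSS]
    -- One constant must serve both the bound on `κ` and the weighted bound.
    refine isTraceClass_comp_mulOp hS hκ (C := max C C') (hC0.trans (le_max_left _ _)) ?_
      (hg0 r) (hg1 r hr) (hgi r hr) fun f => ?_
    · exact hκC.mono fun x hx => hx.trans (le_max_left _ _)
    · filter_upwards [hC' f] with x hx
      refine hx.trans ?_
      have := (hg0 r x).le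
      gcongr
      exact le_max_right _ _
  -- Unlike for the integral, the trace is identified only for `r > 1`, where the weight is
  -- integrable.
  · refine hlim.congr' ?_
    filter_upwards [self_mem_nhdsWithin] with r hr
    have hr : 1 < r := hr
    obtain ⟨C', hC'0, -, hC'⟩ := hκ.exists_norm_mulOp_le hVC hM hVM hs2 (hp r hr)
    rw [← hSS, trace_comp_mulOp hS hκ (C := max C C')
      (hκC.mono fun x hx => hx.trans (le_max_left _ _)) (fun x => (hg0 r x).le) (hg1 r hr)
      (hgi r hr) (hC'.mono fun x hx => hx.trans
        (mul_le_mul_of_nonneg_right (le_max_right _ _) (hg0 r x).le)), Function.comp_apply]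
    push_cast
    rfl
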